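/- Let $(Q,\mathfrak m,k)$ be a regular local ring whose residue field $k$ is algebraically closed, let $f=f_1,\dots,f_c$ be a regular sequence contained in $\mathfrak m^2$, and let $R=Q/(f_1,\dots,f_c)$. A complex $C$ of $R$-modules is totally acyclic if every $C_n$ is a finitely generated free $R$-module and both $C$ and $\operatorname{Hom}_R(C,R)$ are exact. Let $K_{\mathrm{tac}}(R)$ be the full subcategory of totally acyclic complexes in the homotopy category of complexes of $R$-modules, with shift $\Sigma$, $(\Sigma^iC)_n=C_{n-i}$; write $\operatorname{Hom}_R(C,D)$ for its morphisms (homotopy classes of chain maps). A triangle of $K_{\mathrm{tac}}(R)$ is exact if it is isomorphic in the homotopy category to a mapping cone triangle $A\xrightarrow{\alpha}B\to\operatorname{Cone}(\alpha)\to\Sigma A$. A totally acyclic complex $D$ is a complete resolution of an $R$-module $M$ if, for some projective resolution $P$ of $M$ and some $i$, the truncated complexes $D_{>i}$ and $P_{>i}$ (terms of degree $\le i$ replaced by $0$) are homotopy equivalent. For $C\in K_{\mathrm{tac}}(R)$ lift the terms and differentials of $C$ to free $Q$-modules and $Q$-linear maps $\widetilde d_n:\widetilde C_n\to\widetilde C_{n-1}$,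 and write $\widetilde d_{n-1}\widetilde d_n=\sum_{l=1}^c f_l\,\widetilde t_{l,n}$. The maps $\widetilde t_{l,n}\otimes_QR$ form a chain map $t_l:C\to\Sigma^2C$, which is unique up to homotopy, and $t_lt_j\sim t_jt_l$. Through composition with these maps, $\chi_l$ acting as $\alpha\mapsto \Sigma^{2}(\alpha)\circ t_l$, $\bigoplus_{i\ge0}\operatorname{Hom}_R(C,\Sigma^iD)$ is a module over $R[\chi_1,\dots,\chi_c]$. Put $E(C,D)=\bigl(\bigoplus_{i\ge0}\operatorname{Hom}_R(C,\Sigma^iD)\bigr)\otimes_Rk$, a $k[\chi_1,\dots,\chi_c]$-module, and define the support variety $$V(C,D)=\{b\in k^c:\ \varphi(b)=0\ \text{for all}\ \varphi\in\operatorname{Ann}_{k[\chi_1,\dots,\chi_c]}E(C,D)\}\cup\{0\}.$$ Then the following hold for all $C,D\in K_{\mathrm{tac}}(R)$. 1. If $D$ is a complete resolution of $k$, then $V(D,D)=k^c$. 2. $V(C,D)=V(C,C)\cap V(D,D)$. 3. If $D$ is a complete resolution of $k$, then $V(C,D)=V(C,C)$. 4. If $C\to C'\to C''\to\Sigma C$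 and $D\to D'\to D''\to\Sigma D$ are exact triangles in $K_{\mathrm{tac}}(R)$, then $$V(C,D)\subseteq V(C',D)\cup V(C'',D),\quad V(C',D)\subseteq V(C,D)\cup V(C'',D),\quad V(C'',D)\subseteq V(C,D)\cup V(C',D),$$ $$V(C,D)\subseteq V(C,D')\cup V(C,D''),\quad V(C,D')\subseteq V(C,D)\cup V(C,D''),\quad V(C,D'')\subseteq V(C,D)\cup V(C,D').$$ -/

import Mathlib

universe u

namespace TotallyAcyclicVariety

open CategoryTheory

section Algebra

/-- If `∑ fₗ yₗ = 0` for a regular sequence `f`, then every `yₗ` lies in the ideal `(f)`. -/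
theorem mem_span_of_sum_mul_eq_zero {Q : Type u} [CommRing Q] : ∀ {c : ℕ} (f : Fin c → Q),
    RingTheory.Sequence.IsWeaklyRegular Q (List.ofFn f) → ∀ y : Fin c → Q,
    ∑ l, f l * y l = 0 → ∀ l, y l ∈ Ideal.span (Set.range f)
  | 0, _, _, _, _, l => l.elim0
  | c + 1, f, hf, y, hy, l => by
    set g : Fin c → Q := fun i => f i.castSucc with hg
    rw [List.ofFn_succ', List.concat_eq_append,
      RingTheory.Sequence.isWeaklyRegular_append_iff,
      RingTheory.Sequence.isWeaklyRegular_singleton_iff] at hf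
    obtain ⟨h1, h2⟩ := hf
    have hI : Ideal.ofList (List.ofFn g) = Ideal.span (Set.range g) := by
      simp [Ideal.ofList, List.mem_ofFn, Set.range]
    have hle : Ideal.span (Set.range g) ≤ Ideal.span (Set.range f) :=
      Ideal.span_mono (by rintro _ ⟨i, rfl⟩; exact ⟨i.castSucc, rfl⟩)
    rw [Fin.sum_univ_castSucc] at hy
    have hlast : y (Fin.last c) ∈ Ideal.span (Set.range g) := by
      have h3 := isSMulRegular_iff_right_eq_zero_of_smul.1 h2
        (Submodule.Quotient.mk (y (Fin.last c))) (by
          rw [← Submodule.Quotient.mk_smul, Submodule.Quotient.mk_eq_zero, smul_eq_mul]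
          change _ ∈ Ideal.ofList (List.ofFn g) • (⊤ : Ideal Q)
          rw [smul_eq_mul, Ideal.mul_top, hI, smul_eq_mul, eq_neg_of_add_eq_zero_right hy]
          exact neg_mem (sum_mem fun i _ => Ideal.mul_mem_right _ _
            (Ideal.subset_span ⟨i, rfl⟩)))
      rw [Submodule.Quotient.mk_eq_zero] at h3
      change _ ∈ Ideal.ofList (List.ofFn g) • (⊤ : Ideal Q) at h3
      rwa [smul_eq_mul, Ideal.mul_top, hI] at h3
    obtain ⟨a, ha⟩ := (Submodule.mem_span_range_iff_exists_fun Q).1 hlast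
    have h4 := mem_span_of_sum_mul_eq_zero g h1
      (fun i => y i.castSucc + f (Fin.last c) * a i) (by
        rw [← hy, ← ha, Finset.mul_sum, ← Finset.sum_add_distrib]
        refine Finset.sum_congr rfl fun i _ => ?_
        simp only [smul_eq_mul, hg]; ring)
    induction l using Fin.lastCases with
    | last => exact hle hlast
    | cast i =>
      have h5 := hle (h4 i)
      have h6 : f (Fin.last c) * a i ∈ Ideal.span (Set.range f) :=
        Ideal.mul_mem_right _ _ (Ideal.subset_span ⟨_, rfl⟩)
      simpa using sub_mem h5 h6

theorem mem_smul_top_of_sum_smul_eq_zero {Q : Type u} [CommRing Q] {c : ℕ} {f : Fin c → Q}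
    (hf : RingTheory.Sequence.IsWeaklyRegular Q (List.ofFn f))
    {M : Type u} [AddCommGroup M] [Module Q M] [Module.Free Q M]
    (y : Fin c → M) (hy : ∑ l, f l • y l = 0) (l : Fin c) :
    y l ∈ Ideal.span (Set.range f) • (⊤ : Submodule Q M) := by
  let b := Module.Free.chooseBasis Q M
  rw [← b.linearCombination_repr (y l), Finsupp.linearCombination_apply]
  refine sum_mem fun i _ => Submodule.smul_mem_smul ?_ trivial
  refine mem_span_of_sum_mul_eq_zero f hf (fun l => b.repr (y l) i) ?_ l
  simpa [map_sum, Finsupp.finsetSum_apply] using congrArg (fun z => b.repr z i) hy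

theorem mem_span_range_smul_top_iff {Q : Type u} [CommRing Q] {c : ℕ} {f : Fin c → Q}
    {M : Type u} [AddCommGroup M] [Module Q M] (x : M) :
    x ∈ Ideal.span (Set.range f) • (⊤ : Submodule Q M) ↔ ∃ y : Fin c → M, x = ∑ l, f l • y l := by
  constructor
  · intro hx
    induction hx using Submodule.smul_induction_on' with
    | smul r hr n _ =>
      obtain ⟨a, rfl⟩ := (Submodule.mem_span_range_iff_exists_fun Q).1 hr
      exact ⟨fun l => a l • n, by
        rw [Finset.sum_smul]
        exact Finset.sum_congr rfl fun l _ => by rw [smul_eq_mul, mul_comm, mul_smul]⟩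
    | add x _ x' _ h h' =>
      obtain ⟨y, rfl⟩ := h
      obtain ⟨y', rfl⟩ := h'
      exact ⟨y + y', by simp [Finset.sum_add_distrib]⟩
  · rintro ⟨y, rfl⟩
    exact sum_mem fun l _ => Submodule.smul_mem_smul (Ideal.subset_span ⟨l, rfl⟩) trivial

theorem exists_linearMap_decomposition {Q : Type u} [CommRing Q] {c : ℕ} {f : Fin c → Q}
    {F G : Type u} [AddCommGroup F] [Module Q F] [Module.Free Q F] [AddCommGroup G] [Module Q G]
    (g : F →ₗ[Q] G) (hg : ∀ x, g x ∈ Ideal.span (Set.range f) • (⊤ : Submodule Q G)) :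
    ∃ t : Fin c → F →ₗ[Q] G, ∀ x, g x = ∑ l, f l • t l x := by
  let b := Module.Free.chooseBasis Q F
  choose y hy using fun i => (mem_span_range_smul_top_iff (g (b i))).1 (hg (b i))
  refine ⟨fun l => b.constr Q fun i => y i l, fun x => ?_⟩
  have : g = ∑ l, f l • (b.constr Q fun i => y i l : F →ₗ[Q] G) :=
    b.ext fun i => by simp [hy, LinearMap.sum_apply]
  simpa [LinearMap.sum_apply] using LinearMap.congr_fun this x

theorem exists_linearMap_lift {Q R : Type u} [CommRing Q] [CommRing R] [Algebra Q R]
    {F G N : Type u} [AddCommGroup F] [Module Q F] [Module.Free Q F] [AddCommGroup G] [Module Q G]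
    [AddCommGroup N] [Module R N] (π : G →ₛₗ[algebraMap Q R] N) (hπ : Function.Surjective π)
    (φ : F →ₛₗ[algebraMap Q R] N) : ∃ g : F →ₗ[Q] G, ∀ x, π (g x) = φ x := by
  let b := Module.Free.chooseBasis Q F
  choose y hy using fun i => hπ (φ (b i))
  refine ⟨b.constr Q y, fun x => ?_⟩
  have : π.comp (b.constr Q y : F →ₗ[Q] G) = φ := b.ext fun i => by simp [hy]
  exact LinearMap.congr_fun this x

theorem exists_linearMap_descend {Q R : Type u} [CommRing Q] [CommRing R] [Algebra Q R]
    (hQR : Function.Surjective (algebraMap Q R))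
    {F G M N : Type u} [AddCommGroup F] [Module Q F] [AddCommGroup G] [Module Q G]
    [AddCommGroup M] [Module R M] [AddCommGroup N] [Module R N]
    (π : F →ₛₗ[algebraMap Q R] M) (hπ : Function.Surjective π)
    (hπk : LinearMap.ker π = RingHom.ker (algebraMap Q R) • (⊤ : Submodule Q F))
    (π' : G →ₛₗ[algebraMap Q R] N) (g : F →ₗ[Q] G) :
    ∃ h : M →ₗ[R] N, ∀ x, h (π x) = π' (g x) := by
  have key : ∀ x, π x = 0 → π' (g x) = 0 := by
    intro x hx
    have hx' : x ∈ RingHom.ker (algebraMap Q R) • (⊤ : Submodule Q F) := by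
      rw [← hπk]; exact hx
    induction hx' using Submodule.smul_induction_on' with
    | smul r hr n _ =>
      rw [map_smul, LinearMap.map_smulₛₗ, (RingHom.mem_ker).1 hr, zero_smul]
    | add x hx1 x' hx2 h h' =>
      rw [← hπk] at hx1 hx2
      rw [map_add, map_add, h hx1, h' hx2, add_zero]
  have key' : ∀ x y, π x = π y → π' (g x) = π' (g y) := by
    intro x y hxy
    have := key (x - y) (by rw [map_sub, hxy, sub_self])
    rwa [map_sub, map_sub, sub_eq_zero] at this
  refine ⟨{ toFun := fun m => π' (g (Function.surjInv hπ m)), map_add' := ?_, map_smul' := ?_ },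
    fun x => key' _ _ (Function.surjInv_eq hπ _)⟩
  · intro x y
    rw [← map_add, ← map_add]
    exact key' _ _ (by simp only [map_add, Function.surjInv_eq hπ])
  · intro r x
    obtain ⟨q, rfl⟩ := hQR r
    rw [RingHom.id_apply, ← LinearMap.map_smulₛₗ, ← map_smul]
    exact key' _ _ (by simp only [LinearMap.map_smulₛₗ, Function.surjInv_eq hπ])

end Algebra

/-- The `Q`-algebra `R` is `Q / (f₁, …, f_c)` (the structure map `Q → R` is surjective with kernel
the ideal generated by the `fₗ`), where `f₁, …, f_c` is a regular sequence contained in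
the square of the maximal ideal of the local ring `Q`. -/
structure IsCompleteIntersection {Q : Type u} [CommRing Q] [IsLocalRing Q] {c : ℕ} (f : Fin c → Q)
    (R : Type u) [CommRing R] [Algebra Q R] : Prop where
  surjective : Function.Surjective (algebraMap Q R)
  ker_eq : RingHom.ker (algebraMap Q R) = Ideal.span (Set.range f)
  isRegular : RingTheory.Sequence.IsRegular Q (List.ofFn f)
  mem_sq : ∀ l, f l ∈ IsLocalRing.maximalIdeal Q ^ 2

/-- Totally acyclic complexes of `R`-modules: finitely generated free terms, exact, and with exact
`R`-dual. Complexes are indexed cohomologically, `C.X n` being the term `C_{-n}` in homological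
notation; the shift `⟦i⟧` is then `Σ^i`. -/
structure IsTotallyAcyclic {R : Type u} [CommRing R] (C : CochainComplex (ModuleCat.{u} R) ℤ) :
    Prop where
  free : ∀ n, Module.Free R (C.X n)
  finite : ∀ n, Module.Finite R (C.X n)
  acyclic : C.Acyclic
  dual_exact : ∀ i j k : ℤ, i + 1 = j → j + 1 = k →
    Function.Exact (LinearMap.dualMap (C.d j k).hom) (LinearMap.dualMap (C.d i j).hom)

/-- A lift to `Q` of (the underlying sequence of maps of) a complex `C` of `R`-modules, for `R` a
quotient of `Q`: free `Q`-modules `X n` with surjections `π n : X n → C.X n` with kernel `I • X n`,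
`I = ker (Q → R)` (so that `X n ⊗_Q R ≅ C.X n`), and `Q`-linear maps `d : X i → X j`, for
`i + 1 = j`, reducing to the differentials of `C`. No condition is imposed on `d i j` when
`i + 1 ≠ j`, and these maps are never used. The maps `d` need not compose to zero. -/
structure FreeLift (Q : Type u) [CommRing Q] {R : Type u} [CommRing R] [Algebra Q R]
    (C : CochainComplex (ModuleCat.{u} R) ℤ) where
  X : ℤ → Type u
  [addCommGroup : ∀ n, AddCommGroup (X n)]
  [module : ∀ n, Module Q (X n)]
  [free : ∀ n, Module.Free Q (X n)]
  [finite : ∀ n, Module.Finite Q (X n)]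
  π : ∀ n, X n →ₛₗ[algebraMap Q R] C.X n
  π_surjective : ∀ n, Function.Surjective (π n)
  ker_π : ∀ n, LinearMap.ker (π n) = RingHom.ker (algebraMap Q R) • (⊤ : Submodule Q (X n))
  d : ∀ i j : ℤ, X i →ₗ[Q] X j
  π_d : ∀ i j : ℤ, i + 1 = j → ∀ x, π j (d i j x) = (C.d i j).hom (π i x)

attribute [instance] FreeLift.addCommGroup FreeLift.module FreeLift.free FreeLift.finite

/-- A decomposition `d ∘ d = ∑ fₗ tₗ` of the square of the lifted differential. Only the maps
`t l i k` with `i + 2 = k` are used. -/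
structure FreeLift.Decomposition {Q : Type u} [CommRing Q] {R : Type u} [CommRing R] [Algebra Q R]
    {C : CochainComplex (ModuleCat.{u} R) ℤ} (L : FreeLift Q C) {c : ℕ} (f : Fin c → Q) where
  t : Fin c → ∀ i k : ℤ, L.X i →ₗ[Q] L.X k
  d_d : ∀ i j k : ℤ, i + 1 = j → j + 1 = k → ∀ x, L.d j k (L.d i j x) = ∑ l, f l • t l i k x

/-- The chain maps `τₗ : C ⟶ Σ²C` are the reductions `tₗ ⊗_Q R`, for some lift of `C` to `Q` and
some decomposition `d ∘ d = ∑ fₗ tₗ`. -/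
def IsEisenbudFamily {Q : Type u} [CommRing Q] {R : Type u} [CommRing R] [Algebra Q R]
    {c : ℕ} (f : Fin c → Q) {C : CochainComplex (ModuleCat.{u} R) ℤ}
    (τ : Fin c → (C ⟶ C⟦(2 : ℤ)⟧)) : Prop :=
  ∃ (L : FreeLift Q C) (T : L.Decomposition f), ∀ (l : Fin c) (i : ℤ) (x : L.X i),
    ((τ l).f i).hom (L.π i x) = L.π (i + 2) (T.t l i (i + 2) x)

/-- The shifts of Eisenbud operators of `C` are Eisenbud operators of `C⟦2⟧`. -/
theorem IsEisenbudFamily.shift {Q : Type u} [CommRing Q] {R : Type u} [CommRing R] [Algebra Q R]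
    {c : ℕ} {f : Fin c → Q} {C : CochainComplex (ModuleCat.{u} R) ℤ}
    {τ : Fin c → (C ⟶ C⟦(2 : ℤ)⟧)} (hτ : IsEisenbudFamily f τ) :
    IsEisenbudFamily f (fun l => (τ l)⟦(2 : ℤ)⟧') := by
  obtain ⟨L, T, hτ⟩ := hτ
  refine ⟨{ X := fun n => L.X (n + 2), π := fun n => L.π (n + 2)
            π_surjective := fun n => L.π_surjective (n + 2)
            ker_π := fun n => L.ker_π (n + 2)
            d := fun i j => L.d (i + 2) (j + 2)
            π_d := fun i j hij x => ?_ },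
    { t := fun l i k => T.t l (i + 2) (k + 2)
      d_d := fun i j k hj hk x => T.d_d _ _ _ (by omega) (by omega) x },
    fun l i x => hτ l (i + 2) x⟩
  rw [CochainComplex.shiftFunctor_obj_d', Int.negOnePow_even 2 even_two, one_smul]
  exact L.π_d (i + 2) (j + 2) (by omega) x

section

variable {Q : Type u} [CommRing Q] [IsLocalRing Q] {R : Type u} [CommRing R] [Algebra Q R]
    {c : ℕ} {f : Fin c → Q}

/-- Eisenbud operators exist as chain maps. -/
theorem exists_isEisenbudFamily (hf : IsCompleteIntersection f R) {C : CochainComplex (ModuleCat.{u} R) ℤ}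
    (hfree : ∀ n, Module.Free R (C.X n)) (hfin : ∀ n, Module.Finite R (C.X n)) :
    ∃ τ : Fin c → (C ⟶ C⟦(2 : ℤ)⟧), IsEisenbudFamily f τ := by
  have hlift : ∃ L : FreeLift Q C, True := by
    let ι : ℤ → Type u := fun n => Module.Free.ChooseBasisIndex R (C.X n)
    let b : ∀ n, Module.Basis (ι n) R (C.X n) := fun n => Module.Free.chooseBasis R (C.X n)
    let π : ∀ n, (ι n → Q) →ₛₗ[algebraMap Q R] C.X n := fun n =>
      { toFun := fun v => ∑ i, algebraMap Q R (v i) • b n i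
        map_add' := fun v w => by simp [add_smul, Finset.sum_add_distrib]
        map_smul' := fun r v => by simp [mul_smul, Finset.smul_sum] }
    have hπ : ∀ n, Function.Surjective (π n) := fun n m => by
      choose v hv using fun i => hf.surjective ((b n).repr m i)
      refine ⟨v, ?_⟩
      change ∑ i, algebraMap Q R (v i) • b n i = m
      simp only [hv]
      exact (b n).sum_repr m
    have hk : ∀ n, LinearMap.ker (π n) =
        RingHom.ker (algebraMap Q R) • (⊤ : Submodule Q (ι n → Q)) := fun n => by
      ext v
      constructor
      · intro hv
        have hv' : ∑ i, algebraMap Q R (v i) • b n i = 0 := hv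
        have h0 := Fintype.linearIndependent_iff.1 (b n).linearIndependent _ hv'
        rw [pi_eq_sum_univ' v]
        exact sum_mem fun i _ => Submodule.smul_mem_smul (RingHom.mem_ker.2 (h0 i)) trivial
      · intro hv
        induction hv using Submodule.smul_induction_on' with
        | smul r hr w _ =>
          rw [LinearMap.mem_ker, LinearMap.map_smulₛₗ, RingHom.mem_ker.1 hr, zero_smul]
        | add x _ y _ hx hy => exact add_mem hx hy
    choose d hd using fun i j : ℤ => exists_linearMap_lift (π j) (hπ j)
      ((C.d i j).hom.comp (π i))
    exact ⟨{ X := fun n => ι n → Q, π := π, π_surjective := hπ, ker_π := hk, d := d,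
             π_d := fun i j _ x => hd i j x }, trivial⟩
  obtain ⟨L, -⟩ := hlift
  have hdec : ∃ t : Fin c → ∀ i k : ℤ, L.X i →ₗ[Q] L.X k, ∀ i j k : ℤ, i + 1 = j → j + 1 = k →
      ∀ x, L.d j k (L.d i j x) = ∑ l, f l • t l i k x := by
    have h := fun i k : ℤ => exists_linearMap_decomposition (f := f)
      (if i + 1 + 1 = k then (L.d (i + 1) k).comp (L.d i (i + 1)) else 0) (fun x => by
        split_ifs with hk
        · rw [← hf.ker_eq, ← L.ker_π, LinearMap.mem_ker, LinearMap.comp_apply,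
            L.π_d _ _ hk, L.π_d _ _ rfl, ← ModuleCat.comp_apply, C.d_comp_d]
          rfl
        · exact zero_mem _)
    choose t ht using h
    refine ⟨fun l i k => t i k l, ?_⟩
    rintro i _ k rfl hk x
    rw [← ht, if_pos hk]; rfl
  obtain ⟨t, ht⟩ := hdec
  choose τ hτ using fun l i => exists_linearMap_descend hf.surjective (L.π i) (L.π_surjective i)
    (L.ker_π i) (L.π (i + 2)) (t l i (i + 2))
  refine ⟨fun l => ⟨fun i => ModuleCat.ofHom (τ l i), ?_⟩, L, ⟨t, ht⟩, fun l i x => hτ l i x⟩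
  rintro i _ rfl
  ext y
  obtain ⟨x, rfl⟩ := L.π_surjective i y
  rw [CochainComplex.shiftFunctor_obj_d', Int.negOnePow_even 2 even_two, one_smul]
  change (C.d (i + 2) (i + 1 + 2)).hom (τ l i (L.π i x)) =
    τ l (i + 1) ((C.d i (i + 1)).hom (L.π i x))
  rw [hτ, ← L.π_d i (i + 1) rfl, hτ, ← L.π_d _ _ (by ring), ← sub_eq_zero, ← map_sub,
    ← LinearMap.mem_ker, L.ker_π, hf.ker_eq]
  refine mem_smul_top_of_sum_smul_eq_zero hf.isRegular.toIsWeaklyRegular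
    (fun l => L.d (i + 2) (i + 1 + 2) (t l i (i + 2) x) -
      t l (i + 1) (i + 1 + 2) (L.d i (i + 1) x)) ?_ l
  simp only [smul_sub, Finset.sum_sub_distrib]
  rw [← ht (i + 1) (i + 2) (i + 1 + 2) (by ring) (by ring), ht i (i + 1) (i + 2) rfl (by ring)]
  simp


/-- Eisenbud operators are natural up to homotopy. -/
theorem IsEisenbudFamily.homotopy (hf : IsCompleteIntersection f R)
    {C D : CochainComplex (ModuleCat.{u} R) ℤ}
    {τ : Fin c → (C ⟶ C⟦(2 : ℤ)⟧)} (hτ : IsEisenbudFamily f τ)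
    {σ : Fin c → (D ⟶ D⟦(2 : ℤ)⟧)} (hσ : IsEisenbudFamily f σ) (ψ : C ⟶ D) (l : Fin c) :
    Nonempty (Homotopy (τ l ≫ ψ⟦(2 : ℤ)⟧') (ψ ≫ σ l)) := by
  obtain ⟨L, T, hτ⟩ := hτ
  obtain ⟨M, S, hσ⟩ := hσ
  choose p hp using fun i => exists_linearMap_lift (M.π i) (M.π_surjective i)
    ((ψ.f i).hom.comp (L.π i))
  replace hp : ∀ i x, M.π i (p i x) = (ψ.f i).hom (L.π i x) := hp
  have hcomm : ∀ i j x, (ψ.f j).hom ((C.d i j).hom x) = (D.d i j).hom ((ψ.f i).hom x) :=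
    fun i j x => (congrArg (fun g => g.hom x) (ψ.comm i j)).symm
  choose r' hr' using fun i j : ℤ => exists_linearMap_decomposition (f := f)
    (if i + 1 = j then (p j).comp (L.d i j) - (M.d i j).comp (p i) else 0) (fun x => by
      split_ifs with hj
      · rw [← hf.ker_eq, ← M.ker_π, LinearMap.mem_ker, LinearMap.sub_apply, map_sub,
          LinearMap.comp_apply, LinearMap.comp_apply, hp, L.π_d _ _ hj, M.π_d _ _ hj, hp, hcomm,
          sub_self]
      · exact zero_mem _)
  have hr : ∀ i j : ℤ, i + 1 = j → ∀ x,
      p j (L.d i j x) - M.d i j (p i x) = ∑ l, f l • r' i j l x := by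
    intro i j hj x
    rw [← hr', if_pos hj]; rfl
  have key : ∀ i j k : ℤ, i + 1 = j → j + 1 = k → ∀ l x,
      M.π k (p k (T.t l i k x)) - M.π k (S.t l i k (p i x)) =
        M.π k (r' j k l (L.d i j x)) + M.π k (M.d j k (r' i j l x)) := by
    intro i j k hj hk l x
    rw [← sub_eq_zero, ← map_sub, ← map_add, ← map_sub, ← LinearMap.mem_ker, M.ker_π, hf.ker_eq]
    refine mem_smul_top_of_sum_smul_eq_zero hf.isRegular.toIsWeaklyRegular
      (fun l => p k (T.t l i k x) - S.t l i k (p i x) -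
        (r' j k l (L.d i j x) + M.d j k (r' i j l x))) ?_ l
    have e1 : ∑ l, f l • p k (T.t l i k x) = p k (L.d j k (L.d i j x)) := by
      rw [T.d_d i j k hj hk]; simp
    have e4 : ∑ l, f l • M.d j k (r' i j l x) =
        M.d j k (p j (L.d i j x) - M.d i j (p i x)) := by
      rw [hr i j hj]; simp
    simp only [smul_sub, smul_add, Finset.sum_sub_distrib, Finset.sum_add_distrib]
    rw [e1, e4, ← S.d_d i j k hj hk, ← hr j k hk, map_sub]
    abel
  choose h hh using fun l i j => exists_linearMap_descend hf.surjective (L.π i)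
    (L.π_surjective i) (L.ker_π i) (M.π j) (r' i j l)
  obtain ⟨H, hH, hH0⟩ : ∃ H : ∀ i j : ℤ, C.X i →ₗ[R] D.X (j + 2),
      (∀ j y, H (j + 1) j y = h l (j + 1) (j + 2) y) ∧ ∀ i j, ¬ j + 1 = i → H i j = 0 :=
    ⟨fun i j => if j + 1 = i then h l i (j + 2) else 0,
      fun j y => by simp, fun i j hij => if_neg hij⟩
  obtain ⟨H', hH'⟩ : ∃ H' : ∀ i j : ℤ, C.X i ⟶ (D⟦(2 : ℤ)⟧).X j,
      ∀ i j, H' i j = (ModuleCat.ofHom (H i j) : C.X i ⟶ D.X (j + 2)) := ⟨_, fun _ _ => rfl⟩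
  refine ⟨{ hom := H'
            zero := fun i j hij => by rw [hH', hH0 i j hij]; rfl
            comm := fun i => ?_ }⟩
  obtain ⟨i', rfl⟩ : ∃ i', i = i' + 1 := ⟨i - 1, by ring⟩
  rw [dNext_eq _ (show (ComplexShape.up ℤ).Rel (i' + 1) (i' + 1 + 1) from rfl),
    prevD_eq _ (show (ComplexShape.up ℤ).Rel i' (i' + 1) from rfl),
    CochainComplex.shiftFunctor_obj_d', Int.negOnePow_even 2 even_two, one_smul, hH', hH']
  ext y
  obtain ⟨x, rfl⟩ := L.π_surjective _ y
  let σ' : ∀ i, D.X i →ₗ[R] D.X (i + 2) := fun i => ((σ l).f i).hom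
  have hσ' : ∀ i x, σ' i (M.π i x) = M.π (i + 2) (S.t l i (i + 2) x) := fun i x => hσ l i x
  change (ψ.f (i' + 1 + 2)).hom (((τ l).f (i' + 1)).hom (L.π (i' + 1) x)) =
    H (i' + 1 + 1) (i' + 1) ((C.d (i' + 1) (i' + 1 + 1)).hom (L.π (i' + 1) x)) +
    (D.d (i' + 2) (i' + 1 + 2)).hom (H (i' + 1) i' (L.π (i' + 1) x)) +
    σ' (i' + 1) ((ψ.f (i' + 1)).hom (L.π (i' + 1) x))
  rw [hH, hH, hτ, ← hp, ← hp, hσ', ← L.π_d _ _ rfl, hh, hh, ← M.π_d _ _ (by ring)]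
  have e : i' + 2 = i' + 1 + 1 := by ring
  have := key (i' + 1) (i' + 1 + 1) (i' + 1 + 2) rfl (by ring) l x
  rw [sub_eq_iff_eq_add] at this
  rw [this, e]

/-- Eisenbud operators commute in the homotopy category. -/
theorem IsEisenbudFamily.comm (hf : IsCompleteIntersection f R) {C : CochainComplex (ModuleCat.{u} R) ℤ}
    {τ : Fin c → (C ⟶ C⟦(2 : ℤ)⟧)} (hτ : IsEisenbudFamily f τ) (l m : Fin c) :
    (ShiftedHom.map (τ l) (HomotopyCategory.quotient (ModuleCat.{u} R) (ComplexShape.up ℤ))).comp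
      (ShiftedHom.map (τ m) (HomotopyCategory.quotient (ModuleCat.{u} R) (ComplexShape.up ℤ)))
      (show (2 : ℤ) + 2 = 4 by norm_num) =
    (ShiftedHom.map (τ m) (HomotopyCategory.quotient (ModuleCat.{u} R) (ComplexShape.up ℤ))).comp
      (ShiftedHom.map (τ l) (HomotopyCategory.quotient (ModuleCat.{u} R) (ComplexShape.up ℤ)))
      (show (2 : ℤ) + 2 = 4 by norm_num) := by
  obtain ⟨h⟩ := hτ.homotopy hf hτ.shift (τ m) l
  rw [← ShiftedHom.map_comp, ← ShiftedHom.map_comp]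
  have := HomotopyCategory.eq_of_homotopy _ _ h
  simp only [ShiftedHom.comp, ShiftedHom.map, Functor.map_comp, Category.assoc] at this ⊢
  rw [reassoc_of% this]

end

/-- The homotopy category of (unbounded) complexes of `R`-modules. -/
abbrev K (R : Type u) [CommRing R] := HomotopyCategory (ModuleCat.{u} R) (ComplexShape.up ℤ)

/-- The objects of `K_tac(R)`: totally acyclic complexes of `R`-modules. The category `K_tac(R)` is
the corresponding full subcategory of the homotopy category of complexes. -/
structure Ktac (R : Type u) [CommRing R] where
  complex : CochainComplex (ModuleCat.{u} R) ℤ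
  property : IsTotallyAcyclic complex

/-- A totally acyclic complex as an object of the homotopy category. -/
abbrev Ktac.obj {R : Type u} [CommRing R] (C : Ktac R) : K R :=
  (HomotopyCategory.quotient (ModuleCat.{u} R) (ComplexShape.up ℤ)).obj C.complex

section

variable {Q : Type u} [CommRing Q] [IsLocalRing Q] {R : Type u} [CommRing R] [Algebra Q R]
    {c : ℕ} {f : Fin c → Q}

/-- The Eisenbud operator `tₗ : C ⟶ Σ²C` of `C ∈ K_tac(R)`, a homotopy class of chain maps. It does
not depend on the lift or the decomposition chosen, see `eisenbudOperator_eq`. -/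
noncomputable def eisenbudOperator (hf : IsCompleteIntersection f R) (C : Ktac R) (l : Fin c) :
    ShiftedHom C.obj C.obj (2 : ℤ) :=
  ShiftedHom.map ((exists_isEisenbudFamily hf C.property.free C.property.finite).choose l)
    (HomotopyCategory.quotient (ModuleCat.{u} R) (ComplexShape.up ℤ))

theorem eisenbudOperator_eq (hf : IsCompleteIntersection f R) (C : Ktac R)
    {τ : Fin c → (C.complex ⟶ C.complex⟦(2 : ℤ)⟧)} (hτ : IsEisenbudFamily f τ) (l : Fin c) :
    eisenbudOperator hf C l =
      ShiftedHom.map (τ l) (HomotopyCategory.quotient (ModuleCat.{u} R) (ComplexShape.up ℤ)) := by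
  obtain ⟨h⟩ := IsEisenbudFamily.homotopy hf
    (exists_isEisenbudFamily hf C.property.free C.property.finite).choose_spec hτ (𝟙 _) l
  have e := HomotopyCategory.eq_of_homotopy _ _ h
  rw [Category.id_comp, (shiftFunctor (CochainComplex (ModuleCat.{u} R) ℤ) (2 : ℤ)).map_id,
    Category.comp_id] at e
  exact congrArg (· ≫ _) e

theorem eisenbudOperator_comm (hf : IsCompleteIntersection f R) (C : Ktac R) (l m : Fin c) :
    (eisenbudOperator hf C l).comp (eisenbudOperator hf C m) (show (2 : ℤ) + 2 = 4 by norm_num) =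
    (eisenbudOperator hf C m).comp (eisenbudOperator hf C l) (show (2 : ℤ) + 2 = 4 by norm_num) :=
  (exists_isEisenbudFamily hf C.property.free C.property.finite).choose_spec.comm hf l m

/-- The `R`-module `⨁_{i ≥ 0} Hom(C, Σⁱ D)`, where `Hom` denotes homotopy classes of chain maps. -/
abbrev GradedHom (C D : Ktac R) : Type u :=
  DirectSum ℕ fun i => ShiftedHom C.obj D.obj (i : ℤ)

/-- The cohomology operator `χₗ`, of degree two, on `⨁_{i ≥ 0} Hom(C, Σⁱ D)`: composition with the
Eisenbud operator `tₗ : C ⟶ Σ²C`. -/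
noncomputable def cohomologyOperator (hf : IsCompleteIntersection f R) (C D : Ktac R) (l : Fin c) :
    Module.End R (GradedHom C D) :=
  DirectSum.toModule R ℕ _ fun i =>
    DirectSum.lof R ℕ (fun i => ShiftedHom C.obj D.obj (i : ℤ)) (i + 2) ∘ₗ
      { toFun := fun α => (eisenbudOperator hf C l).comp α (by push_cast; rfl)
        map_add' := fun α β => ShiftedHom.comp_add _ _ _ _
        map_smul' := fun r α => ShiftedHom.comp_smul r _ _ _ }

theorem cohomologyOperator_lof (hf : IsCompleteIntersection f R) (C D : Ktac R) (l : Fin c) (i : ℕ)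
    (α : ShiftedHom C.obj D.obj (i : ℤ)) :
    cohomologyOperator hf C D l (DirectSum.lof R ℕ (fun i => ShiftedHom C.obj D.obj (i : ℤ)) i α) =
      DirectSum.lof R ℕ (fun i => ShiftedHom C.obj D.obj (i : ℤ)) (i + 2)
        ((eisenbudOperator hf C l).comp α (by push_cast; rfl)) := by
  simp [cohomologyOperator]

theorem cohomologyOperator_comm (hf : IsCompleteIntersection f R) (C D : Ktac R) (l m : Fin c) :
    Commute (cohomologyOperator hf C D l) (cohomologyOperator hf C D m) := by
  refine DirectSum.linearMap_ext R fun i => LinearMap.ext fun α => ?_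
  simp only [LinearMap.comp_apply, Module.End.mul_apply, cohomologyOperator_lof]
  congr 1
  rw [← ShiftedHom.comp_assoc _ _ _ (show (2 : ℤ) + 2 = 4 by norm_num) _ (by push_cast; ring),
    ← ShiftedHom.comp_assoc _ _ _ (show (2 : ℤ) + 2 = 4 by norm_num) _ (by push_cast; ring),
    eisenbudOperator_comm]

variable [IsLocalRing R]

/-- The vector space `E = (⨁_{i ≥ 0} Hom(C, Σⁱ D)) ⊗_R k` over the residue field `k` of `R` (which is
also the residue field of `Q`). -/
abbrev ReducedGradedHom (C D : Ktac R) : Type u :=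
  TensorProduct R (IsLocalRing.ResidueField R) (GradedHom C D)

/-- The action of `χₗ` on `E`. -/
noncomputable def reducedOperator (hf : IsCompleteIntersection f R) (C D : Ktac R) (l : Fin c) :
    Module.End (IsLocalRing.ResidueField R) (ReducedGradedHom C D) :=
  (cohomologyOperator hf C D l).baseChange (IsLocalRing.ResidueField R)

theorem reducedOperator_comm (hf : IsCompleteIntersection f R) (C D : Ktac R) (l m : Fin c) :
    Commute (reducedOperator hf C D l) (reducedOperator hf C D m) := by
  rw [commute_iff_eq, reducedOperator, reducedOperator, ← LinearMap.baseChange_mul,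
    ← LinearMap.baseChange_mul, (cohomologyOperator_comm hf C D l m).eq]

/-- The action of `k[χ₁, …, χ_c]` on `E`, that is, the `k[χ₁, …, χ_c]`-module structure of `E`, in
which `χₗ` acts through the `l`-th cohomology operator. -/
noncomputable def polynomialAction (hf : IsCompleteIntersection f R) (C D : Ktac R) :
    MvPolynomial (Fin c) (IsLocalRing.ResidueField R) →ₐ[IsLocalRing.ResidueField R]
      Module.End (IsLocalRing.ResidueField R) (ReducedGradedHom C D) :=
  haveI := Algebra.isMulCommutative_adjoin (IsLocalRing.ResidueField R)
    (s := Set.range (reducedOperator hf C D))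
    (by rintro _ ⟨l, rfl⟩ _ ⟨m, rfl⟩; exact reducedOperator_comm hf C D l m)
  letI : CommSemiring (Algebra.adjoin (IsLocalRing.ResidueField R)
      (Set.range (reducedOperator hf C D))) := { Subalgebra.toSemiring _ with mul_comm := mul_comm' }
  (Algebra.adjoin (IsLocalRing.ResidueField R) (Set.range (reducedOperator hf C D))).val.comp
    (MvPolynomial.aeval fun l => ⟨reducedOperator hf C D l, Algebra.subset_adjoin ⟨l, rfl⟩⟩)

theorem polynomialAction_X (hf : IsCompleteIntersection f R) (C D : Ktac R) (l : Fin c) :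
    polynomialAction hf C D (MvPolynomial.X l) = reducedOperator hf C D l := by
  simp [polynomialAction]

/-- The support variety `V(Q, f, C, D)`: the zero set in `k^c` of the annihilator of the
`k[χ₁, …, χ_c]`-module `E`, together with the origin. -/
noncomputable def supportVariety (hf : IsCompleteIntersection f R) (C D : Ktac R) :
    Set (Fin c → IsLocalRing.ResidueField R) :=
  {b | ∀ φ ∈ RingHom.ker (polynomialAction hf C D), MvPolynomial.eval b φ = 0} ∪ {0}

end

/-- `C` is a complete resolution of the module `M`: for some projective resolution `P` of `M` and
some degree `i`, the truncations `C_{>i}` and `P_{>i}` (the subquotients obtained by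
replacing the terms of homological degree at most `i` by zero) are homotopy equivalent. In
cohomological indexing these are the truncations to degrees at most `p = -i - 1`. -/
def IsCompleteResolution {R : Type u} [CommRing R] (C : Ktac R) (M : ModuleCat.{u} R) : Prop :=
  ∃ (P : ProjectiveResolution M) (p : ℤ), Nonempty (HomotopyEquiv
    (HomologicalComplex.stupidTrunc C.complex (ComplexShape.embeddingUpIntLE p))
    (HomologicalComplex.stupidTrunc (P.complex.extend ComplexShape.embeddingDownNat)
      (ComplexShape.embeddingUpIntLE p)))

/-- There is an exact triangle `C ⟶ C' ⟶ C'' ⟶ ΣC` in `K_tac(R)`: a triangle isomorphic, in the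
homotopy category, to the triangle of the mapping cone of a chain map. -/
def IsExactTriangle {R : Type u} [CommRing R] (C C' C'' : Ktac R) : Prop :=
  ∃ (α : C.obj ⟶ C'.obj) (β : C'.obj ⟶ C''.obj) (γ : C''.obj ⟶ C.obj⟦(1 : ℤ)⟧),
    Pretriangulated.Triangle.mk α β γ ∈ Pretriangulated.distinguishedTriangles (C := K R)

end TotallyAcyclicVariety

/-! Every complex is replaced by a matrix factorization. In cohomological indexing, the cokernel `N`
of `C⁻¹ → C⁰` is finite over the regular ring `Q`, hence has a finite free resolution over `Q`
(`hasFiniteFreeResolution`). Since the `fₗ` annihilate `N`, a system of higher homotopies extends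
the differential of this resolution to a matrix `D` over `Q[χ₁, …, χ_c]` with `D² = W = ∑ fₗ χₗ`.
Letting `D` act by contraction on `R`-valued functions of monomials gives a free resolution of `N`
over `R` (the construction of Shamash and Eisenbud), on which `tₗ` is contraction with `χₗ`.
Consequently `⨁ Hom(C, Σⁱ D)` is, in positive degrees, the module of homotopy classes of morphisms
between the two matrix factorizations, with `χₗ` acting as multiplication by the variable. The
comparison breaks down in degree zero only, and multiplying by a variable avoids that degree.

The central criterion is `Model.notMem_supportVariety_iff`: a point `b ≠ 0` lies outside `V(C, D)`
exactly when the matrix of `C` or the matrix of `D`, evaluated at `b` over `k`, is contractible. If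
`b` lies outside, some polynomial not vanishing at `b` maps the morphisms into `𝔪` times themselves
up to homotopy, and the determinant trick (`exists_smul_mem`) turns it into some `ψ` with `ψ(b) ≠ 0`
annihilating all morphisms up to homotopy. This property survives reduction modulo a regular element
at the price of squaring `ψ` (`Annihilates.map_of_regular`). Killing all `χᵢ - bᵢ` and then a
regular sequence generating `𝔪` leads to the field `k`, where testing on a rank-one morphism shows
that one of the two matrices has no homology. Conversely, a contraction at `b` spreads out, by an
adjugate matrix, to a homotopy from `ψ • 1` to zero with `ψ(b) = 1`.

The criterion is symmetric and gives `V(C, D) = V(C, C) ∩ V(D, D)`. It also shows that `b` is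
outside `V(C, D)` if and only if some `ψ` with `ψ(b) ≠ 0` annihilates `⨁ Hom(C, Σⁱ D)` before
reduction to `k`; in this form the long exact sequences of a triangle give the inclusions in the
second variable, and symmetry gives those in the first.

For a complete resolution of `k`, the hypothesis `fₗ ∈ 𝔪²` provides a Koszul matrix factorization
with all coefficients in `𝔪`. Functionals with values in `k` are then cocycles, and coboundaries
only if they vanish. A polynomial with value `1` at `b` has a coefficient outside `𝔪`, so it cannot
annihilate the class of a power of a variable, and no point is excluded. The third statement
combines the first two. -/

namespace TotallyAcyclicVariety

open IsLocalRing RingTheory.Sequence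

/-! ### Regular local rings: they are domains whose maximal ideal is generated by a regular
sequence. -/

section RegularLocal

/-- In a Noetherian local ring of positive dimension some element of the maximal ideal lies neither
in its square nor in any minimal prime. -/
theorem exists_mem_maximalIdeal_notMem_sq {B : Type u} [CommRing B] [IsLocalRing B]
    [IsNoetherianRing B] (hd : 0 < ringKrullDim B) :
    ∃ x ∈ maximalIdeal B, x ∉ maximalIdeal B ^ 2 ∧ ∀ p ∈ minimalPrimes B, x ∉ p := by
  classical
  by_contra! h
  let s : Finset (Ideal B) :=
    insert (maximalIdeal B ^ 2) (minimalPrimes.finite_of_isNoetherianRing B).toFinset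
  have hsub : (maximalIdeal B : Set B) ⊆ ⋃ i ∈ (s : Set (Ideal B)), ((id i : Ideal B) : Set B) := by
    intro x hx
    by_cases hx2 : x ∈ maximalIdeal B ^ 2
    · exact Set.mem_biUnion (x := maximalIdeal B ^ 2) (by simp [s]) hx2
    · obtain ⟨p, hp, hxp⟩ := h x hx hx2
      exact Set.mem_biUnion (x := p) (by simp [s, hp]) hxp
  -- Prime avoidance tolerates two ideals that are not prime; `𝔪²` fills both exceptional places.
  obtain ⟨i, hi, hle⟩ := (Ideal.subset_union_prime (s := s) (f := id) (maximalIdeal B ^ 2)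
    (maximalIdeal B ^ 2) (by
      intro i hi h1 _
      simp only [s, Finset.mem_insert, Set.Finite.mem_toFinset] at hi
      exact (hi.resolve_left h1).1.1)).1 hsub
  simp only [s, Finset.mem_insert, Set.Finite.mem_toFinset, id] at hi hle
  rcases hi with rfl | hi
  · have : maximalIdeal B = ⊥ :=
      Submodule.eq_bot_of_le_smul_of_le_jacobson_bot (maximalIdeal B) _ (IsNoetherian.noetherian _)
        (by rwa [smul_eq_mul, ← pow_two]) (jacobson_eq_maximalIdeal ⊥ bot_ne_top).ge
    rw [ringKrullDim_eq_zero_of_isField (isField_iff_maximalIdeal_eq.2 this)] at hd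
    exact lt_irrefl _ hd
  · have hp : i.IsPrime := hi.1.1
    obtain rfl : maximalIdeal B = i := le_antisymm hle (le_maximalIdeal hp.ne_top)
    rw [← maximalIdeal_height_eq_ringKrullDim, Ideal.height_eq_zero_iff.2 hi] at hd
    exact lt_irrefl _ hd

/-- Induction on the number of generators. An element `x ∈ 𝔪 \ 𝔪²` can replace one generator, and
dividing by it lowers the dimension by at most one, so `B/(x)` satisfies the same hypotheses and is
a domain. Thus `(x)` is prime, and a minimal prime inside it is zero by Nakayama, which makes `B` a
domain and `x` regular. -/
theorem exists_isWeaklyRegular_of_span : ∀ (n : ℕ) (B : Type u) [CommRing B] [IsLocalRing B]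
    [IsNoetherianRing B] (y : Fin n → B), Ideal.span (Set.range y) = maximalIdeal B →
    (n : WithBot ℕ∞) ≤ ringKrullDim B →
    IsDomain B ∧ ∃ rs : List B, IsWeaklyRegular B rs ∧ Ideal.ofList rs = maximalIdeal B
  | 0, B, _, _, _, y, hy, _ => by
    have h : maximalIdeal B = ⊥ := by rw [← hy]; simp
    exact ⟨(isField_iff_maximalIdeal_eq.2 h).isDomain, [], IsWeaklyRegular.nil _ _, by simp [h]⟩
  | n + 1, B, _, _, _, y, hy, hd => by
    obtain ⟨x, hxm, hx2, hxp⟩ := exists_mem_maximalIdeal_notMem_sq (B := B)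
      (lt_of_lt_of_le (by exact_mod_cast Nat.succ_pos n) hd)
    obtain ⟨a, ha⟩ := Ideal.mem_span_range_iff_exists_fun.1 (hy ▸ hxm)
    have hym : ∀ i, y i ∈ maximalIdeal B := fun i => hy ▸ Ideal.subset_span ⟨i, rfl⟩
    obtain ⟨i, hi⟩ : ∃ i, IsUnit (a i) := by
      -- If every coefficient lay in `𝔪`, then `x` would lie in `𝔪²`.
      by_contra! h
      refine hx2 (ha ▸ sum_mem fun i _ => ?_)
      rw [pow_two]
      exact Ideal.mul_mem_mul ((mem_maximalIdeal _).2 (h i)) (hym i)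
    let I := Ideal.span {x}
    have hI : I ≤ maximalIdeal B := (Ideal.span_singleton_le_iff_mem _).2 hxm
    have : Nontrivial (B ⧸ I) :=
      Ideal.Quotient.nontrivial_iff.2 fun h => (maximalIdeal.isMaximal B).ne_top (top_le_iff.1 (h ▸ hI))
    have : IsLocalRing (B ⧸ I) := IsLocalRing.of_surjective' (Ideal.Quotient.mk I)
      Ideal.Quotient.mk_surjective
    have hmap : (maximalIdeal B).map (Ideal.Quotient.mk I) = maximalIdeal (B ⧸ I) :=
      map_maximalIdeal_of_surjective _ Ideal.Quotient.mk_surjective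
    have hspan : Ideal.span (Set.range fun j => Ideal.Quotient.mk I (y (i.succAbove j))) =
        maximalIdeal (B ⧸ I) := by
      rw [← hmap, ← hy, Ideal.map_span, ← Set.range_comp]
      refine le_antisymm (Ideal.span_mono ?_) (Ideal.span_le.2 ?_)
      · rintro _ ⟨j, rfl⟩
        exact ⟨i.succAbove j, rfl⟩
      · have hsucc : ∀ j, Ideal.Quotient.mk I (y (i.succAbove j)) ∈ Ideal.span
            (Set.range fun j => Ideal.Quotient.mk I (y (i.succAbove j))) :=
          fun j => Ideal.subset_span ⟨j, rfl⟩
        rintro _ ⟨j, rfl⟩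
        rcases eq_or_ne j i with rfl | hj
        · obtain ⟨u, hu⟩ := hi
          have hx0 : Ideal.Quotient.mk I x = 0 :=
            Ideal.Quotient.eq_zero_iff_mem.2 (Ideal.mem_span_singleton_self x)
          rw [← ha, Fin.sum_univ_succAbove _ j, map_add, map_sum, ← hu, map_mul] at hx0
          have : Ideal.Quotient.mk I (y j) = Ideal.Quotient.mk I (↑u⁻¹ : B) *
              (Ideal.Quotient.mk I (u : B) * Ideal.Quotient.mk I (y j)) := by
            rw [← mul_assoc, ← map_mul]; simp
          change Ideal.Quotient.mk I (y j) ∈ _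
          rw [this, eq_neg_of_add_eq_zero_left hx0]
          refine Ideal.mul_mem_left _ _ (neg_mem (sum_mem fun l _ => ?_))
          rw [map_mul]
          exact Ideal.mul_mem_left _ _ (hsucc l)
        · obtain ⟨l, rfl⟩ := Fin.exists_succAbove_eq hj
          exact hsucc l
    have hdim : (n : WithBot ℕ∞) ≤ ringKrullDim (B ⧸ I) := by
      have := ringKrullDim_le_ringKrullDim_quotient_add_card {x} (by
        rw [IsLocalRing.ringJacobson_eq_maximalIdeal]; simpa using hxm)
      rw [Finset.coe_singleton, Finset.card_singleton] at this
      have h1 := hd.trans this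
      push_cast at h1
      exact ENat.WithBot.add_le_add_one_right_iff.1 h1
    obtain ⟨hdom, rs, hrs, hrs'⟩ := exists_isWeaklyRegular_of_span n (B ⧸ I) _ hspan hdim
    have hIp : I.IsPrime := (Ideal.Quotient.isDomain_iff_prime I).1 hdom
    have hB : IsDomain B := by
      obtain ⟨p, hp, hpI⟩ := Ideal.exists_minimalPrimes_le (I := ⊥) (J := I) bot_le
      have hp' : p.IsPrime := hp.1.1
      -- An element of `p ⊆ (x)` is `w x` with `w ∈ p`, because `x ∉ p`; hence `p = x p`.
      have : p = ⊥ := by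
        refine Submodule.eq_bot_of_le_smul_of_le_jacobson_bot I _ (IsNoetherian.noetherian _) ?_
          (hI.trans (jacobson_eq_maximalIdeal ⊥ bot_ne_top).ge)
        intro z hz
        obtain ⟨w, rfl⟩ := Ideal.mem_span_singleton'.1 (hpI hz)
        rw [smul_eq_mul, mul_comm w]
        exact Ideal.mul_mem_mul (Ideal.mem_span_singleton_self x)
          ((hp'.mem_or_mem hz).resolve_right (hxp p hp))
      have hbot : (⊥ : Ideal B).IsPrime := this ▸ hp'
      exact { IsLocalRing.toNontrivial, (IsDomain.of_bot_isPrime B).toIsCancelMulZero with }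
    obtain ⟨rs, rfl⟩ := List.map_surjective_iff.2 Ideal.Quotient.mk_surjective rs
    refine ⟨hB, x :: rs, ?_, ?_⟩
    · rw [isWeaklyRegular_cons_iff']
      refine ⟨fun a b hab => mul_left_cancel₀ (fun h0 => hx2 (by rw [h0]; exact zero_mem _)) hab, ?_⟩
      let e : QuotSMulTop x B ≃ₗ[B] B ⧸ I := Submodule.quotEquivOfEq _ _ (by
        ext z
        rw [Ideal.mem_span_singleton', Submodule.mem_smul_pointwise_iff_exists]
        simp [mul_comm])
      rw [(show QuotSMulTop x B ≃ₗ[B ⧸ I] B ⧸ I from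
        e.extendScalarsOfSurjective Ideal.Quotient.mk_surjective).isWeaklyRegular_congr]
      exact hrs
    · rw [← Ideal.map_ofList, ← hmap] at hrs'
      have := congrArg (Ideal.comap (Ideal.Quotient.mk I)) hrs'
      rw [Ideal.comap_map_of_surjective _ Ideal.Quotient.mk_surjective,
        Ideal.comap_map_of_surjective _ Ideal.Quotient.mk_surjective, ← RingHom.ker_eq_comap_bot,
        Ideal.mk_ker, sup_eq_left.2 hI] at this
      rw [Ideal.ofList_cons, sup_comm, this]

theorem isDomain_and_exists_isWeaklyRegular (Q : Type u) [CommRing Q] [IsRegularLocalRing Q] :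
    IsDomain Q ∧ ∃ rs : List Q, IsWeaklyRegular Q rs ∧ Ideal.ofList rs = maximalIdeal Q := by
  have hfg : (maximalIdeal Q).FG := IsNoetherian.noetherian _
  have hfin := Submodule.FG.finite_generators hfg
  have : Fintype (maximalIdeal Q).generators := hfin.fintype
  have hcard : Fintype.card (maximalIdeal Q).generators = (maximalIdeal Q).spanFinrank := by
    rw [← Submodule.FG.generators_ncard hfg, Set.ncard_eq_toFinset_card', Set.toFinset_card]
  let e := Fintype.equivFinOfCardEq hcard
  refine exists_isWeaklyRegular_of_span (maximalIdeal Q).spanFinrank Q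
    (fun i => ((e.symm i : (maximalIdeal Q).generators) : Q)) ?_
    (le_of_eq (IsRegularLocalRing.spanFinrank_maximalIdeal))
  have : Set.range (fun i => ((e.symm i : (maximalIdeal Q).generators) : Q)) =
      (maximalIdeal Q).generators := by
    change Set.range (Subtype.val ∘ e.symm) = _
    rw [Set.range_comp, e.symm.surjective.range_eq, Set.image_univ, Subtype.range_coe]
  rw [this]
  exact Submodule.span_generators _

end RegularLocal

open IsLocalRing RingTheory.Sequence TensorProduct

/-! ### Finite free resolutions over a regular local ring. -/

section FreeResolution

variable {Q : Type u} [CommRing Q]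

/-- A finite free resolution of the `Q`-module `M`, written as one square matrix `d` of degree `-1`
on a graded basis `ι`, with augmentation `ε` on the basis elements of degree zero. -/
structure IsFreeResolution {ι : Type} [Fintype ι] (deg : ι → ℕ) (d : Matrix ι ι Q)
    {M : Type u} [AddCommGroup M] [Module Q M] (ε : ι → M) : Prop where
  homog : ∀ i j, d i j ≠ 0 → deg j = deg i + 1
  eps_deg : ∀ i, ε i ≠ 0 → deg i = 0
  span_eps : Submodule.span Q (Set.range ε) = ⊤
  sq : d * d = 0
  eps_d : ∀ j, ∑ i, d i j • ε i = 0
  exact : ∀ v : ι → Q, d.mulVec v = 0 → ∑ i, v i • ε i = 0 → ∃ w, v = d.mulVec w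

/-- `M` has some finite free resolution. -/
def HasFiniteFreeResolution (Q : Type u) [CommRing Q] (M : Type u) [AddCommGroup M] [Module Q M] :
    Prop :=
  ∃ (ι : Type) (_ : Fintype ι) (_ : DecidableEq ι) (deg : ι → ℕ) (d : Matrix ι ι Q) (ε : ι → M),
    IsFreeResolution deg d ε

theorem HasFiniteFreeResolution.of_free {M : Type u} [AddCommGroup M] [Module Q M]
    [Module.Finite Q M] [Module.Free Q M] : HasFiniteFreeResolution Q M := by
  let b := (Module.Free.chooseBasis Q M).reindex (Finite.equivFin _)
  refine ⟨Fin _, inferInstance, inferInstance, fun _ => 0, 0, b, ?_, fun _ _ => rfl, b.span_eq,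
    by simp, by simp, fun v _ hv => ⟨0, ?_⟩⟩
  · intro i j h; exact (h rfl).elim
  · rw [Matrix.zero_mulVec]
    exact funext (Fintype.linearIndependent_iff.1 b.linearIndependent v hv)

/-- Only basis elements of degree zero are seen by `ε`, and `d` kills them for reasons of degree, so
the coefficients can be chosen to form a cycle. -/
theorem IsFreeResolution.exists_combination {ι : Type} [Fintype ι] {deg : ι → ℕ}
    {d : Matrix ι ι Q} {M : Type u} [AddCommGroup M] [Module Q M] {ε : ι → M}
    (h : IsFreeResolution deg d ε) (m : M) :
    ∃ a : ι → Q, d.mulVec a = 0 ∧ ∑ j, a j • ε j = m := by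
  classical
  obtain ⟨a, ha⟩ := (Submodule.mem_span_range_iff_exists_fun Q).1
    (h.span_eps ▸ Submodule.mem_top : m ∈ _)
  refine ⟨fun j => if deg j = 0 then a j else 0, ?_, ?_⟩
  · ext i
    refine Finset.sum_eq_zero fun j _ => ?_
    by_cases hj : deg j = 0
    · have : d i j = 0 := by
        by_contra h0
        have := h.homog i j h0
        omega
      simp [this]
    · simp [hj]
  · rw [← ha]
    refine Finset.sum_congr rfl fun j _ => ?_
    by_cases hj : deg j = 0
    · simp [hj]
    · have : ε j = 0 := by
        by_contra h0
        exact hj (h.eps_deg j h0)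
      simp [this]

/-- This replaces the vanishing of `Tor₁` of `M` with the quotient of `Q` by `rs`: reduction modulo
a regular sequence on `M` preserves injectivity of the kernel into `F`. -/
theorem injective_mapQ_of_isWeaklyRegular {K F M : Type*} [AddCommGroup K] [Module Q K]
    [AddCommGroup F] [Module Q F] [AddCommGroup M] [Module Q M] {i : K →ₗ[Q] F} {p : F →ₗ[Q] M}
    (hi : Function.Injective i) (hip : Function.Exact i p) (hp : Function.Surjective p)
    {rs : List Q} (hM : IsWeaklyRegular M rs) :
    ∀ x, i x ∈ Ideal.ofList rs • (⊤ : Submodule Q F) → x ∈ Ideal.ofList rs • (⊤ : Submodule Q K) := by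
  have h := map_first_exact_on_four_term_right_exact_of_isSMulRegular_last
    (f₁ := (0 : K →ₗ[Q] K)) (f₂ := i) (f₃ := p) (rs := rs)
    ((LinearMap.exact_zero_iff_injective K i).2 hi) hip hp hM
  intro x hx
  obtain ⟨y, hy⟩ := (h (Submodule.Quotient.mk x)).1 (by
    rw [Submodule.mapQ_apply, Submodule.Quotient.mk_eq_zero]; exact hx)
  obtain ⟨y, rfl⟩ := Submodule.Quotient.mk_surjective _ y
  rw [Submodule.mapQ_apply, LinearMap.zero_apply, Submodule.Quotient.mk_zero] at hy
  exact (Submodule.Quotient.mk_eq_zero _).1 hy.symm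

theorem isWeaklyRegular_of_flat (F : Type*) [AddCommGroup F] [Module Q F] [Module.Flat Q F]
    {rs : List Q} (h : IsWeaklyRegular Q rs) : IsWeaklyRegular F rs :=
  ((TensorProduct.rid Q F).isWeaklyRegular_congr rs).1 h.isWeaklyRegular_lTensor

/-- Kernels gain one element of a regular sequence. -/
theorem isWeaklyRegular_ker_append {F M : Type*} [AddCommGroup F] [Module Q F] [Module.Free Q F]
    [AddCommGroup M] [Module Q M] (p : F →ₗ[Q] M) (hp : Function.Surjective p) (rs : List Q) :
    ∀ (r : Q), IsWeaklyRegular M rs → IsWeaklyRegular Q (rs ++ [r]) →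
      IsWeaklyRegular (LinearMap.ker p) (rs ++ [r]) := by
  induction rs using List.reverseRecOn with
  | nil =>
    intro r _ hr
    have hF := (isWeaklyRegular_singleton_iff F r).1 (isWeaklyRegular_of_flat F hr)
    exact (isWeaklyRegular_singleton_iff _ r).2 (hF.submodule _ _)
  | append_singleton rs r' ih =>
    intro r hM hr
    have hF := (isWeaklyRegular_append_iff F _ _).1 (isWeaklyRegular_of_flat F hr)
    rw [isWeaklyRegular_append_iff] at hr
    rw [isWeaklyRegular_append_iff]
    refine ⟨ih r' ((isWeaklyRegular_append_iff _ _ _).1 hM).1 hr.1, ?_⟩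
    have h1 := (isWeaklyRegular_singleton_iff _ r).1 hF.2
    rw [isWeaklyRegular_singleton_iff, isSMulRegular_iff_right_eq_zero_of_smul]
    intro x hx
    obtain ⟨x, rfl⟩ := Submodule.Quotient.mk_surjective _ x
    rw [← Submodule.Quotient.mk_smul, Submodule.Quotient.mk_eq_zero] at hx
    rw [Submodule.Quotient.mk_eq_zero]
    -- The kernel modulo `rs ++ [r']` embeds in `F` modulo the same ideal, where `r` is regular
    -- because `F` is free.
    refine injective_mapQ_of_isWeaklyRegular (Submodule.injective_subtype _)
      (LinearMap.exact_subtype_ker_map p) hp hM x ?_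
    rw [← Submodule.Quotient.mk_eq_zero]
    refine isSMulRegular_iff_right_eq_zero_of_smul.1 h1 _ ?_
    rw [← Submodule.Quotient.mk_smul, Submodule.Quotient.mk_eq_zero, ← map_smul]
    exact Submodule.smul_top_le_comap_smul_top _ (LinearMap.ker p).subtype hx

/-- Regularity of a sequence generating `𝔪` makes the kernel of a free cover stay injective after
tensoring with the residue field, and this forces a finite module to be free. -/
theorem free_of_isWeaklyRegular [IsLocalRing Q] [IsNoetherianRing Q] {M : Type u} [AddCommGroup M]
    [Module Q M] [Module.Finite Q M] (rs : List Q) (hm : Ideal.ofList rs = maximalIdeal Q)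
    (hM : IsWeaklyRegular M rs) : Module.Free Q M := by
  obtain ⟨n, p, hp⟩ := Module.Finite.exists_fin' Q M
  have hex : Function.Exact (LinearMap.ker p).subtype p := LinearMap.exact_subtype_ker_map p
  refine Module.free_of_lTensor_residueField_injective (LinearMap.ker p).subtype p hp hex ?_
  rw [injective_iff_map_eq_zero]
  intro x hx
  obtain ⟨x, rfl⟩ := TensorProduct.mk_surjective Q (LinearMap.ker p) (ResidueField Q)
    Ideal.Quotient.mk_surjective x
  rw [TensorProduct.mk_apply, LinearMap.lTensor_tmul] at hx
  have key : ∀ (N : Type u) [AddCommGroup N] [Module Q N] (y : N),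
      (1 : ResidueField Q) ⊗ₜ[Q] y = 0 ↔ y ∈ maximalIdeal Q • (⊤ : Submodule Q N) := by
    intro N _ _ y
    rw [← Submodule.Quotient.mk_eq_zero, ← TensorProduct.quotTensorEquivQuotSMul_mk_one_tmul]
    exact (TensorProduct.quotTensorEquivQuotSMul N (maximalIdeal Q)).map_eq_zero_iff.symm
  rw [TensorProduct.mk_apply, key, ← hm]
  rw [key, ← hm] at hx
  exact injective_mapQ_of_isWeaklyRegular (Submodule.injective_subtype _) hex hp hM x hx

/-- The resolution of the kernel is shifted by one and spliced with `Qⁿ`; the block `E` writes its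
augmentation in coordinates. -/
theorem HasFiniteFreeResolution.of_ker {M : Type u} [AddCommGroup M] [Module Q M] {n : ℕ}
    (p : (Fin n → Q) →ₗ[Q] M) (hp : Function.Surjective p)
    (h : HasFiniteFreeResolution Q (LinearMap.ker p)) : HasFiniteFreeResolution Q M := by
  obtain ⟨ι, _, _, deg, d, ε, h⟩ := h
  let E : Matrix (Fin n) ι Q := Matrix.of fun i j => (ε j : Fin n → Q) i
  have hE : ∀ w : ι → Q, E.mulVec w = ((∑ j, w j • ε j : LinearMap.ker p) : Fin n → Q) := by
    intro w
    ext i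
    simp [E, Matrix.mulVec, dotProduct, mul_comm]
  have hEd : E * d = 0 := by
    ext i j
    have := congrArg (fun z : LinearMap.ker p => (z : Fin n → Q) i) (h.eps_d j)
    simpa [Matrix.mul_apply, E, mul_comm] using this
  let e : Fin n → M := fun i => p (Pi.single i 1)
  have he : ∀ v : Fin n → Q, ∑ i, v i • e i = p v := by
    intro v
    conv_rhs => rw [pi_eq_sum_univ' v]
    simp [e]
  refine ⟨Fin n ⊕ ι, inferInstance, inferInstance, Sum.elim (fun _ => 0) (fun j => deg j + 1),
    Matrix.fromBlocks 0 E 0 d, Sum.elim e 0, ?_, ?_, ?_, ?_, ?_, ?_⟩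
  · rintro (i | i) (j | j) hij
    · exact (hij rfl).elim
    · have : ε j ≠ 0 := fun h0 => hij (by simp [E, h0])
      simp [h.eps_deg j this]
    · exact (hij rfl).elim
    · simpa using h.homog i j hij
  · rintro (i | i) hi
    · rfl
    · exact (hi rfl).elim
  · rw [eq_top_iff]
    rintro m -
    obtain ⟨v, rfl⟩ := hp m
    rw [← he]
    exact sum_mem fun i _ => Submodule.smul_mem _ _ (Submodule.subset_span ⟨Sum.inl i, rfl⟩)
  · rw [Matrix.fromBlocks_multiply]
    simp [hEd, h.sq]
  · rintro (j | j)
    · simp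
    · have := he (fun i => E i j)
      simp only [Fintype.sum_sum_type, Matrix.fromBlocks_apply₁₂, Sum.elim_inl, Sum.elim_inr,
        Pi.zero_apply, smul_zero, Finset.sum_const_zero, add_zero, this]
      exact (ε j).2
  · intro v hv hv'
    obtain ⟨v1, v2, rfl⟩ : ∃ v1 v2, v = Sum.elim v1 v2 := ⟨_, _, (Sum.elim_comp_inl_inr v).symm⟩
    simp only [Fintype.sum_sum_type, Sum.elim_inl, Sum.elim_inr, Pi.zero_apply, smul_zero,
      Finset.sum_const_zero, add_zero, he] at hv'
    rw [Matrix.fromBlocks_mulVec] at hv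
    simp only [Sum.elim_comp_inl, Sum.elim_comp_inr, Matrix.zero_mulVec, zero_add] at hv
    have h1 : E.mulVec v2 = 0 := funext fun i => congrFun hv (Sum.inl i)
    have h2 : d.mulVec v2 = 0 := funext fun i => congrFun hv (Sum.inr i)
    obtain ⟨w, rfl⟩ := h.exact v2 h2 (by rwa [hE, Submodule.coe_eq_zero] at h1)
    -- The preimage `w` handles the upper part of the cycle; adding the cycle `a` corrects its image
    -- in `Qⁿ` without changing `d w`.
    obtain ⟨a, ha0, ha⟩ := h.exists_combination (⟨v1, hv'⟩ - ∑ j, w j • ε j)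
    refine ⟨Sum.elim 0 (w + a), ?_⟩
    rw [Matrix.fromBlocks_mulVec]
    simp only [Sum.elim_comp_inl, Sum.elim_comp_inr, Matrix.zero_mulVec, zero_add,
      Matrix.mulVec_add, ha0, add_zero, hE]
    have : ∑ j, (w + a) j • ε j = ⟨v1, hv'⟩ := by
      simp only [Pi.add_apply, add_smul, Finset.sum_add_distrib, ha, add_sub_cancel]
    rw [this]

/-- Hilbert's syzygy theorem by counting regular elements: each syzygy module acquires one more
member of the sequence, and once the whole sequence is regular on it, it is free. -/
theorem HasFiniteFreeResolution.of_isWeaklyRegular_append [IsLocalRing Q] [IsNoetherianRing Q]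
    (rs₂ : List Q) : ∀ rs₁ : List Q, IsWeaklyRegular Q (rs₁ ++ rs₂) →
      Ideal.ofList (rs₁ ++ rs₂) = maximalIdeal Q → ∀ (M : Type u) [AddCommGroup M] [Module Q M]
      [Module.Finite Q M], IsWeaklyRegular M rs₁ → HasFiniteFreeResolution Q M := by
  induction rs₂ with
  | nil =>
    intro rs₁ _ hm M _ _ _ hM
    rw [List.append_nil] at hm
    have := free_of_isWeaklyRegular rs₁ hm hM
    exact .of_free
  | cons r rs₂ ih =>
    intro rs₁ hQ hm M _ _ _ hM
    obtain ⟨n, p, hp⟩ := Module.Finite.exists_fin' Q M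
    rw [List.append_cons] at hQ hm
    exact .of_ker p hp (ih (rs₁ ++ [r]) hQ hm _
      (isWeaklyRegular_ker_append p hp rs₁ r hM ((isWeaklyRegular_append_iff _ _ _).1 hQ).1))

theorem hasFiniteFreeResolution [IsRegularLocalRing Q] (M : Type u) [AddCommGroup M] [Module Q M]
    [Module.Finite Q M] : HasFiniteFreeResolution Q M := by
  obtain ⟨-, rs, h1, h2⟩ := isDomain_and_exists_isWeaklyRegular Q
  exact .of_isWeaklyRegular_append rs [] h1 h2 M (.nil _ _)

end FreeResolution

/-! ### Higher homotopies: from a free resolution to a graded matrix factorization. -/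

section MatrixFactorization

variable {Q : Type u} [CommRing Q] {c : ℕ}

/-- A graded matrix factorization of `W ∈ Q[χ₁, …, χ_c]` on a graded basis `ι`, of degree `-1`,
the variables having degree `-2`. -/
structure IsMatrixFactorization {ι : Type} [Fintype ι] [DecidableEq ι] (deg : ι → ℕ)
    (W : MvPolynomial (Fin c) Q) (D : Matrix ι ι (MvPolynomial (Fin c) Q)) : Prop where
  homog : ∀ i j e, (D i j).coeff e ≠ 0 → 2 * e.degree + deg j = deg i + 1
  sq : D * D = W • (1 : Matrix ι ι (MvPolynomial (Fin c) Q))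

/-- The matrix of coefficients of the monomial `e`. -/
def coeffMatrix {κ ι : Type} (e : Fin c →₀ ℕ) (X : Matrix κ ι (MvPolynomial (Fin c) Q)) :
    Matrix κ ι Q := X.map (MvPolynomial.coeff e)

theorem coeffMatrix_apply {κ ι : Type} (e : Fin c →₀ ℕ)
    (X : Matrix κ ι (MvPolynomial (Fin c) Q)) (k i) : coeffMatrix e X k i = (X k i).coeff e := rfl

theorem matrix_mul_apply_eq_zero {B : Type*} [CommRing B] {κ ι τ : Type} [Fintype ι]
    {X : Matrix κ ι B} {Y : Matrix ι τ B} {k : κ} {t : τ} (h : ∀ i, X k i = 0 ∨ Y i t = 0) :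
    (X * Y) k t = 0 := by
  rw [Matrix.mul_apply]
  exact Finset.sum_eq_zero fun i _ => (h i).elim (fun h => by rw [h, zero_mul])
    fun h => by rw [h, mul_zero]

theorem coeffMatrix_mul {κ ι τ : Type} [Fintype ι] (e : Fin c →₀ ℕ)
    (X : Matrix κ ι (MvPolynomial (Fin c) Q)) (Y : Matrix ι τ (MvPolynomial (Fin c) Q)) :
    coeffMatrix e (X * Y) =
      ∑ p ∈ Finset.HasAntidiagonal.antidiagonal e, coeffMatrix p.1 X * coeffMatrix p.2 Y := by
  ext k t
  simp only [coeffMatrix_apply, Matrix.mul_apply, MvPolynomial.coeff_sum, MvPolynomial.coeff_mul,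
    Matrix.sum_apply]
  exact Finset.sum_comm

theorem coeffMatrix_add {κ ι : Type} (e : Fin c →₀ ℕ)
    (X Y : Matrix κ ι (MvPolynomial (Fin c) Q)) :
    coeffMatrix e (X + Y) = coeffMatrix e X + coeffMatrix e Y := by
  ext; simp [coeffMatrix_apply]

theorem coeffMatrix_sub {κ ι : Type} (e : Fin c →₀ ℕ)
    (X Y : Matrix κ ι (MvPolynomial (Fin c) Q)) :
    coeffMatrix e (X - Y) = coeffMatrix e X - coeffMatrix e Y := by
  ext; simp [coeffMatrix_apply]

theorem ext_coeffMatrix {κ ι : Type} {X Y : Matrix κ ι (MvPolynomial (Fin c) Q)}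
    (h : ∀ e, coeffMatrix e X = coeffMatrix e Y) : X = Y := by
  ext k i e
  exact congrFun (congrFun (h e) k) i

variable {ι : Type} [Fintype ι] {deg : ι → ℕ} {d : Matrix ι ι Q}
  {M : Type u} [AddCommGroup M] [Module Q M] {ε : ι → M}

theorem IsFreeResolution.exact_homogeneous (h : IsFreeResolution deg d ε) {p : ℕ} (v : ι → Q)
    (hp : ∀ i, v i ≠ 0 → deg i = p) (hv : d.mulVec v = 0) (hv' : ∑ i, v i • ε i = 0) :
    ∃ w : ι → Q, (∀ i, w i ≠ 0 → deg i = p + 1) ∧ v = d.mulVec w := by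
  classical
  obtain ⟨w, rfl⟩ := h.exact v hv hv'
  refine ⟨fun i => if deg i = p + 1 then w i else 0, fun i hi => ?_, ?_⟩
  · by_contra h0
    exact hi (if_neg h0)
  · ext i
    by_cases hi : deg i = p
    · refine Finset.sum_congr rfl fun k _ => ?_
      by_cases hd : d i k = 0
      · simp [hd]
      · have hk : deg k = p + 1 := by rw [h.homog _ _ hd, hi]
        simp [hk]
    · rw [show d.mulVec w i = 0 by by_contra h0; exact hi (hp i h0)]
      refine (Finset.sum_eq_zero fun k _ => ?_).symm
      by_cases hd : d i k = 0
      · simp [hd]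
      · have hk : deg k ≠ p + 1 := by rw [h.homog _ _ hd]; omega
        simp [hk]

/-- Chain maps of positive degree, or inducing zero on the module resolved, are null-homotopic. -/
theorem IsFreeResolution.exists_homotopy (h : IsFreeResolution deg d ε) {m : ℕ} (ρ : Matrix ι ι Q)
    (hρ : ∀ i j, ρ i j ≠ 0 → deg i = deg j + m) (hcomm : d * ρ = ρ * d)
    (hε : ∀ j, ∑ i, ρ i j • ε i = 0) :
    ∃ η : Matrix ι ι Q, (∀ i j, η i j ≠ 0 → deg i = deg j + m + 1) ∧ ρ = d * η + η * d := by
  classical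
  -- The homotopy is built column by column, in increasing degree of the source: after step `N` it
  -- is correct on the columns of degree below `N`.
  have key : ∀ N : ℕ, ∃ η : Matrix ι ι Q, (∀ i j, η i j ≠ 0 → deg i = deg j + m + 1) ∧
      ∀ i j, deg j < N → (ρ - d * η - η * d) i j = 0 := by
    intro N
    induction N with
    | zero => exact ⟨0, by simp, by simp⟩
    | succ N ih =>
      obtain ⟨η, hη, hN⟩ := ih
      set r := ρ - d * η - η * d with hr
      have hrc : d * r = r * d := by
        rw [hr]
        simp only [mul_sub, sub_mul, ← mul_assoc, h.sq, hcomm, zero_mul, mul_assoc η, mul_zero]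
        simp
      have hrε : ∀ j, ∑ i, r i j • ε i = 0 := by
        intro j
        have e1 : ∑ i, (d * η) i j • ε i = 0 := by
          simp only [Matrix.mul_apply, Finset.sum_smul]
          rw [Finset.sum_comm]
          refine Finset.sum_eq_zero fun k _ => ?_
          simp_rw [mul_comm (d _ k), mul_smul]
          rw [← Finset.smul_sum, h.eps_d, smul_zero]
        have e2 : ∑ i, (η * d) i j • ε i = 0 := by
          refine Finset.sum_eq_zero fun i _ => ?_
          by_cases hi : ε i = 0
          · simp [hi]
          · rw [matrix_mul_apply_eq_zero fun k => .inl ?_, zero_smul]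
            by_contra h0
            have h1 := hη i k h0
            have h2 := h.eps_deg i hi
            omega
        simp [hr, sub_smul, Finset.sum_sub_distrib, hε, e1, e2]
      have hrh : ∀ i j, r i j ≠ 0 → deg i = deg j + m := by
        intro i j hij
        by_contra hne
        refine hij ?_
        have e1 : ρ i j = 0 := by by_contra h0; exact hne (hρ i j h0)
        have e2 : (d * η) i j = 0 := matrix_mul_apply_eq_zero fun k => by
          by_contra! h0
          have h3 := h.homog _ _ h0.1
          have h4 := hη _ _ h0.2
          exact (hne (by omega)).elim
        have e3 : (η * d) i j = 0 := matrix_mul_apply_eq_zero fun k => by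
          by_contra! h0
          have h3 := h.homog _ _ h0.2
          have h4 := hη _ _ h0.1
          exact (hne (by omega)).elim
        simp [hr, e1, e2, e3]
      have hcol : ∀ j, deg j = N → ∃ w : ι → Q, (∀ i, w i ≠ 0 → deg i = deg j + m + 1) ∧
          (fun i => r i j) = d.mulVec w := by
        intro j hj
        refine h.exact_homogeneous _ (fun i hi => hrh i j hi) ?_ (hrε j)
        ext i
        change (d * r) i j = 0
        rw [hrc]
        refine matrix_mul_apply_eq_zero fun k => or_iff_not_imp_right.2 fun h1 =>
          hN i k (by have := h.homog _ _ h1; omega)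
      choose w hw hw' using hcol
      -- The correction lives in the columns of degree `N`; multiplied on the right by `d` it meets
      -- only columns of higher degree, so earlier columns are undisturbed.
      let η' : Matrix ι ι Q := Matrix.of fun i j => if hj : deg j = N then w j hj i else 0
      have hη'0 : ∀ i j, deg j ≠ N → η' i j = 0 := fun i j hj => by simp [η', hj]
      have hη'1 : ∀ i j (hj : deg j = N), η' i j = w j hj i := fun i j hj => by simp [η', hj]
      refine ⟨η + η', ?_, ?_⟩
      · intro i j hij
        by_contra hne
        refine hij ?_
        have e1 : η i j = 0 := by by_contra h0; exact hne (hη i j h0)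
        have e2 : η' i j = 0 := by
          by_cases hj : deg j = N
          · rw [hη'1 i j hj]
            by_contra h0
            exact hne (hw j hj i h0)
          · exact hη'0 i j hj
        simp [e1, e2]
      · intro i j hj
        have e0 : ρ - d * (η + η') - (η + η') * d = r - d * η' - η' * d := by
          rw [hr, mul_add, add_mul]; abel
        have e1 : (η' * d) i j = 0 := matrix_mul_apply_eq_zero fun k =>
          or_iff_not_imp_right.2 fun h1 => hη'0 i k (by have := h.homog _ _ h1; omega)
        rw [e0]
        simp only [Matrix.sub_apply, e1, sub_zero]
        by_cases hjN : deg j = N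
        · have := congrFun (hw' j hjN) i
          rw [this, sub_eq_zero]
          simp only [Matrix.mul_apply, Matrix.mulVec, dotProduct, hη'1 _ j hjN]
        · rw [hN i j (by omega), zero_sub, neg_eq_zero]
          exact matrix_mul_apply_eq_zero fun k => .inr (hη'0 k j hjN)
  obtain ⟨η, hη, hη'⟩ := key (Finset.univ.sup deg + 1)
  refine ⟨η, hη, ?_⟩
  ext i j
  have := hη' i j (Nat.lt_succ_of_le (Finset.le_sup (Finset.mem_univ j)))
  rw [← sub_eq_zero, ← this]
  simp only [Matrix.sub_apply, Matrix.add_apply]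
  ring

/-- The potential `∑ fₗ χₗ`. -/
noncomputable def potential (f : Fin c → Q) : MvPolynomial (Fin c) Q :=
  ∑ l, MvPolynomial.C (f l) * MvPolynomial.X l

/-- Induction on the total degree in the variables. The error `r = W - D²` commutes with `D`, so
each of its coefficients in the lowest surviving degree `n + 1` commutes with `d`. It has degree
`2n` and induces zero on `M`, because the `fₗ` do, hence is null-homotopic; the homotopies are the
next coefficients of `D`. -/
theorem IsFreeResolution.exists_matrixFactorization_mod [DecidableEq ι]
    (h : IsFreeResolution deg d ε) (f : Fin c → Q) (hf : ∀ l (m : M), f l • m = 0) (n : ℕ) :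
    ∃ D : Matrix ι ι (MvPolynomial (Fin c) Q),
      (∀ i j e, (D i j).coeff e ≠ 0 → 2 * e.degree + deg j = deg i + 1) ∧ coeffMatrix 0 D = d ∧
      ∀ e : Fin c →₀ ℕ, e.degree ≤ n → coeffMatrix e (potential f • 1 - D * D) = 0 := by
  classical
  have hW : ∀ e : Fin c →₀ ℕ, coeffMatrix e (potential f • (1 : Matrix ι ι (MvPolynomial (Fin c) Q)))
      = (potential f).coeff e • 1 := by
    intro e
    ext i j
    by_cases hij : i = j <;> simp [coeffMatrix_apply, hij]
  induction n with
  | zero =>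
    refine ⟨d.map MvPolynomial.C, ?_, ?_, ?_⟩
    · intro i j e he
      rw [Matrix.map_apply, MvPolynomial.coeff_C] at he
      obtain ⟨rfl, h1⟩ := ite_ne_right_iff.1 he
      simpa using h.homog i j h1
    · ext i j; simp [coeffMatrix_apply]
    · intro e he
      obtain rfl : e = 0 := (Finsupp.degree_eq_zero_iff e).1 (Nat.le_zero.1 he)
      rw [coeffMatrix_sub, hW, ← Matrix.map_mul, h.sq]
      ext i j
      simp [coeffMatrix_apply, potential, MvPolynomial.coeff_sum, MvPolynomial.coeff_C_mul]
  | succ n ih =>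
    obtain ⟨D, hD, hD0, hn⟩ := ih
    set r := potential f • (1 : Matrix ι ι (MvPolynomial (Fin c) Q)) - D * D with hr
    have hDr : D * r = r * D := by
      rw [hr, mul_sub, sub_mul, mul_assoc]
      congr 1
      rw [Matrix.mul_smul, Matrix.smul_mul, mul_one, one_mul]
    have hε : ∀ (e : Fin c →₀ ℕ) j, ∑ i, coeffMatrix e r i j • ε i = 0 := by
      intro e j
      rw [hr, coeffMatrix_sub, hW, coeffMatrix_mul]
      simp only [Matrix.sub_apply, sub_smul, Finset.sum_sub_distrib]
      have e1 : ∑ i, ((potential f).coeff e • (1 : Matrix ι ι Q)) i j • ε i = 0 := by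
        have hm : ∀ m : M, (potential f).coeff e • m = 0 := by
          intro m
          simp only [potential, MvPolynomial.coeff_sum, MvPolynomial.coeff_C_mul, Finset.sum_smul]
          exact Finset.sum_eq_zero fun l _ => by rw [mul_comm, mul_smul, hf, smul_zero]
        exact Finset.sum_eq_zero fun i _ => by
          rw [Matrix.smul_apply, smul_eq_mul, mul_smul, hm]
      rw [e1, zero_sub, neg_eq_zero]
      simp only [Matrix.sum_apply, Finset.sum_smul]
      rw [Finset.sum_comm]
      refine Finset.sum_eq_zero fun p _ => ?_
      by_cases hp : p.1 = 0
      · rw [hp, hD0]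
        simp only [Matrix.mul_apply, Finset.sum_smul]
        rw [Finset.sum_comm]
        refine Finset.sum_eq_zero fun k _ => ?_
        simp_rw [mul_comm (d _ k), mul_smul]
        rw [← Finset.smul_sum, h.eps_d, smul_zero]
      · refine Finset.sum_eq_zero fun i _ => ?_
        by_cases hi : ε i = 0
        · rw [hi, smul_zero]
        · rw [matrix_mul_apply_eq_zero fun k => .inl ?_, zero_smul]
          by_contra h0
          have h1 := hD i k p.1 h0
          have h2 := h.eps_deg i hi
          have h3 : p.1.degree ≠ 0 := fun h0 => hp ((Finsupp.degree_eq_zero_iff _).1 h0)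
          omega
    have hrh : ∀ e : Fin c →₀ ℕ, e.degree = n + 1 → ∀ i j, coeffMatrix e r i j ≠ 0 →
        deg i = deg j + 2 * n := by
      intro e he i j hij
      by_contra hne
      refine hij ?_
      rw [hr, coeffMatrix_sub, hW, coeffMatrix_mul, Matrix.sub_apply, sub_eq_zero]
      have e1 : (∑ p ∈ Finset.HasAntidiagonal.antidiagonal e,
          coeffMatrix p.1 D * coeffMatrix p.2 D) i j = 0 := by
        rw [Matrix.sum_apply]
        refine Finset.sum_eq_zero fun p hp => matrix_mul_apply_eq_zero fun k => ?_
        by_contra! h0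
        have h1 := hD _ _ _ h0.1
        have h2 := hD _ _ _ h0.2
        have h3 : p.1.degree + p.2.degree = e.degree := by
          rw [← Finset.HasAntidiagonal.mem_antidiagonal.1 hp, map_add]
        omega
      rw [e1, Matrix.smul_apply, Matrix.one_apply]
      split_ifs with hij'
      · subst hij'
        have : (potential f).coeff e = 0 := by
          simp only [potential, MvPolynomial.coeff_sum, MvPolynomial.coeff_C_mul]
          refine Finset.sum_eq_zero fun l _ => ?_
          rw [MvPolynomial.coeff_X, if_neg, mul_zero]
          rintro rfl
          rw [Finsupp.degree_single] at he
          omega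
        rw [this, zero_smul]
      · rw [smul_zero]
    have hrc : ∀ e : Fin c →₀ ℕ, e.degree = n + 1 →
        d * coeffMatrix e r = coeffMatrix e r * d := by
      intro e he
      have hdeg : ∀ p ∈ Finset.HasAntidiagonal.antidiagonal e, p ≠ (0, e) →
          p ≠ (e, 0) → p.1.degree ≤ n ∧ p.2.degree ≤ n := by
        intro p hp h1 h2
        have h3 := Finset.HasAntidiagonal.mem_antidiagonal.1 hp
        have h4 : p.1.degree + p.2.degree = e.degree := by rw [← h3, map_add]
        have h5 : p.1.degree ≠ 0 := fun h0 => h1 (by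
          have := (Finsupp.degree_eq_zero_iff _).1 h0
          ext1 <;> simp_all)
        have h6 : p.2.degree ≠ 0 := fun h0 => h2 (by
          have := (Finsupp.degree_eq_zero_iff _).1 h0
          ext1 <;> simp_all)
        omega
      have hr0 : coeffMatrix 0 r = 0 := hn 0 (by simp)
      have he0 : e ≠ 0 := by rintro rfl; simp at he
      have h1 : coeffMatrix e (D * r) = d * coeffMatrix e r := by
        rw [coeffMatrix_mul, Finset.sum_eq_single (0, e), hD0]
        · intro p hp h1
          by_cases h2 : p = (e, 0)
          · subst h2; simp [hr0]
          · rw [hn _ (hdeg p hp h1 h2).2, mul_zero]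
        · intro h; exact (h (by simp)).elim
      have h2 : coeffMatrix e (r * D) = coeffMatrix e r * d := by
        rw [coeffMatrix_mul, Finset.sum_eq_single (e, 0), hD0]
        · intro p hp h2
          by_cases h1 : p = (0, e)
          · subst h1; simp [hr0]
          · rw [hn _ (hdeg p hp h1 h2).1, zero_mul]
        · intro h; exact (h (by simp)).elim
      rw [← h1, ← h2, hDr]
    have hη := fun (e : Fin c →₀ ℕ) (he : e.degree = n + 1) =>
      h.exists_homotopy (coeffMatrix e r) (hrh e he) (hrc e he) (hε e)
    choose η hη1 hη2 using hη
    let H : Matrix ι ι (MvPolynomial (Fin c) Q) := Matrix.of fun i j =>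
      ∑ e ∈ (Finset.finsuppAntidiag Finset.univ (n + 1) : Finset (Fin c →₀ ℕ)),
        if he : e.degree = n + 1 then MvPolynomial.monomial e (η e he i j) else 0
    have hH : ∀ (e : Fin c →₀ ℕ) (he : e.degree = n + 1), coeffMatrix e H = η e he := by
      intro e he
      ext i j
      simp only [coeffMatrix_apply, H, Matrix.of_apply, MvPolynomial.coeff_sum]
      rw [Finset.sum_eq_single e]
      · simp [he]
      · intro e' _ hne
        split_ifs
        · rw [MvPolynomial.coeff_monomial, if_neg hne]
        · rfl
      · intro h
        refine (h ?_).elim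
        rw [Finset.mem_finsuppAntidiag]
        exact ⟨by rw [← he, Finsupp.degree_eq_sum], Finset.subset_univ _⟩
    have hH0 : ∀ e : Fin c →₀ ℕ, e.degree ≠ n + 1 → coeffMatrix e H = 0 := by
      intro e he
      ext i j
      simp only [coeffMatrix_apply, H, Matrix.of_apply, MvPolynomial.coeff_sum]
      refine Finset.sum_eq_zero fun e' _ => ?_
      split_ifs with he'
      · rw [MvPolynomial.coeff_monomial, if_neg]
        rintro rfl; exact he he'
      · rfl
    refine ⟨D + H, ?_, ?_, ?_⟩
    · intro i j e hne
      by_cases h1 : (D i j).coeff e = 0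
      · have h2 : coeffMatrix e H i j ≠ 0 := by
          simpa [coeffMatrix_apply, h1] using hne
        by_cases he : e.degree = n + 1
        · rw [hH e he] at h2
          have := hη1 e he i j h2
          omega
        · rw [hH0 e he] at h2
          exact (h2 rfl).elim
      · exact hD i j e h1
    · rw [coeffMatrix_add, hD0, hH0 0 (by simp), add_zero]
    · intro e he
      -- Up to degree `n + 1` the square of `H` contributes nothing, and the cross terms only see
      -- the constant coefficient `d` of `D`.
      have e0 : potential f • 1 - (D + H) * (D + H) = r - (D * H + H * D) - H * H := by
        rw [hr]; noncomm_ring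
      have hHH : coeffMatrix e (H * H) = 0 := by
        rw [coeffMatrix_mul]
        refine Finset.sum_eq_zero fun p hp => ?_
        have h3 : p.1.degree + p.2.degree = e.degree := by
          rw [← Finset.HasAntidiagonal.mem_antidiagonal.1 hp, map_add]
        by_cases h1 : p.1.degree = n + 1
        · rw [hH0 p.2 (by omega), mul_zero]
        · rw [hH0 p.1 h1, zero_mul]
      have hle : ∀ p ∈ Finset.HasAntidiagonal.antidiagonal e,
          p.1.degree + p.2.degree = e.degree := fun p hp => by
        rw [← Finset.HasAntidiagonal.mem_antidiagonal.1 hp, map_add]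
      rw [e0, coeffMatrix_sub, coeffMatrix_sub, coeffMatrix_add, hHH, sub_zero]
      by_cases he' : e.degree = n + 1
      · have h1 : coeffMatrix e (D * H) = d * η e he' := by
          rw [coeffMatrix_mul, Finset.sum_eq_single (0, e), hD0, hH e he']
          · intro p hp h1
            rw [hH0 p.2, mul_zero]
            intro h2
            have h3 := hle p hp
            have h4 := (Finsupp.degree_eq_zero_iff p.1).1 (by omega)
            have h5 := Finset.HasAntidiagonal.mem_antidiagonal.1 hp
            exact h1 (by ext1 <;> simp_all)
          · intro h; exact (h (by simp)).elim
        have h2 : coeffMatrix e (H * D) = η e he' * d := by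
          rw [coeffMatrix_mul, Finset.sum_eq_single (e, 0), hD0, hH e he']
          · intro p hp h1
            rw [hH0 p.1, zero_mul]
            intro h2
            have h3 := hle p hp
            have h4 := (Finsupp.degree_eq_zero_iff p.2).1 (by omega)
            have h5 := Finset.HasAntidiagonal.mem_antidiagonal.1 hp
            exact h1 (by ext1 <;> simp_all)
          · intro h; exact (h (by simp)).elim
        rw [h1, h2, ← hη2 e he', sub_self]
      · rw [hn e (by omega), zero_sub, neg_eq_zero]
        have h1 : coeffMatrix e (D * H) = 0 := by
          rw [coeffMatrix_mul]
          exact Finset.sum_eq_zero fun p hp => by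
            rw [hH0 p.2 (by have := hle p hp; omega), mul_zero]
        have h2 : coeffMatrix e (H * D) = 0 := by
          rw [coeffMatrix_mul]
          exact Finset.sum_eq_zero fun p hp => by
            rw [hH0 p.1 (by have := hle p hp; omega), zero_mul]
        rw [h1, h2, add_zero]

/-- A finite free resolution of a module annihilated by the `fₗ` extends to a graded matrix
factorization of `∑ fₗ χₗ`, by a system of higher homotopies. -/
theorem IsFreeResolution.exists_matrixFactorization [DecidableEq ι]
    (h : IsFreeResolution deg d ε) (f : Fin c → Q) (hf : ∀ l (m : M), f l • m = 0) :
    ∃ D : Matrix ι ι (MvPolynomial (Fin c) Q),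
      IsMatrixFactorization deg (potential f) D ∧ coeffMatrix 0 D = d := by
  -- Beyond this degree the coefficients of `D²` vanish by homogeneity, the basis being finite, and
  -- those of `W` vanish because `W` is linear in the variables.
  obtain ⟨D, hD, hD0, hn⟩ := h.exists_matrixFactorization_mod f hf (Finset.univ.sup deg + 2)
  refine ⟨D, ⟨hD, ?_⟩, hD0⟩
  rw [eq_comm, ← sub_eq_zero]
  refine ext_coeffMatrix fun e => ?_
  by_cases he : e.degree ≤ Finset.univ.sup deg + 2
  · rw [hn e he]; ext; simp [coeffMatrix_apply]
  · ext i j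
    have hle : deg i ≤ Finset.univ.sup deg := Finset.le_sup (Finset.mem_univ i)
    have e1 : coeffMatrix e (D * D) i j = 0 := by
      rw [coeffMatrix_mul, Matrix.sum_apply]
      refine Finset.sum_eq_zero fun p hp => matrix_mul_apply_eq_zero fun k => ?_
      by_contra! h0
      have h1 := hD _ _ _ h0.1
      have h2 := hD _ _ _ h0.2
      have h3 : p.1.degree + p.2.degree = e.degree := by
        rw [← Finset.HasAntidiagonal.mem_antidiagonal.1 hp, map_add]
      omega
    have e2 : (potential f).coeff e = 0 := by
      simp only [potential, MvPolynomial.coeff_sum, MvPolynomial.coeff_C_mul]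
      refine Finset.sum_eq_zero fun l _ => ?_
      rw [MvPolynomial.coeff_X, if_neg, mul_zero]
      rintro rfl
      rw [Finsupp.degree_single] at he
      omega
    rw [coeffMatrix_sub, Matrix.sub_apply, e1, sub_zero, coeffMatrix_apply, Matrix.smul_apply,
      Matrix.one_apply]
    by_cases hij : i = j <;> simp [coeffMatrix_apply, hij, e2]

end MatrixFactorization

/-! ### Polynomials acting by contraction on functions of monomials. -/

section Contraction

variable {Q : Type u} [CommRing Q] {c : ℕ} (B : Type u) [CommRing B] [Algebra Q B]

/-- The translation of functions on monomials by the exponent `e`. -/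
noncomputable def translate (e : Fin c →₀ ℕ) : Module.End B ((Fin c →₀ ℕ) → B) where
  toFun γ a := γ (a + e)
  map_add' _ _ := rfl
  map_smul' _ _ := rfl

/-- The contraction action of polynomials on functions on monomials. -/
noncomputable def contract : MvPolynomial (Fin c) Q →ₐ[Q] Module.End B ((Fin c →₀ ℕ) → B) :=
  AddMonoidAlgebra.lift Q (Module.End B ((Fin c →₀ ℕ) → B)) (Fin c →₀ ℕ)
    { toFun := fun e => translate B e.toAdd
      map_one' := by ext; simp [translate]
      map_mul' := fun x y => by
        refine LinearMap.ext fun γ => funext fun a => ?_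
        change γ (a + (x.toAdd + y.toAdd)) = γ (a + x.toAdd + y.toAdd)
        rw [add_assoc] }

variable {B}

theorem contract_monomial (e : Fin c →₀ ℕ) (q : Q) :
    contract B (MvPolynomial.monomial e q) = q • translate B e :=
  AddMonoidAlgebra.lift_single _ _ _

theorem contract_apply (p : MvPolynomial (Fin c) Q) (γ : (Fin c →₀ ℕ) → B) (a : Fin c →₀ ℕ) :
    contract B p γ a = ∑ e ∈ p.support, algebraMap Q B (p.coeff e) * γ (a + e) := by
  have h : contract B p = ∑ e ∈ p.support, p.coeff e • translate B e := by
    conv_lhs => rw [p.as_sum]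
    rw [map_sum]
    refine Finset.sum_congr rfl fun e _ => ?_
    exact contract_monomial _ _
  rw [h, LinearMap.sum_apply, Finset.sum_apply]
  refine Finset.sum_congr rfl fun e _ => ?_
  rw [LinearMap.smul_apply, Pi.smul_apply, Algebra.smul_def]
  rfl

theorem contract_C (q : Q) (γ : (Fin c →₀ ℕ) → B) :
    contract B (MvPolynomial.C q) γ = algebraMap Q B q • γ := by
  rw [← MvPolynomial.algebraMap_eq, AlgHom.commutes, Module.algebraMap_end_apply, algebraMap_smul]

theorem contract_X (l : Fin c) (γ : (Fin c →₀ ℕ) → B) (a : Fin c →₀ ℕ) :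
    contract B (MvPolynomial.X l : MvPolynomial (Fin c) Q) γ a = γ (a + Finsupp.single l 1) := by
  rw [MvPolynomial.X, contract_monomial, one_smul]
  rfl

variable {ι κ τ : Type} [Fintype ι]

variable (B) in
/-- The action of a matrix of polynomials on tuples of functions on monomials, by contraction. -/
noncomputable def contractMatrix (X : Matrix κ ι (MvPolynomial (Fin c) Q)) :
    (ι → (Fin c →₀ ℕ) → B) →ₗ[B] (κ → (Fin c →₀ ℕ) → B) :=
  LinearMap.pi fun k => ∑ i, contract B (X k i) ∘ₗ LinearMap.proj i

theorem contractMatrix_apply (X : Matrix κ ι (MvPolynomial (Fin c) Q))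
    (z : ι → (Fin c →₀ ℕ) → B) (k : κ) : contractMatrix B X z k = ∑ i, contract B (X k i) (z i) := by
  simp [contractMatrix, LinearMap.sum_apply]

theorem contractMatrix_apply' (X : Matrix κ ι (MvPolynomial (Fin c) Q))
    (z : ι → (Fin c →₀ ℕ) → B) (k : κ) (a : Fin c →₀ ℕ) : contractMatrix B X z k a =
      ∑ i, ∑ e ∈ (X k i).support, algebraMap Q B ((X k i).coeff e) * z i (a + e) := by
  simp [contractMatrix_apply, Finset.sum_apply, contract_apply]

theorem contractMatrix_mul [Fintype κ] (Y : Matrix τ κ (MvPolynomial (Fin c) Q))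
    (X : Matrix κ ι (MvPolynomial (Fin c) Q)) (z : ι → (Fin c →₀ ℕ) → B) :
    contractMatrix B (Y * X) z = contractMatrix B Y (contractMatrix B X z) := by
  funext t
  simp only [contractMatrix_apply, Matrix.mul_apply, map_sum, LinearMap.sum_apply, map_mul,
    Module.End.mul_apply]
  exact Finset.sum_comm

theorem contractMatrix_add (X Y : Matrix κ ι (MvPolynomial (Fin c) Q))
    (z : ι → (Fin c →₀ ℕ) → B) :
    contractMatrix B (X + Y) z = contractMatrix B X z + contractMatrix B Y z := by
  funext k
  simp [contractMatrix_apply, Finset.sum_add_distrib]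

theorem contractMatrix_sub (X Y : Matrix κ ι (MvPolynomial (Fin c) Q))
    (z : ι → (Fin c →₀ ℕ) → B) :
    contractMatrix B (X - Y) z = contractMatrix B X z - contractMatrix B Y z := by
  funext k
  simp [contractMatrix_apply, Finset.sum_sub_distrib]

theorem contractMatrix_smul (p : MvPolynomial (Fin c) Q) (X : Matrix κ ι (MvPolynomial (Fin c) Q))
    (z : ι → (Fin c →₀ ℕ) → B) :
    contractMatrix B (p • X) z = contractMatrix B X (fun i => contract B p (z i)) := by
  funext k
  simp only [contractMatrix_apply, Matrix.smul_apply, smul_eq_mul, mul_comm p, map_mul,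
    Module.End.mul_apply]

theorem contractMatrix_one [DecidableEq ι] (z : ι → (Fin c →₀ ℕ) → B) :
    contractMatrix B (1 : Matrix ι ι (MvPolynomial (Fin c) Q)) z = z := by
  funext k
  rw [contractMatrix_apply, Finset.sum_eq_single k]
  · simp
  · intro b _ hb; simp [Matrix.one_apply_ne hb.symm]
  · simp

theorem contractMatrix_contract (p : MvPolynomial (Fin c) Q)
    (X : Matrix κ ι (MvPolynomial (Fin c) Q)) (z : ι → (Fin c →₀ ℕ) → B) (k : κ) :
    contractMatrix B X (fun i => contract B p (z i)) k = contract B p (contractMatrix B X z k) := by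
  simp only [contractMatrix_apply, map_sum, ← Module.End.mul_apply, ← map_mul, mul_comm p]

theorem contract_potential (f : Fin c → Q) (γ : (Fin c →₀ ℕ) → B) (a : Fin c →₀ ℕ) :
    contract B (potential f) γ a = ∑ l, algebraMap Q B (f l) * γ (a + Finsupp.single l 1) := by
  simp [potential, LinearMap.sum_apply, Finset.sum_apply, contract_X, Algebra.smul_def]

theorem IsMatrixFactorization.contractMatrix_sq [DecidableEq ι] {deg : ι → ℕ} {f : Fin c → Q}
    {D : Matrix ι ι (MvPolynomial (Fin c) Q)} (h : IsMatrixFactorization deg (potential f) D)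
    (z : ι → (Fin c →₀ ℕ) → B) (i : ι) (a : Fin c →₀ ℕ) :
    contractMatrix B D (contractMatrix B D z) i a =
      ∑ l, algebraMap Q B (f l) * z i (a + Finsupp.single l 1) := by
  rw [← contractMatrix_mul, h.sq, contractMatrix_smul, contractMatrix_one, contract_potential]

/-- Values in an ideal are preserved by contraction. -/
theorem contractMatrix_mem (I : Ideal B) (X : Matrix κ ι (MvPolynomial (Fin c) Q))
    (z : ι → (Fin c →₀ ℕ) → B) (hz : ∀ i a, z i a ∈ I) (k : κ) (a : Fin c →₀ ℕ) :
    contractMatrix B X z k a ∈ I := by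
  rw [contractMatrix_apply']
  exact sum_mem fun i _ => sum_mem fun e _ => Ideal.mul_mem_left _ _ (hz _ _)

/-- Contraction commutes with change of the ring of values. -/
theorem contractMatrix_algebraMap (X : Matrix κ ι (MvPolynomial (Fin c) Q))
    (z : ι → (Fin c →₀ ℕ) → Q) (k : κ) (a : Fin c →₀ ℕ) :
    contractMatrix B X (fun i a => algebraMap Q B (z i a)) k a =
      algebraMap Q B (contractMatrix Q X z k a) := by
  simp [contractMatrix_apply', map_sum]

/-- In the rows of degree zero homogeneity leaves only the constant coefficient `d` of `D`, and `ε ∘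
d = 0`. -/
theorem IsFreeResolution.sum_contractMatrix [DecidableEq ι] {deg : ι → ℕ} {W : MvPolynomial (Fin c) Q}
    {D : Matrix ι ι (MvPolynomial (Fin c) Q)} (h : IsMatrixFactorization deg W D)
    {M : Type u} [AddCommGroup M] [Module Q M] [Module B M] [IsScalarTower Q B M] {ε : ι → M}
    (hε : IsFreeResolution deg (coeffMatrix 0 D) ε) (z : ι → (Fin c →₀ ℕ) → B) :
    ∑ i, contractMatrix B D z i 0 • ε i = 0 := by
  have key : ∀ i, contractMatrix B D z i 0 • ε i = ∑ k, z k 0 • (coeffMatrix 0 D i k • ε i) := by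
    intro i
    by_cases hi : ε i = 0
    · simp [hi]
    · have h0 := hε.eps_deg i hi
      rw [contractMatrix_apply', Finset.sum_smul]
      refine Finset.sum_congr rfl fun k _ => ?_
      have : ∑ e ∈ (D i k).support, algebraMap Q B ((D i k).coeff e) * z k (0 + e) =
          algebraMap Q B ((D i k).coeff 0) * z k 0 := by
        rw [Finset.sum_eq_single 0]
        · rw [zero_add]
        · intro e he hne
          have h1 := h.homog i k e (MvPolynomial.mem_support_iff.1 he)
          have h2 : e.degree ≠ 0 := fun h0 => hne ((Finsupp.degree_eq_zero_iff _).1 h0)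
          omega
        · intro h0
          rw [MvPolynomial.notMem_support_iff.1 h0, map_zero, zero_mul]
      rw [this, mul_comm, mul_smul, algebraMap_smul]
      rfl
  simp_rw [key]
  rw [Finset.sum_comm]
  refine Finset.sum_eq_zero fun k _ => ?_
  rw [← Finset.smul_sum, hε.eps_d, smul_zero]

end Contraction

/-! ### Exactness of the contraction complex modulo the regular sequence. -/

section Exactness

variable {Q : Type u} [CommRing Q] {c : ℕ}

theorem mul_mem_span_iff_of_isWeaklyRegular {f : Fin c → Q}
    (hf : RingTheory.Sequence.IsWeaklyRegular Q (List.ofFn f)) (j : Fin c) (x : Q)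
    (hx : f j * x ∈ Ideal.span (f '' {l | l < j})) : x ∈ Ideal.span (f '' {l | l < j}) := by
  rw [RingTheory.Sequence.isWeaklyRegular_iff_Fin] at hf
  have h := hf (j.cast (by simp))
  have hI : Ideal.ofList ((List.ofFn f).take (j.cast (by simp) : Fin (List.ofFn f).length)) =
      Ideal.span (f '' {l | l < j}) := by
    rw [Ideal.ofList]
    congr 1
    ext y
    simp only [Set.mem_ofPred_eq, Set.mem_image, List.mem_take_iff_getElem, List.getElem_ofFn]
    constructor
    · rintro ⟨i, hi, rfl⟩
      simp at hi
      exact ⟨⟨i, by omega⟩, by rw [Fin.lt_def]; simp; omega, rfl⟩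
    · rintro ⟨l, hl, rfl⟩
      refine ⟨l, ?_, rfl⟩
      simpa using hl
  have hle : ∀ y : Q, y ∈ Ideal.ofList ((List.ofFn f).take
      (j.cast (by simp) : Fin (List.ofFn f).length)) • (⊤ : Submodule Q Q) ↔
      y ∈ Ideal.span (f '' {l | l < j}) := by
    intro y
    rw [smul_eq_mul, Ideal.mul_top, hI]
  have h3 := isSMulRegular_iff_right_eq_zero_of_smul.1 h (Submodule.Quotient.mk x) (by
    rw [← Submodule.Quotient.mk_smul, Submodule.Quotient.mk_eq_zero, hle]
    simpa using hx)
  rwa [Submodule.Quotient.mk_eq_zero, hle] at h3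

end Exactness

section Exactness

variable {Q : Type u} [CommRing Q] {c : ℕ} {ι : Type} [Fintype ι] [DecidableEq ι]

/-- The complex of contractions attached to a matrix factorization extending a free resolution
is exact modulo the `fₗ`: the statement for functions of the first `j` variables, over `Q`. -/
theorem exists_contractMatrix_sub_mem {deg : ι → ℕ} {f : Fin c → Q}
    {D : Matrix ι ι (MvPolynomial (Fin c) Q)}
    (hf : RingTheory.Sequence.IsWeaklyRegular Q (List.ofFn f))
    (h : IsMatrixFactorization deg (potential f) D)
    {M : Type u} [AddCommGroup M] [Module Q M] {ε : ι → M}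
    (hε : IsFreeResolution deg (coeffMatrix 0 D) ε) (j : ℕ) (hj : j ≤ c) :
    ∀ z : ι → (Fin c →₀ ℕ) → Q, (∀ i a (l : Fin c), j ≤ l → a l ≠ 0 → z i a = 0) →
      (∀ i a, contractMatrix Q D z i a ∈ Ideal.span (f '' {l | (l : ℕ) < j})) →
      ∑ i, z i 0 • ε i = 0 →
      ∃ u : ι → (Fin c →₀ ℕ) → Q, (∀ i a (l : Fin c), j ≤ l → a l ≠ 0 → u i a = 0) ∧
        ∀ i a, z i a - contractMatrix Q D u i a ∈ Ideal.span (f '' {l | (l : ℕ) < j}) := by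
  induction j with
  | zero =>
    intro z hz hDz hεz
    have hsupp : ∀ (v : ι → (Fin c →₀ ℕ) → Q),
        (∀ i a (l : Fin c), 0 ≤ (l : ℕ) → a l ≠ 0 → v i a = 0) → ∀ i a, a ≠ 0 → v i a = 0 := by
      intro v hv i a ha
      obtain ⟨l, hl⟩ := Finsupp.ne_iff.1 ha
      exact hv i a l (Nat.zero_le _) hl
    have hD0 : ∀ (v : ι → (Fin c →₀ ℕ) → Q), (∀ i a, a ≠ 0 → v i a = 0) → ∀ i a,
        contractMatrix Q D v i a = if a = 0 then (coeffMatrix 0 D).mulVec (fun k => v k 0) i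
          else 0 := by
      intro v hv i a
      rw [contractMatrix_apply']
      split_ifs with ha
      · subst ha
        refine Finset.sum_congr rfl fun k _ => ?_
        rw [Finset.sum_eq_single 0]
        · rw [zero_add]; rfl
        · intro e _ he
          rw [hv k _ (by simpa using he), mul_zero]
        · intro h0
          rw [MvPolynomial.notMem_support_iff.1 h0, map_zero, zero_mul]
      · refine Finset.sum_eq_zero fun k _ => Finset.sum_eq_zero fun e _ => ?_
        rw [hv k _ (by simp [ha]), mul_zero]
    have hz' := hsupp z hz
    -- Without variables, functions are supported at the exponent zero and `D` acts through `d`: the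
    -- statement is exactness of the resolution over `Q`.
    obtain ⟨w, hw⟩ := hε.exact (fun k => z k 0) (by
      ext i
      have := hDz i 0
      rw [hD0 z hz'] at this
      simpa using this) hεz
    have hw' : ∀ i (a : Fin c →₀ ℕ), a ≠ 0 → (if a = 0 then w i else 0) = 0 :=
      fun i a ha => if_neg ha
    refine ⟨fun i a => if a = 0 then w i else 0, fun i a l _ hl => if_neg ?_, fun i a => ?_⟩
    · rintro rfl; exact hl rfl
    · rw [hD0 (fun i a => if a = 0 then w i else 0) hw']
      by_cases ha : a = 0
      · subst ha
        have := congrFun hw i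
        simp only [if_true] at this ⊢
        rw [this, sub_self]
        exact zero_mem _
      · rw [hz' i a ha, if_neg ha, sub_zero]
        exact zero_mem _
  | succ j ih =>
    intro z hz hDz hεz
    let J : Fin c := ⟨j, hj⟩
    set I := Ideal.span (f '' {l : Fin c | (l : ℕ) < j}) with hI
    have hle : I ≤ Ideal.span (f '' {l : Fin c | (l : ℕ) < j + 1}) :=
      Ideal.span_mono (Set.image_mono fun l (hl : (l : ℕ) < j) => Nat.lt_succ_of_lt hl)
    have hfI : ∀ l : Fin c, (l : ℕ) < j → f l ∈ I := fun l hl => Ideal.subset_span ⟨l, hl, rfl⟩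
    have hreg : ∀ x, f J * x ∈ I → x ∈ I := fun x hx =>
      mul_mem_span_iff_of_isWeaklyRegular hf J x hx
    have hI' : ∀ x ∈ Ideal.span (f '' {l : Fin c | (l : ℕ) < j + 1}), ∃ y, x - f J * y ∈ I := by
      intro x hx
      have : f '' {l : Fin c | (l : ℕ) < j + 1} = insert (f J) (f '' {l : Fin c | (l : ℕ) < j}) := by
        rw [← Set.image_insert_eq]
        congr 1
        ext l
        simp only [Set.mem_insert_iff, Fin.ext_iff, J]
        change (l : ℕ) < j + 1 ↔ (l : ℕ) = j ∨ (l : ℕ) < j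
        omega
      rw [this, Ideal.mem_span_insert] at hx
      obtain ⟨y, x', hx', rfl⟩ := hx
      exact ⟨y, by rw [mul_comm (f J), add_sub_cancel_left]; exact hx'⟩
    choose w₀ hw₀ using fun i a => hI' _ (hDz i a)
    -- Modulo `I`, `D z` is `f_J w`. The choice of `w` is made to vanish outside the first `j + 1`
    -- variables, where `D z` already vanishes.
    obtain ⟨w, hwz, hw⟩ : ∃ w : ι → (Fin c →₀ ℕ) → Q,
        (∀ i a (l : Fin c), j + 1 ≤ l → a l ≠ 0 → w i a = 0) ∧
        ∀ i a, contractMatrix Q D z i a - f J * w i a ∈ I := by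
      refine ⟨fun i a => if ∃ l : Fin c, j + 1 ≤ l ∧ a l ≠ 0 then 0 else w₀ i a,
        fun i a l hl ha => if_pos ⟨l, hl, ha⟩, fun i a => ?_⟩
      dsimp only
      split_ifs with ha
      · obtain ⟨l, hl, ha⟩ := ha
        rw [contractMatrix_apply', Finset.sum_eq_zero, mul_zero, sub_zero]
        · exact zero_mem _
        · refine fun k _ => Finset.sum_eq_zero fun e _ => ?_
          rw [hz k _ l hl (by simp [ha]), mul_zero]
      · exact hw₀ i a
    -- the part of `D² = ∑ fₗ χₗ` surviving modulo `I` on functions of the first `j + 1` variables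
    have hsq : ∀ v : ι → (Fin c →₀ ℕ) → Q,
        (∀ i a (l : Fin c), j + 1 ≤ l → a l ≠ 0 → v i a = 0) → ∀ i a,
        contractMatrix Q D (contractMatrix Q D v) i a - f J * v i (a + Finsupp.single J 1) ∈ I := by
      intro v hv i a
      rw [h.contractMatrix_sq, ← Finset.add_sum_erase _ _ (Finset.mem_univ J)]
      change f J * _ + _ - _ ∈ I
      rw [add_sub_cancel_left]
      refine sum_mem fun l hl => ?_
      have hlJ : (l : ℕ) ≠ j := fun h0 => (Finset.mem_erase.1 hl).1 (Fin.ext h0)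
      by_cases hlj : (l : ℕ) < j
      · exact Ideal.mul_mem_right _ _ (hfI l hlj)
      · rw [hv i _ l (by omega) (by simp), mul_zero]
        exact zero_mem _
    -- `u` is `w` moved up by one in the variable `χ_J`, so that contraction with `χ_J` sends `u` to
    -- `w`. Subtracting `D u` from `z` should remove all dependence on that variable modulo `I`.
    let u : ι → (Fin c →₀ ℕ) → Q := fun i a =>
      if a J = 0 then 0 else w i (a - Finsupp.single J 1)
    have hu : ∀ i a, u i (a + Finsupp.single J 1) = w i a := fun i a => by
      simp only [u, Finsupp.add_apply, Finsupp.single_eq_same]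
      rw [if_neg (by omega), add_tsub_cancel_right]
    have huz : ∀ i a (l : Fin c), j + 1 ≤ l → a l ≠ 0 → u i a = 0 := by
      intro i a l hl ha
      simp only [u]
      split_ifs with h0
      · rfl
      · have hne : J ≠ l := fun h => by rw [← h] at hl; exact absurd hl (by simp [J])
        exact hwz i _ l hl (by simpa [Finsupp.single_apply, hne] using ha)
    set v' : ι → (Fin c →₀ ℕ) → Q := z - contractMatrix Q D u with hv'
    have hDu0 : ∀ i a (l : Fin c), j + 1 ≤ l → a l ≠ 0 → contractMatrix Q D u i a = 0 := by
      intro i a l hl ha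
      rw [contractMatrix_apply']
      refine Finset.sum_eq_zero fun k _ => Finset.sum_eq_zero fun e _ => ?_
      rw [huz k _ l hl (by simp [ha]), mul_zero]
    have hv'z : ∀ i a (l : Fin c), j + 1 ≤ l → a l ≠ 0 → v' i a = 0 := fun i a l hl ha => by
      simp [hv', hz i a l hl ha, hDu0 i a l hl ha]
    have hshift : ∀ i a, contractMatrix Q D u i (a + Finsupp.single J 1) =
        contractMatrix Q D w i a := by
      intro i a
      have e : (fun k => contract Q (MvPolynomial.X J : MvPolynomial (Fin c) Q) (u k)) = w := by
        funext k b
        rw [contract_X, hu]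
      have := congrFun (contractMatrix_contract (B := Q) (MvPolynomial.X J) D u i) a
      rw [contract_X, e] at this
      exact this.symm
    -- Modulo `I`, both `f_J χ_J z` and `f_J D w` equal `D² z`; regularity of `f_J` modulo `I`
    -- cancels the factor `f_J`.
    have hv'J : ∀ i a, v' i (a + Finsupp.single J 1) ∈ I := by
      intro i a
      rw [hv', Pi.sub_apply, Pi.sub_apply, hshift]
      refine hreg _ ?_
      have e1 := hsq z hz i a
      have e2 := contractMatrix_mem I D (contractMatrix Q D z - f J • w) (fun i a => hw i a) i a
      rw [map_sub, map_smul] at e2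
      have e3 := sub_mem e2 e1
      simpa [mul_sub] using e3
    -- The part of `v'` involving `χ_J` lies in `I` and is discarded, which leaves a function of the
    -- first `j` variables to which the induction applies.
    let v : ι → (Fin c →₀ ℕ) → Q := fun i a => if a J = 0 then v' i a else 0
    have hvv' : ∀ i a, v' i a - v i a ∈ I := by
      intro i a
      simp only [v]
      split_ifs with h0
      · simp
      · rw [sub_zero, ← tsub_add_cancel_of_le (show Finsupp.single J 1 ≤ a by
          rw [Finsupp.single_le_iff]; omega)]
        exact hv'J i _
    have hv0 : ∀ i a (l : Fin c), j ≤ l → a l ≠ 0 → v i a = 0 := by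
      intro i a l hl ha
      simp only [v]
      split_ifs with h0
      · refine hv'z i a l ?_ ha
        refine lt_of_le_of_ne hl fun h => ha ?_
        rwa [show l = J from Fin.ext h.symm]
      · rfl
    have hDv : ∀ i a, contractMatrix Q D v i a ∈ I := by
      intro i a
      have e1 := contractMatrix_mem I D (v' - v) (fun i a => hvv' i a) i a
      have e2 := hsq u huz i a
      rw [hu] at e2
      have e3 := sub_mem (sub_mem (hw i a) e2) e1
      rw [map_sub, hv', map_sub] at e3
      simpa using e3
    obtain ⟨u', hu'0, hu'⟩ := ih (by omega) v hv0 hDv (by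
      have e1 := IsFreeResolution.sum_contractMatrix (B := Q) h hε u
      have e2 : ∀ i, v i 0 • ε i = z i 0 • ε i - contractMatrix Q D u i 0 • ε i := by
        intro i
        rw [← sub_smul]
        simp [v, hv']
      rw [Finset.sum_congr rfl fun i _ => e2 i, Finset.sum_sub_distrib, hεz, e1, sub_zero])
    refine ⟨u' + u, ?_, fun i a => hle ?_⟩
    · intro i a l hl ha
      rw [Pi.add_apply, Pi.add_apply, hu'0 i a l (by omega) ha, huz i a l hl ha, add_zero]
    · have := add_mem (hvv' i a) (hu' i a)
      rw [map_add]
      simp only [hv', Pi.sub_apply, Pi.add_apply] at this ⊢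
      convert this using 1
      ring

theorem exists_contractMatrix_eq {R : Type u} [CommRing R] [Algebra Q R] [IsLocalRing Q]
    {deg : ι → ℕ} {f : Fin c → Q} (hf : IsCompleteIntersection f R)
    {D : Matrix ι ι (MvPolynomial (Fin c) Q)}
    (h : IsMatrixFactorization deg (potential f) D)
    {M : Type u} [AddCommGroup M] [Module R M] [Module Q M] [IsScalarTower Q R M] {ε : ι → M}
    (hε : IsFreeResolution deg (coeffMatrix 0 D) ε) (z : ι → (Fin c →₀ ℕ) → R)
    (hz : contractMatrix R D z = 0) (hz' : ∑ i, z i 0 • ε i = 0) :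
    ∃ u, z = contractMatrix R D u := by
  choose z' hz'' using fun i a => hf.surjective (z i a)
  have hI : Ideal.span (f '' {l : Fin c | (l : ℕ) < c}) = RingHom.ker (algebraMap Q R) := by
    rw [hf.ker_eq]
    congr 1
    ext x
    simp
  have hzz : z = fun i a => algebraMap Q R (z' i a) := by
    funext i a; exact (hz'' i a).symm
  obtain ⟨u, -, hu⟩ := exists_contractMatrix_sub_mem hf.isRegular.toIsWeaklyRegular h
    (M := M) (ε := ε) hε c le_rfl z'
    (fun i a l hl => absurd l.2 (by omega)) (fun i a => by
      rw [hI, RingHom.mem_ker, ← contractMatrix_algebraMap, ← hzz, hz]; rfl) (by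
      rw [← hz']
      exact Finset.sum_congr rfl fun i _ => by rw [← hz'', algebraMap_smul])
  refine ⟨fun i a => algebraMap Q R (u i a), ?_⟩
  funext i a
  have := hu i a
  rw [hI, RingHom.mem_ker, map_sub, hz'', sub_eq_zero] at this
  rw [this, contractMatrix_algebraMap]

end Exactness

open CategoryTheory

/-! ### The contraction complex of free `R`-modules and its Eisenbud operators. -/

section ContractionComplex

variable {Q : Type u} [CommRing Q] {c : ℕ} {ι κ : Type}

/-- The positions of cohomological degree `n` in `ι → (Fin c →₀ ℕ) → B`. -/
abbrev Position (c : ℕ) (deg : ι → ℕ) (n : ℤ) : Type :=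
  {x : ι × (Fin c →₀ ℕ) // ((2 * x.2.degree + deg x.1 : ℕ) : ℤ) = -n}

instance Position.finite [Finite ι] (deg : ι → ℕ) (n : ℤ) : Finite (Position c deg n) := by
  have h : {a : Fin c →₀ ℕ | a.degree ≤ (-n).toNat}.Finite := Finsupp.finite_of_degree_le _
  have := (Set.finite_univ (α := ι)).prod h
  refine (this.subset ?_).to_subtype
  rintro ⟨i, a⟩ hx
  refine ⟨trivial, ?_⟩
  change a.degree ≤ _
  have hx : ((2 * a.degree + deg i : ℕ) : ℤ) = -n := hx
  omega

theorem position_isEmpty {deg : ι → ℕ} {n : ℤ} (hn : 0 < n) : IsEmpty (Position c deg n) :=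
  ⟨fun x => by have := x.2; omega⟩

variable (B : Type u) [CommRing B] [Algebra Q B] (deg : ι → ℕ)

/-- Restriction to the positions of degree `n`. -/
noncomputable def restrictDegree (n : ℤ) : (ι → (Fin c →₀ ℕ) → B) →ₗ[B] (Position c deg n → B) where
  toFun z x := z x.1.1 x.1.2
  map_add' _ _ := rfl
  map_smul' _ _ := rfl

/-- Extension by zero from the positions of degree `n`. -/
noncomputable def extendDegree (n : ℤ) : (Position c deg n → B) →ₗ[B] (ι → (Fin c →₀ ℕ) → B) where
  toFun z i a := if h : ((2 * a.degree + deg i : ℕ) : ℤ) = -n then z ⟨(i, a), h⟩ else 0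
  map_add' x y := by
    funext i a
    simp only [Pi.add_apply]
    split_ifs <;> simp
  map_smul' r x := by
    funext i a
    simp only [Pi.smul_apply, RingHom.id_apply]
    split_ifs <;> simp

variable {B deg}

theorem restrictDegree_apply (n : ℤ) (z : ι → (Fin c →₀ ℕ) → B) (x : Position c deg n) :
    restrictDegree B deg n z x = z x.1.1 x.1.2 := rfl

theorem extendDegree_of_ne {n : ℤ} (z : Position c deg n → B) {i : ι} {a : Fin c →₀ ℕ}
    (h : ((2 * a.degree + deg i : ℕ) : ℤ) ≠ -n) : extendDegree B deg n z i a = 0 := dif_neg h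

theorem extendDegree_coe {n : ℤ} (z : Position c deg n → B) (x : Position c deg n) :
    extendDegree B deg n z x.1.1 x.1.2 = z x := dif_pos x.2

theorem restrictDegree_extendDegree {n : ℤ} (z : Position c deg n → B) :
    restrictDegree B deg n (extendDegree B deg n z) = z :=
  funext fun x => extendDegree_coe z x

theorem extendDegree_restrictDegree {n : ℤ} (z : ι → (Fin c →₀ ℕ) → B)
    (h : ∀ i a, ((2 * a.degree + deg i : ℕ) : ℤ) ≠ -n → z i a = 0) :
    extendDegree B deg n (restrictDegree B deg n z) = z := by
  funext i a
  by_cases hx : ((2 * a.degree + deg i : ℕ) : ℤ) = -n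
  · exact extendDegree_coe _ ⟨(i, a), hx⟩
  · rw [extendDegree_of_ne _ hx, h i a hx]

theorem extendDegree_restrictDegree_apply {n : ℤ} (z : ι → (Fin c →₀ ℕ) → B) {i : ι}
    {a : Fin c →₀ ℕ} (h : ((2 * a.degree + deg i : ℕ) : ℤ) = -n) :
    extendDegree B deg n (restrictDegree B deg n z) i a = z i a :=
  extendDegree_coe _ ⟨(i, a), h⟩

variable {deg' : κ → ℕ}

/-- A matrix of polynomials is homogeneous of degree `m`. -/
def IsHomogeneousOfDegree (deg : ι → ℕ) (deg' : κ → ℕ) (m : ℤ)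
    (X : Matrix κ ι (MvPolynomial (Fin c) Q)) : Prop :=
  ∀ k i e, (X k i).coeff e ≠ 0 → ((2 * e.degree + deg i : ℕ) : ℤ) = deg' k + m

variable (Q ι) in
/-- The scalar matrix `χₗ`. -/
noncomputable def variableMatrix [DecidableEq ι] (l : Fin c) :
    Matrix ι ι (MvPolynomial (Fin c) Q) := (MvPolynomial.X l : MvPolynomial (Fin c) Q) • 1

theorem isHomogeneousOfDegree_variableMatrix [DecidableEq ι] (l : Fin c) :
    IsHomogeneousOfDegree deg deg 2 (variableMatrix Q ι l) := by
  intro k i e he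
  rw [variableMatrix] at he
  by_cases hki : k = i
  · subst hki
    rw [Matrix.smul_apply, Matrix.one_apply_eq, smul_eq_mul, mul_one, MvPolynomial.coeff_X] at he
    have : Finsupp.single l 1 = e := by
      by_contra h0
      exact he (if_neg h0)
    rw [← this, Finsupp.degree_single]
    push_cast
    ring
  · exact absurd (by simp [Matrix.one_apply_ne hki]) he

variable [Fintype ι]

theorem IsHomogeneousOfDegree.extendDegree {m : ℤ} {X : Matrix κ ι (MvPolynomial (Fin c) Q)}
    (hX : IsHomogeneousOfDegree deg deg' m X) {n n' : ℤ} (hn : n + m = n')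
    (z : Position c deg n → B) :
    extendDegree B deg' n' (restrictDegree B deg' n'
      (contractMatrix B X (extendDegree B deg n z))) =
      contractMatrix B X (extendDegree B deg n z) := by
  refine extendDegree_restrictDegree _ fun k a hka => ?_
  rw [contractMatrix_apply']
  refine Finset.sum_eq_zero fun i _ => Finset.sum_eq_zero fun e he => ?_
  rw [extendDegree_of_ne, mul_zero]
  have := hX k i e (MvPolynomial.mem_support_iff.1 he)
  rw [map_add]
  push_cast at *
  omega

/-- A coefficient of exponent `e` in row `k` and column `i` reads the position `(i, a + e)` in order
to fill `(k, a)`; homogeneity says that these two degrees differ by exactly `m`. -/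
theorem IsHomogeneousOfDegree.restrictDegree {m : ℤ} {X : Matrix κ ι (MvPolynomial (Fin c) Q)}
    (hX : IsHomogeneousOfDegree deg deg' m X) {n n' : ℤ} (hn : n + m = n')
    (z : ι → (Fin c →₀ ℕ) → B) :
    restrictDegree B deg' n' (contractMatrix B X z) = restrictDegree B deg' n'
      (contractMatrix B X (TotallyAcyclicVariety.extendDegree B deg n
        (TotallyAcyclicVariety.restrictDegree B deg n z))) := by
  funext ⟨⟨k, a⟩, hx⟩
  simp only [restrictDegree_apply, contractMatrix_apply']
  refine Finset.sum_congr rfl fun i _ => Finset.sum_congr rfl fun e he => ?_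
  rw [extendDegree_restrictDegree_apply]
  have := hX k i e (MvPolynomial.mem_support_iff.1 he)
  change ((2 * a.degree + deg' k : ℕ) : ℤ) = -n' at hx
  rw [map_add]
  push_cast at *
  omega

theorem IsMatrixFactorization.isHomogeneousOfDegree [DecidableEq ι] {W : MvPolynomial (Fin c) Q}
    {D : Matrix ι ι (MvPolynomial (Fin c) Q)} (h : IsMatrixFactorization deg W D) :
    IsHomogeneousOfDegree deg deg 1 D := fun k i e he => by
  have := h.homog k i e he
  push_cast
  omega

variable (B) in
/-- The map in degree `n` given by the contraction with a matrix. -/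
noncomputable def contractDegree (deg : ι → ℕ) (X : Matrix ι ι (MvPolynomial (Fin c) Q))
    (n n' : ℤ) : (Position c deg n → B) →ₗ[B] (Position c deg n' → B) :=
  restrictDegree B deg n' ∘ₗ contractMatrix B X ∘ₗ extendDegree B deg n

theorem extendDegree_contractDegree {m : ℤ} {X : Matrix ι ι (MvPolynomial (Fin c) Q)}
    (hX : IsHomogeneousOfDegree deg deg m X) {n n' : ℤ} (hn : n + m = n')
    (z : Position c deg n → B) : extendDegree B deg n' (contractDegree B deg X n n' z) =
      contractMatrix B X (extendDegree B deg n z) :=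
  hX.extendDegree hn z

theorem contractDegree_contractDegree {m : ℤ} {X Y : Matrix ι ι (MvPolynomial (Fin c) Q)}
    (hX : IsHomogeneousOfDegree deg deg m X) {n n' n'' : ℤ} (hn : n + m = n')
    (z : Position c deg n → B) :
    contractDegree B deg Y n' n'' (contractDegree B deg X n n' z) =
      contractDegree B deg (Y * X) n n'' z := by
  change restrictDegree B deg n'' (contractMatrix B Y (extendDegree B deg n' _)) =
    restrictDegree B deg n'' (contractMatrix B (Y * X) _)
  rw [extendDegree_contractDegree hX hn, contractMatrix_mul]

theorem contractDegree_algebraMap (X : Matrix ι ι (MvPolynomial (Fin c) Q)) (n n' : ℤ)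
    (z : Position c deg n → Q) :
    contractDegree B deg X n n' (fun x => algebraMap Q B (z x)) =
      fun x => algebraMap Q B (contractDegree Q deg X n n' z x) := by
  funext x
  change contractMatrix B X (extendDegree B deg n _) x.1.1 x.1.2 = algebraMap Q B
    (contractMatrix Q X (extendDegree Q deg n z) x.1.1 x.1.2)
  rw [← contractMatrix_algebraMap]
  suffices e : extendDegree B deg n (fun x => algebraMap Q B (z x)) =
      fun i a => algebraMap Q B (extendDegree Q deg n z i a) by rw [e]
  funext i a
  simp only [extendDegree, LinearMap.coe_mk, AddHom.coe_mk]
  split_ifs <;> simp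

theorem contractDegree_potential [DecidableEq ι] (f : Fin c → Q)
    (n n' : ℤ) (z : Position c deg n → B) :
    contractDegree B deg (potential f • (1 : Matrix ι ι (MvPolynomial (Fin c) Q))) n n' z =
      ∑ l, algebraMap Q B (f l) • contractDegree B deg (variableMatrix Q ι l) n n' z := by
  funext x
  rw [Finset.sum_apply]
  simp only [Pi.smul_apply]
  change contractMatrix B _ _ x.1.1 x.1.2 = ∑ l, algebraMap Q B (f l) •
    contractMatrix B _ (extendDegree B deg n z) x.1.1 x.1.2
  simp only [variableMatrix, contractMatrix_smul, contractMatrix_one, contract_potential, contract_X, smul_eq_mul]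

variable [DecidableEq ι] {f : Fin c → Q} {D : Matrix ι ι (MvPolynomial (Fin c) Q)}
  {R : Type u} [CommRing R] [Algebra Q R]

/-- The complex of free `R`-modules attached to a matrix factorization of `∑ fₗ χₗ` over `Q`, for
`R` an algebra over `Q` in which the `fₗ` vanish. -/
noncomputable def contractionComplex (R : Type u) [CommRing R] [Algebra Q R]
    (h : IsMatrixFactorization deg (potential f) D) (hfR : ∀ l, algebraMap Q R (f l) = 0) :
    CochainComplex (ModuleCat.{u} R) ℤ :=
  CochainComplex.of (fun n => ModuleCat.of R (Position c deg n → R))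
    (fun n => ModuleCat.ofHom (contractDegree R deg D n (n + 1)))
    (fun n => by
      ext1
      refine LinearMap.ext fun z => ?_
      change contractDegree R deg D (n + 1) (n + 1 + 1) (contractDegree R deg D n (n + 1) z) = 0
      rw [contractDegree_contractDegree h.isHomogeneousOfDegree rfl, h.sq,
        contractDegree_potential]
      simp [hfR])

variable (h : IsMatrixFactorization deg (potential f) D) (hfR : ∀ l, algebraMap Q R (f l) = 0)

theorem contractionComplex_d (n : ℤ) : (contractionComplex R h hfR).d n (n + 1) =
    ModuleCat.ofHom (contractDegree R deg D n (n + 1)) :=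
  CochainComplex.of_d (fun n => ModuleCat.of R (Position c deg n → R))
    (fun n => ModuleCat.ofHom (contractDegree R deg D n (n + 1))) n

theorem contractionComplex_d_apply {n n' : ℤ} (hn : n + 1 = n') (z : Position c deg n → R) :
    ((contractionComplex R h hfR).d n n').hom z = contractDegree R deg D n n' z := by
  subst hn
  rw [contractionComplex_d]
  rfl

/-- The reduction of coefficients. -/
def coefficientReduction (R : Type u) [CommRing R] [Algebra Q R] (P : Type) :
    (P → Q) →ₛₗ[algebraMap Q R] (P → R) where
  toFun z x := algebraMap Q R (z x)
  map_add' _ _ := by funext; simp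
  map_smul' _ _ := by funext; simp

theorem ker_coefficientReduction (P : Type) [Finite P] :
    LinearMap.ker (coefficientReduction (Q := Q) R P) =
      RingHom.ker (algebraMap Q R) • (⊤ : Submodule Q (P → Q)) := by
  classical
  have := Fintype.ofFinite P
  ext v
  constructor
  · intro hv
    rw [pi_eq_sum_univ' v]
    exact sum_mem fun i _ => Submodule.smul_mem_smul (RingHom.mem_ker.2 (congrFun hv i)) trivial
  · intro hv
    induction hv using Submodule.smul_induction_on' with
    | smul r hr w _ =>
      rw [LinearMap.mem_ker, LinearMap.map_smulₛₗ, RingHom.mem_ker.1 hr, zero_smul]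
    | add x _ y _ hx hy => exact add_mem hx hy

/-- The contraction complex lifts to `Q`. -/
noncomputable def contractionComplexLift (hQR : Function.Surjective (algebraMap Q R)) :
    FreeLift Q (contractionComplex R h hfR) where
  X n := Position c deg n → Q
  π n := coefficientReduction R _
  π_surjective n y := by
    choose x hx using fun i => hQR (y i)
    exact ⟨x, funext hx⟩
  ker_π n := ker_coefficientReduction _
  d i j := contractDegree Q deg D i j
  π_d i j hij x := by
    exact (contractDegree_algebraMap D i j x).symm.trans
      (contractionComplex_d_apply h hfR hij _).symm

/-- The Eisenbud operators of the contraction complex. -/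
noncomputable def contractionOperator (l : Fin c) :
    contractionComplex R h hfR ⟶ (contractionComplex R h hfR)⟦(2 : ℤ)⟧ where
  f n := ModuleCat.ofHom (contractDegree R deg (variableMatrix Q ι l) n (n + 2))
  comm' := by
    rintro i _ rfl
    ext1
    refine LinearMap.ext fun (z : Position c deg i → R) => ?_
    rw [CochainComplex.shiftFunctor_obj_d', Int.negOnePow_even 2 even_two, one_smul]
    change ((contractionComplex R h hfR).d (i + 2) (i + 1 + 2)).hom (contractDegree R deg _ _ _ z) =
      contractDegree R deg _ (i + 1) (i + 1 + 2) (((contractionComplex R h hfR).d i (i + 1)).hom z)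
    rw [contractionComplex_d_apply h hfR (by ring), contractionComplex_d_apply h hfR rfl,
      contractDegree_contractDegree (isHomogeneousOfDegree_variableMatrix l) rfl,
      contractDegree_contractDegree h.isHomogeneousOfDegree rfl, variableMatrix, Matrix.mul_smul, Matrix.smul_mul,
      one_mul, mul_one]

/-- Over `Q` the same matrix `D` lifts the differential, and its square is contraction with `W = ∑
fₗ χₗ`: the decomposition is read off. -/
theorem isEisenbudFamily_contractionOperator (hQR : Function.Surjective (algebraMap Q R)) :
    IsEisenbudFamily f (contractionOperator h hfR) := by
  refine ⟨contractionComplexLift h hfR hQR,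
    { t := fun l i k => contractDegree Q deg (variableMatrix Q ι l) i k
      d_d := fun i j k hij hjk x => ?_ }, fun l i x => ?_⟩
  · have key : ∀ x : Position c deg i → Q,
        contractDegree Q deg D j k (contractDegree Q deg D i j x) =
          ∑ l, f l • contractDegree Q deg (variableMatrix Q ι l) i k x := fun x => by
      rw [contractDegree_contractDegree h.isHomogeneousOfDegree hij, h.sq,
        contractDegree_potential]
      rfl
    exact key x
  · exact contractDegree_algebraMap _ i (i + 2) x

variable {M : Type u} [AddCommGroup M] [Module R M] [Module Q M] [IsScalarTower Q R M] {ε : ι → M}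

/-- The augmentation of the contraction complex. -/
noncomputable def contractionAugmentation (deg : ι → ℕ) (ε : ι → M) :
    (Position c deg 0 → R) →ₗ[R] M where
  toFun z := ∑ i, extendDegree R deg 0 z i 0 • ε i
  map_add' x y := by simp [add_smul, Finset.sum_add_distrib]
  map_smul' r x := by simp [mul_smul, Finset.smul_sum]

/-- The exactness statement for arbitrary functions is cut down to a single degree, which
homogeneity of `D` permits. -/
theorem contractionComplex_exact [IsLocalRing Q] (hf : IsCompleteIntersection f R)
    (h : IsMatrixFactorization deg (potential f) D)
    (hε : IsFreeResolution deg (coeffMatrix 0 D) ε) {n n' : ℤ} (hn : n + 1 = n')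
    (z : Position c deg n' → R) (hz : contractDegree R deg D n' (n' + 1) z = 0)
    (hz' : ∑ i, extendDegree R deg n' z i 0 • ε i = 0) :
    ∃ y, contractDegree R deg D n n' y = z := by
  obtain ⟨u, hu⟩ := exists_contractMatrix_eq (M := M) (ε := ε) hf h hε (extendDegree R deg n' z)
    (by rw [← extendDegree_contractDegree h.isHomogeneousOfDegree rfl, hz, map_zero]) hz'
  refine ⟨restrictDegree R deg n u, ?_⟩
  rw [← restrictDegree_extendDegree z, hu, h.isHomogeneousOfDegree.restrictDegree hn]
  rfl

end ContractionComplex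

/-! ### Recursive constructions in both directions. -/

section Recursion

/-- Two-sided recursion over the integers. -/
theorem exists_int_family {X : ℤ → Type*} (P : ∀ n, X n → Prop) (G : ∀ i j, X i → X j → Prop)
    (n₀ : ℤ) (x₀ : X n₀) (h₀ : P n₀ x₀)
    (up : ∀ i j, i + 1 = j → n₀ ≤ i → ∀ x, P i x → ∃ y, P j y ∧ G i j x y)
    (down : ∀ i j, i + 1 = j → j ≤ n₀ → ∀ y, P j y → ∃ x, P i x ∧ G i j x y) :
    ∃ x : ∀ n, X n, x n₀ = x₀ ∧ (∀ n, P n (x n)) ∧ ∀ i j, i + 1 = j → G i j (x i) (x j) := by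
  choose a ha ha' using fun k hk x hx => up k (k + 1) rfl hk x hx
  choose b hb hb' using fun k hk x hx => down (k - 1) k (by ring) hk x hx
  let F : ∀ n, {x : X n // P n x} := fun n => Int.inductionOn' (motive := fun n => {x : X n // P n x})
    n n₀ ⟨x₀, h₀⟩ (fun k hk x => ⟨a k hk x.1 x.2, ha k hk x.1 x.2⟩)
    (fun k hk x => ⟨b k hk x.1 x.2, hb k hk x.1 x.2⟩)
  refine ⟨fun n => (F n).1, ?_, fun n => (F n).2, ?_⟩
  · have e : F n₀ = ⟨x₀, h₀⟩ := Int.inductionOn'_self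
    dsimp only
    rw [e]
  rintro i _ rfl
  by_cases hi : n₀ ≤ i
  · have e : F (i + 1) = ⟨a i hi (F i).1 (F i).2, ha i hi (F i).1 (F i).2⟩ :=
      Int.inductionOn'_add_one hi
    dsimp only
    rw [e]
    exact ha' _ _ _ _
  · obtain ⟨j, rfl⟩ : ∃ j, i = j - 1 := ⟨i + 1, by ring⟩
    rw [sub_add_cancel]
    have hj : j ≤ n₀ := by omega
    have e : F (j - 1) = ⟨b j hj (F j).1 (F j).2, hb j hj (F j).1 (F j).2⟩ :=
      Int.inductionOn'_sub_one hj
    dsimp only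
    rw [e]
    exact hb' _ _ _ _

theorem exists_comp_eq_of_forall_exists {R A B P : Type*} [CommRing R] [AddCommGroup A]
    [AddCommGroup B] [AddCommGroup P] [Module R A] [Module R B] [Module R P] [Module.Projective R P]
    (g : B →ₗ[R] A) (f : P →ₗ[R] A) (h : ∀ x, ∃ y, g y = f x) : ∃ h, g ∘ₗ h = f := by
  obtain ⟨k, hk⟩ := Module.projective_lifting_property g.rangeRestrict
    (f.codRestrict (LinearMap.range g) fun x => h x) g.surjective_rangeRestrict
  refine ⟨k, LinearMap.ext fun x => ?_⟩
  exact congrArg Subtype.val (LinearMap.congr_fun hk x)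

end Recursion

/-! ### Comparison theorem for projective resolutions placed in nonpositive degrees. -/

section Comparison

/-- A family of linear maps supported at one index. -/
def familyAt {R : Type*} [CommRing R] {X : ℤ → Type*} [∀ n, AddCommGroup (X n)]
    [∀ n, Module R (X n)] {E : Type*} [AddCommGroup E] [Module R E] (p : ℤ) (v : X p →ₗ[R] E)
    (m : ℤ) : X m →ₗ[R] E :=
  if hm : m = p then hm ▸ v else 0

theorem familyAt_self {R : Type*} [CommRing R] {X : ℤ → Type*} [∀ n, AddCommGroup (X n)]
    [∀ n, Module R (X n)] {E : Type*} [AddCommGroup E] [Module R E] (p : ℤ) (v : X p →ₗ[R] E) :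
    familyAt p v p = v := dif_pos rfl

variable {R : Type u} [CommRing R] {M N : Type u} [AddCommGroup M] [Module R M]
  [AddCommGroup N] [Module R N]

theorem d_d_apply (C : CochainComplex (ModuleCat.{u} R) ℤ) (i j k : ℤ) (x : C.X i) :
    (C.d j k).hom ((C.d i j).hom x) = 0 := by
  rw [← ModuleCat.comp_apply, C.d_comp_d]
  rfl

/-- The part of `C` in nonpositive degrees is a projective resolution of `M`. -/
structure IsResolution (C : CochainComplex (ModuleCat.{u} R) ℤ) (ε : C.X 0 →ₗ[R] M) : Prop where
  projective : ∀ n ≤ 0, Module.Projective R (C.X n)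
  surjective : Function.Surjective ε
  exact_zero : Function.Exact (C.d (-1) 0).hom ε
  exact : ∀ i j k, i + 1 = j → j + 1 = k → j < 0 → Function.Exact (C.d i j).hom (C.d j k).hom

variable {C E : CochainComplex (ModuleCat.{u} R) ℤ} {ε : C.X 0 →ₗ[R] M} {ε' : E.X 0 →ₗ[R] M}

theorem IsResolution.exists_map (hC : IsResolution C ε) (hE : IsResolution E ε') :
    ∃ θ : ∀ n, C.X n →ₗ[R] E.X n, (∀ x, ε' (θ 0 x) = ε x) ∧
      ∀ i j, i + 1 = j → j ≤ 0 → ∀ x, (E.d i j).hom (θ i x) = θ j ((C.d i j).hom x) := by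
  have := hC.projective 0 le_rfl
  obtain ⟨θ₀, hθ₀⟩ := Module.projective_lifting_property ε' ε hE.surjective
  obtain ⟨θ, h0, -, h⟩ := exists_int_family (X := fun n => C.X n →ₗ[R] E.X n)
    -- The invariant carried along is the condition that makes the next lift possible.
    (P := fun n θ => ∀ i, i + 1 = n → n ≤ 0 → ∀ y, ∃ w, (E.d i n).hom w = θ ((C.d i n).hom y))
    (G := fun i j θ θ' => j ≤ 0 → ∀ x, (E.d i j).hom (θ x) = θ' ((C.d i j).hom x)) 0 θ₀
    (fun i hi _ y => by
      obtain rfl : i = -1 := by omega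
      refine (hE.exact_zero _).1 ?_
      rw [← LinearMap.comp_apply, hθ₀]
      exact hC.exact_zero.apply_apply_eq_zero y)
    -- Nothing is required in positive degrees; zero is a filler.
    (fun i j hij hi x hx => ⟨0, fun _ _ h => by omega, fun h => by omega⟩)
    (fun i j hij hj y hy => by
      have := hC.projective i (by omega)
      obtain ⟨x, hx⟩ := exists_comp_eq_of_forall_exists (E.d i j).hom (y ∘ₗ (C.d i j).hom)
        (fun z => hy i hij hj z)
      have hx' : ∀ z, (E.d i j).hom (x z) = y ((C.d i j).hom z) := LinearMap.congr_fun hx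
      refine ⟨x, fun k hk _ z => (hE.exact k i j hk hij (by omega) _).1 ?_, fun _ z => hx' z⟩
      rw [hx', d_d_apply, map_zero])
  refine ⟨θ, fun x => ?_, h⟩
  rw [h0]
  exact LinearMap.congr_fun hθ₀ x

theorem IsResolution.exists_homotopy (hC : IsResolution C ε) (hE : IsResolution E ε')
    (θ : ∀ n, C.X n →ₗ[R] E.X n) (h0 : ∀ x, ε' (θ 0 x) = 0)
    (h : ∀ i j, i + 1 = j → j ≤ 0 → ∀ x, (E.d i j).hom (θ i x) = θ j ((C.d i j).hom x)) :
    ∃ s : ∀ n m, C.X m →ₗ[R] E.X n, ∀ i j k, i + 1 = j → j + 1 = k → j < 0 → ∀ x,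
      θ j x = (E.d i j).hom (s i j x) + s j k ((C.d j k).hom x) := by
  have := hC.projective 0 le_rfl
  obtain ⟨y₀, hy₀⟩ := exists_comp_eq_of_forall_exists (E.d (-1) 0).hom (θ 0)
    (fun x => (hE.exact_zero _).1 (h0 x))
  -- For every target index the homotopy is stored with components from all sources, of which only
  -- the one from the next index is used; `familyAt` fills in the others with zero.
  obtain ⟨s, -, -, hs⟩ := exists_int_family (X := fun n => ∀ m, C.X m →ₗ[R] E.X n)
    (P := fun n s => n < 0 → ∀ i m, i + 1 = n → n + 1 = m → ∀ y, ∃ w,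
      (E.d i n).hom w = θ n y - s m ((C.d n m).hom y))
    (G := fun i j s s' => ∀ k, j + 1 = k → j < 0 → ∀ x,
      θ j x = (E.d i j).hom (s j x) + s' k ((C.d j k).hom x)) (-1)
    (familyAt 0 y₀)
    (fun _ i m hi hm y => by
      obtain rfl : m = 0 := by omega
      refine (hE.exact i (-1) 0 hi hm (by omega) _).1 ?_
      rw [familyAt_self, map_sub, h _ _ hm le_rfl]
      change _ - ((E.d (-1) 0).hom ∘ₗ y₀) _ = 0
      rw [hy₀, sub_self])
    (fun i j hij hi x hx => ⟨0, fun h => by omega, fun _ _ h => by omega⟩)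
    (fun i j hij hj y hy => by
      obtain ⟨k, hk⟩ : ∃ k, j + 1 = k := ⟨_, rfl⟩
      have := hC.projective j (by omega)
      obtain ⟨x, hx⟩ := exists_comp_eq_of_forall_exists (E.d i j).hom
        (θ j - y k ∘ₗ (C.d j k).hom) (fun z => hy (by omega) i k hij hk z)
      have hx' : ∀ z, (E.d i j).hom (x z) = θ j z - y k ((C.d j k).hom z) := LinearMap.congr_fun hx
      refine ⟨familyAt j x, fun _ a m ha hm z => ?_,
        fun k' hk' _ z => ?_⟩
      · obtain rfl : m = j := by omega
        refine (hE.exact a i m ha hm (by omega) _).1 ?_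
        rw [familyAt_self, map_sub, h _ _ hm (by omega)]
        rw [hx', d_d_apply, map_zero, sub_zero, sub_self]
      · obtain rfl : k' = k := by omega
        rw [familyAt_self]
        rw [hx', sub_add_cancel])
  exact ⟨s, fun i j k hij hjk hj x => hs i j hij k hjk hj x⟩

end Comparison

/-! ### Chain maps and homotopies out of a totally acyclic complex. -/

section TotallyAcyclic

variable {R : Type u} [CommRing R] {N : Type u} [AddCommGroup N] [Module R N]
  {C E : CochainComplex (ModuleCat.{u} R) ℤ}

theorem Acyclic.function_exact (hE : E.Acyclic) (i j k : ℤ) (hij : i + 1 = j) (hjk : j + 1 = k) :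
    Function.Exact (E.d i j).hom (E.d j k).hom := by
  have := (E.exactAt_iff' i j k (by simp; omega) (by simp; omega)).1 (hE j)
  exact (ShortComplex.ShortExact.moduleCat_exact_iff_function_exact _).1 this

/-- Exactness of the dual extends functionals along the differential; a map to a finite free module
is extended coordinate by coordinate. -/
theorem IsTotallyAcyclic.exists_extension (hC : IsTotallyAcyclic C) {E : Type u} [AddCommGroup E]
    [Module R E] [Module.Free R E] [Module.Finite R E] (i j k : ℤ) (hij : i + 1 = j)
    (hjk : j + 1 = k) (g : C.X j →ₗ[R] E) (hg : ∀ x, g ((C.d i j).hom x) = 0) :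
    ∃ g' : C.X k →ₗ[R] E, ∀ x, g' ((C.d j k).hom x) = g x := by
  let b := Module.Free.chooseBasis R E
  have := fun a => (hC.dual_exact i j k hij hjk (b.coord a ∘ₗ g)).1 (LinearMap.ext fun x => by
    change b.coord a (g ((C.d i j).hom x)) = 0
    rw [hg, map_zero])
  choose φ hφ using this
  refine ⟨∑ a, (φ a).smulRight (b a), fun x => ?_⟩
  rw [LinearMap.sum_apply]
  conv_rhs => rw [← b.sum_repr (g x)]
  refine Finset.sum_congr rfl fun a _ => ?_
  rw [LinearMap.smulRight_apply]
  congr 1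
  exact LinearMap.congr_fun (hφ a) x

/-- Cocycles with values in a cokernel of `E` come from chain maps to `E`. -/
theorem IsTotallyAcyclic.exists_hom (hC : IsTotallyAcyclic C)
    (hEf : ∀ n, Module.Free R (E.X n)) (hEF : ∀ n, Module.Finite R (E.X n))
    (hE : ∀ i j k, i + 1 = j → j + 1 = k → Function.Exact (E.d i j).hom (E.d j k).hom)
    (m n : ℤ) (hmn : m + 1 = n) (π : E.X n →ₗ[R] N) (hπ : Function.Surjective π)
    (hπ' : Function.Exact (E.d m n).hom π) (g : C.X n →ₗ[R] N)
    (hg : ∀ x, g ((C.d m n).hom x) = 0) :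
    ∃ α : C ⟶ E, ∀ x, π ((α.f n).hom x) = g x := by
  have := hC.free
  obtain ⟨g₀, hg₀⟩ := Module.projective_lifting_property π g hπ
  have hg₀' : ∀ x, π (g₀ x) = g x := LinearMap.congr_fun hg₀
  -- From degree `n`, upward steps extend maps by exactness of the dual of `C`, and downward steps
  -- lift them by exactness of `E`. The invariant, that boundaries go to cycles, serves both
  -- directions.
  obtain ⟨α, h0, -, h⟩ := exists_int_family (X := fun n => C.X n →ₗ[R] E.X n)
    (P := fun j α => ∀ i k, i + 1 = j → j + 1 = k → ∀ x,
      (E.d j k).hom (α ((C.d i j).hom x)) = 0)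
    (G := fun i j α α' => ∀ x, (E.d i j).hom (α x) = α' ((C.d i j).hom x)) n g₀
    (fun i k hi hk x => by
      obtain rfl : i = m := by omega
      obtain ⟨y, hy⟩ := (hπ' (g₀ ((C.d i n).hom x))).1 (by rw [hg₀', hg])
      rw [← hy, d_d_apply])
    (fun j k hjk _ α hα => by
      obtain ⟨i, hij⟩ : ∃ i, i + 1 = j := ⟨j - 1, by ring⟩
      obtain ⟨β, hβ⟩ := hC.exists_extension i j k hij hjk ((E.d j k).hom ∘ₗ α)
        (hα i k hij hjk)
      refine ⟨β, fun i' k' hi' _ x => ?_, fun x => (hβ x).symm⟩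
      obtain rfl : i' = j := by omega
      rw [hβ, LinearMap.comp_apply, d_d_apply])
    (fun j k hjk _ α hα => by
      obtain ⟨l, hl⟩ : ∃ l, k + 1 = l := ⟨k + 1, by ring⟩
      obtain ⟨β, hβ⟩ := exists_comp_eq_of_forall_exists (E.d j k).hom (α ∘ₗ (C.d j k).hom)
        (fun x => (hE j k l hjk hl _).1 (hα j l hjk hl x))
      have hβ' : ∀ x, (E.d j k).hom (β x) = α ((C.d j k).hom x) := LinearMap.congr_fun hβ
      refine ⟨β, fun i' k' _ hk' x => ?_, hβ'⟩
      obtain rfl : k' = k := by omega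
      rw [hβ', d_d_apply, map_zero])
  refine ⟨⟨fun n => ModuleCat.ofHom (α n), fun i j hij => ?_⟩, fun x => ?_⟩
  · ext x
    exact h i j hij x
  · rw [← hg₀', ← h0]
    rfl

/-- Null-homotopies from homotopy data on linear maps. -/
theorem nonempty_homotopy_zero (α : C ⟶ E) (s : ∀ n m, C.X m →ₗ[R] E.X n)
    (hs : ∀ i j k, i + 1 = j → j + 1 = k → ∀ x,
      (α.f j).hom x = (E.d i j).hom (s i j x) + s j k ((C.d j k).hom x)) :
    Nonempty (Homotopy α 0) := by
  refine ⟨{ hom := fun i j => if j + 1 = i then ModuleCat.ofHom (s j i) else 0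
            zero := fun i j hij => if_neg hij
            comm := fun j => ?_ }⟩
  obtain ⟨i, rfl⟩ : ∃ i, j = i + 1 := ⟨j - 1, by ring⟩
  rw [dNext_eq _ (show (ComplexShape.up ℤ).Rel (i + 1) (i + 1 + 1) from rfl),
    prevD_eq _ (show (ComplexShape.up ℤ).Rel i (i + 1) from rfl), if_pos rfl, if_pos rfl]
  ext x
  rw [hs i (i + 1) (i + 1 + 1) rfl rfl]
  change _ = s (i + 1) (i + 1 + 1) ((C.d (i + 1) (i + 1 + 1)).hom x) +
    (E.d i (i + 1)).hom (s i (i + 1) x) + 0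
  rw [add_zero]
  exact add_comm _ _

theorem exists_of_homotopy {α β : C ⟶ E} (h : Homotopy α β) :
    ∃ s : ∀ n m, C.X m →ₗ[R] E.X n, ∀ i j k, i + 1 = j → j + 1 = k → ∀ x,
      (α.f j).hom x = (E.d i j).hom (s i j x) + s j k ((C.d j k).hom x) + (β.f j).hom x := by
  refine ⟨fun n m => (h.hom m n).hom, ?_⟩
  rintro i _ _ rfl rfl x
  have := h.comm (i + 1)
  rw [dNext_eq _ (show (ComplexShape.up ℤ).Rel (i + 1) (i + 1 + 1) from rfl),
    prevD_eq _ (show (ComplexShape.up ℤ).Rel i (i + 1) from rfl)] at this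
  rw [this]
  change h.hom (i + 1 + 1) (i + 1) ((C.d (i + 1) (i + 1 + 1)).hom x) +
    (E.d i (i + 1)).hom (h.hom (i + 1) i x) + (β.f (i + 1)).hom x = _
  rw [add_comm ((h.hom (i + 1 + 1) (i + 1)) _)]

/-- Chain maps inducing coboundaries with values in a cokernel of `E` are null-homotopic. -/
theorem IsTotallyAcyclic.nonempty_homotopy_zero (hC : IsTotallyAcyclic C)
    (hEf : ∀ n, Module.Free R (E.X n)) (hEF : ∀ n, Module.Finite R (E.X n))
    (hE : ∀ i j k, i + 1 = j → j + 1 = k → Function.Exact (E.d i j).hom (E.d j k).hom)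
    (m n p : ℤ) (hnp : n + 1 = p) (π : E.X n →ₗ[R] N)
    (hπ : Function.Surjective π) (hπ' : Function.Exact (E.d m n).hom π) (α : C ⟶ E)
    (v : C.X p →ₗ[R] N) (hv : ∀ x, π ((α.f n).hom x) = v ((C.d n p).hom x)) :
    Nonempty (Homotopy α 0) := by
  have := hC.free
  obtain ⟨v₀, hv₀⟩ := Module.projective_lifting_property π v hπ
  have hv₀' : ∀ x, π (v₀ x) = v x := LinearMap.congr_fun hv₀
  have hα : ∀ i j x, (E.d i j).hom ((α.f i).hom x) = (α.f j).hom ((C.d i j).hom x) :=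
    fun i j x => congrArg (fun g => g.hom x) (α.comm i j)
  -- The invariant says that the part of `α` not yet accounted for takes values in cycles. Lower
  -- degrees use exactness of `E`, higher ones exactness of the dual of `C`.
  obtain ⟨s, -, -, hs⟩ := exists_int_family (X := fun n => ∀ m, C.X m →ₗ[R] E.X n)
    (P := fun j s => ∀ k, j + 1 = k → ∀ x,
      (E.d j k).hom ((α.f j).hom x - s k ((C.d j k).hom x)) = 0)
    (G := fun i j s s' => ∀ k, j + 1 = k → ∀ x,
      (α.f j).hom x = (E.d i j).hom (s j x) + s' k ((C.d j k).hom x)) n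
    (familyAt p v₀)
    (fun k hk x => by
      obtain rfl : k = p := by omega
      rw [familyAt_self]
      obtain ⟨y, hy⟩ := (hπ' ((α.f n).hom x - v₀ ((C.d n k).hom x))).1 (by
        rw [map_sub, hv₀', hv, sub_self])
      rw [← hy, d_d_apply])
    (fun i j hij _ s hs => by
      obtain ⟨k, hjk⟩ : ∃ k, j + 1 = k := ⟨_, rfl⟩
      obtain ⟨t, ht⟩ := hC.exists_extension i j k hij hjk
        ((α.f j).hom - (E.d i j).hom ∘ₗ s j) (fun x => by
          rw [LinearMap.sub_apply, LinearMap.comp_apply, ← hα, ← map_sub]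
          exact hs j hij x)
      refine ⟨familyAt k t, fun k' hk' x => ?_, fun k' hk' x => ?_⟩
      · obtain rfl : k' = k := by omega
        rw [familyAt_self]
        rw [ht, LinearMap.sub_apply, LinearMap.comp_apply, sub_sub_cancel, d_d_apply]
      · obtain rfl : k' = k := by omega
        rw [familyAt_self]
        rw [ht, LinearMap.sub_apply, LinearMap.comp_apply, add_sub_cancel])
    (fun i j hij _ s hs => by
      obtain ⟨k, hjk⟩ : ∃ k, j + 1 = k := ⟨_, rfl⟩
      obtain ⟨t, ht⟩ := exists_comp_eq_of_forall_exists (E.d i j).hom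
        ((α.f j).hom - s k ∘ₗ (C.d j k).hom) (fun x => (hE i j k hij hjk _).1 (hs k hjk x))
      have ht' : ∀ x, (E.d i j).hom (t x) = (α.f j).hom x - s k ((C.d j k).hom x) :=
        LinearMap.congr_fun ht
      refine ⟨familyAt j t, fun j' hj' x => ?_, fun k' hk' x => ?_⟩
      · obtain rfl : j' = j := by omega
        rw [familyAt_self, map_sub, hα]
        rw [ht', d_d_apply, map_zero, sub_zero, sub_self]
      · obtain rfl : k' = k := by omega
        rw [familyAt_self]
        rw [ht', sub_add_cancel])
  exact TotallyAcyclicVariety.nonempty_homotopy_zero α s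
    (fun i j k hij hjk x => hs i j hij k hjk x)

end TotallyAcyclic

/-! ### Classes in `Hom(C, Σⁱ D)` as cocycles on `C` with values in a cokernel of `D`. -/

section Representatives

variable {R : Type u} [CommRing R] {N : Type u} [AddCommGroup N] [Module R N]

/-- A coboundary with values in `N`. -/
def IsCoboundary (C : CochainComplex (ModuleCat.{u} R) ℤ) (p : ℤ) (g : C.X p →ₗ[R] N) : Prop :=
  ∃ (r : ℤ) (_ : p + 1 = r) (v : C.X r →ₗ[R] N), ∀ x, g x = v ((C.d p r).hom x)

theorem IsCoboundary.zero (C : CochainComplex (ModuleCat.{u} R) ℤ) (p : ℤ) :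
    IsCoboundary C p (0 : C.X p →ₗ[R] N) := ⟨_, rfl, 0, fun _ => rfl⟩

theorem IsCoboundary.add {C : CochainComplex (ModuleCat.{u} R) ℤ} {p : ℤ} {g g' : C.X p →ₗ[R] N}
    (h : IsCoboundary C p g) (h' : IsCoboundary C p g') : IsCoboundary C p (g + g') := by
  obtain ⟨_, rfl, v, hv⟩ := h
  obtain ⟨_, rfl, v', hv'⟩ := h'
  exact ⟨_, rfl, v + v', fun x => by simp [hv, hv']⟩

theorem IsCoboundary.smul {C : CochainComplex (ModuleCat.{u} R) ℤ} {p : ℤ} {g : C.X p →ₗ[R] N}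
    (r : R) (h : IsCoboundary C p g) : IsCoboundary C p (r • g) := by
  obtain ⟨_, rfl, v, hv⟩ := h
  exact ⟨_, rfl, r • v, fun x => by simp [hv]⟩

theorem IsCoboundary.neg {C : CochainComplex (ModuleCat.{u} R) ℤ} {p : ℤ} {g : C.X p →ₗ[R] N}
    (h : IsCoboundary C p g) : IsCoboundary C p (-g) := by
  simpa using h.smul (-1)

theorem shift_d_apply (D : CochainComplex (ModuleCat.{u} R) ℤ) (i m n : ℤ) (x : D.X (m + i)) :
    ((D⟦i⟧).d m n).hom x = i.negOnePow • (D.d (m + i) (n + i)).hom x := by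
  rw [CochainComplex.shiftFunctor_obj_d']
  rfl

/-- The shift changes the differential only by a sign, which is absorbed into the preimage. -/
theorem shift_exact {D : CochainComplex (ModuleCat.{u} R) ℤ} (i m n : ℤ) {P : Type*} [Zero P]
    {g : D.X (n + i) → P} (h : Function.Exact (D.d (m + i) (n + i)).hom g) :
    Function.Exact ((D⟦i⟧).d m n).hom g := by
  intro y
  rw [h y]
  constructor
  · rintro ⟨x, rfl⟩
    refine ⟨(i.negOnePow • x : D.X (m + i)), ?_⟩
    rw [shift_d_apply, Units.smul_def, Units.smul_def, map_zsmul, smul_smul, ← Units.val_mul,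
      ← Int.negOnePow_add, Int.negOnePow_even _ ⟨i, rfl⟩, Units.val_one, one_smul]
  · rintro ⟨x, rfl⟩
    refine ⟨(i.negOnePow • (show D.X (m + i) from x) : D.X (m + i)), ?_⟩
    rw [Units.smul_def, map_zsmul]
    exact (shift_d_apply D i m n x).symm

theorem shift_exact' {D : CochainComplex (ModuleCat.{u} R) ℤ} (i m n p : ℤ)
    (h : Function.Exact (D.d (m + i) (n + i)).hom (D.d (n + i) (p + i)).hom) :
    Function.Exact ((D⟦i⟧).d m n).hom ((D⟦i⟧).d n p).hom := by
  refine shift_exact i m n fun y => ?_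
  rw [← h y, shift_d_apply]
  exact smul_eq_zero_iff_eq _

/-- The augmentation `π : D⁰ → N` on the term of degree `-i` of `Σⁱ D`. -/
noncomputable def shiftedAugmentation {D : CochainComplex (ModuleCat.{u} R) ℤ} (π : D.X 0 →ₗ[R] N)
    {i p : ℤ} (hp : p + i = 0) : (D⟦i⟧).X p →ₗ[R] N :=
  show D.X (p + i) →ₗ[R] N from π ∘ₗ (D.XIsoOfEq hp).hom.hom

theorem shiftedAugmentation_surjective {D : CochainComplex (ModuleCat.{u} R) ℤ} {π : D.X 0 →ₗ[R] N}
    (hπ : Function.Surjective π) {i p : ℤ} (hp : p + i = 0) :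
    Function.Surjective (shiftedAugmentation π hp) := by
  have : ∀ {n : ℤ} (hn : n = 0), Function.Surjective (π ∘ₗ (D.XIsoOfEq hn).hom.hom) := by
    rintro _ rfl
    exact hπ
  exact this hp

theorem shiftedAugmentation_exact {D : CochainComplex (ModuleCat.{u} R) ℤ} {π : D.X 0 →ₗ[R] N}
    (hπ : Function.Exact (D.d (-1) 0).hom π) {i m p : ℤ} (hm : m + 1 = p) (hp : p + i = 0) :
    Function.Exact ((D⟦i⟧).d m p).hom (shiftedAugmentation π hp) := by
  have : ∀ {m n : ℤ} (hn : n = 0), m + 1 = n →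
      Function.Exact (D.d m n).hom (π ∘ₗ (D.XIsoOfEq hn).hom.hom) := by
    rintro m _ rfl hm
    obtain rfl : m = -1 := by omega
    exact hπ
  exact shift_exact i m p (this hp (by omega))

/-- The components of a chain map to a shift, as maps to terms of the original complex. -/
def shiftComponent {C E : CochainComplex (ModuleCat.{u} R) ℤ} {i : ℤ} (φ : C ⟶ E⟦i⟧) (q : ℤ) :
    C.X q →ₗ[R] E.X (q + i) := (φ.f q).hom

theorem d_shiftComponent {C E : CochainComplex (ModuleCat.{u} R) ℤ} (φ : C ⟶ E⟦(2 : ℤ)⟧)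
    (p q : ℤ) (x : C.X p) : (E.d (p + 2) (q + 2)).hom (shiftComponent φ p x) =
      shiftComponent φ q ((C.d p q).hom x) := by
  have e : (φ.f q).hom ((C.d p q).hom x) = ((E⟦(2 : ℤ)⟧).d p q).hom ((φ.f p).hom x) :=
    congrArg (fun g => g.hom x) (φ.comm p q).symm
  refine Eq.trans ?_ e.symm
  rw [CochainComplex.shiftFunctor_obj_d', Int.negOnePow_even 2 even_two, one_smul]
  rfl

variable (C D : Ktac R) (π : D.complex.X 0 →ₗ[R] N)

/-- The class `h` of chain maps `C ⟶ Σⁱ D` induces the map `g` on the term of degree `-i`, up to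
coboundaries, after composition with `π : D⁰ → N`. -/
def Represents (i : ℕ) (p : ℤ) (hp : p + i = 0) (h : ShiftedHom C.obj D.obj (i : ℤ))
    (g : C.complex.X p →ₗ[R] N) : Prop :=
  ∃ α : ShiftedHom C.complex D.complex (i : ℤ),
    h = ShiftedHom.map α (HomotopyCategory.quotient (ModuleCat.{u} R) (ComplexShape.up ℤ)) ∧
    IsCoboundary C.complex p (shiftedAugmentation π hp ∘ₗ (α.f p).hom - g)

variable {C D π}

theorem Represents.add {i : ℕ} {p : ℤ} {hp : p + i = 0} {h h' : ShiftedHom C.obj D.obj (i : ℤ)}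
    {g g' : C.complex.X p →ₗ[R] N} (H : Represents C D π i p hp h g)
    (H' : Represents C D π i p hp h' g') : Represents C D π i p hp (h + h') (g + g') := by
  obtain ⟨α, rfl, hα⟩ := H
  obtain ⟨α', rfl, hα'⟩ := H'
  refine ⟨α + α', (ShiftedHom.map_add _ _ _).symm, ?_⟩
  convert hα.add hα' using 1
  ext x
  change shiftedAugmentation π hp (((α.f p).hom x + (α'.f p).hom x : (D.complex⟦(i : ℤ)⟧).X p)) - _ = _
  rw [map_add]
  simp only [LinearMap.add_apply, LinearMap.sub_apply, LinearMap.comp_apply]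
  abel

theorem Represents.smul {i : ℕ} {p : ℤ} {hp : p + i = 0} {h : ShiftedHom C.obj D.obj (i : ℤ)}
    {g : C.complex.X p →ₗ[R] N} (r : R) (H : Represents C D π i p hp h g) :
    Represents C D π i p hp (r • h) (r • g) := by
  obtain ⟨α, rfl, hα⟩ := H
  refine ⟨r • α, (ShiftedHom.map_smul _ _ _).symm, ?_⟩
  convert hα.smul r using 1
  ext x
  change shiftedAugmentation π hp ((r • (α.f p).hom x : (D.complex⟦(i : ℤ)⟧).X p)) - _ = _
  rw [map_smul]
  simp only [LinearMap.smul_apply, LinearMap.sub_apply, LinearMap.comp_apply, smul_sub]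

theorem Represents.zero (i : ℕ) (p : ℤ) (hp : p + i = 0) :
    Represents C D π i p hp 0 0 := by
  refine ⟨0, (ShiftedHom.map_zero _).symm, ?_⟩
  convert IsCoboundary.zero C.complex p using 1
  ext x
  change shiftedAugmentation π hp (0 : (D.complex⟦(i : ℤ)⟧).X p) - 0 = 0
  rw [map_zero, sub_zero]

theorem Represents.congr {i : ℕ} {p : ℤ} {hp : p + i = 0} {h : ShiftedHom C.obj D.obj (i : ℤ)}
    {g g' : C.complex.X p →ₗ[R] N} (H : Represents C D π i p hp h g)
    (hg : IsCoboundary C.complex p (g - g')) : Represents C D π i p hp h g' := by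
  obtain ⟨α, rfl, hα⟩ := H
  refine ⟨α, rfl, ?_⟩
  convert hα.add hg using 1
  abel

/-- Together with `exists_represents'`, `Represents.eq_zero` and `Represents.isCoboundary`, this
identifies `Hom(C, Σⁱ D)` with cocycles modulo coboundaries on the term `C⁻ⁱ`, with values in the
cokernel `N` of `D⁻¹ → D⁰`. -/
theorem exists_represents (hπ : Function.Surjective π)
    (hπ' : Function.Exact (D.complex.d (-1) 0).hom π) {i : ℕ} {m p : ℤ} (hp : p + i = 0)
    (hm : m + 1 = p) (g : C.complex.X p →ₗ[R] N) (hg : ∀ x, g ((C.complex.d m p).hom x) = 0) :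
    ∃ h, Represents C D π i p hp h g := by
  obtain ⟨α, hα⟩ := C.property.exists_hom (E := D.complex⟦(i : ℤ)⟧)
    (fun n => D.property.free (n + i)) (fun n => D.property.finite (n + i))
    (fun a b c hab hbc => shift_exact' _ _ _ _
      (Acyclic.function_exact D.property.acyclic _ _ _ (by omega) (by omega))) m p hm
    (shiftedAugmentation π hp) (shiftedAugmentation_surjective hπ hp)
    (shiftedAugmentation_exact hπ' (by omega) hp) g hg
  refine ⟨_, α, rfl, ?_⟩
  convert IsCoboundary.zero C.complex p using 1
  ext x
  exact sub_eq_zero.2 (hα x)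

theorem exists_represents' (hπ' : Function.Exact (D.complex.d (-1) 0).hom π) {i : ℕ} {m p : ℤ}
    (hp : p + i = 0) (hm : m + 1 = p) (h : ShiftedHom C.obj D.obj (i : ℤ)) :
    ∃ g : C.complex.X p →ₗ[R] N, (∀ x, g ((C.complex.d m p).hom x) = 0) ∧
      Represents C D π i p hp h g := by
  obtain ⟨α, rfl⟩ : ∃ α : ShiftedHom C.complex D.complex (i : ℤ), h = ShiftedHom.map α
      (HomotopyCategory.quotient (ModuleCat.{u} R) (ComplexShape.up ℤ)) := by
    obtain ⟨α, hα⟩ := (HomotopyCategory.quotient (ModuleCat.{u} R)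
      (ComplexShape.up ℤ)).map_surjective (h ≫ ((HomotopyCategory.quotient (ModuleCat.{u} R)
        (ComplexShape.up ℤ)).commShiftIso (i : ℤ)).inv.app D.complex)
    exact ⟨α, by rw [ShiftedHom.map, hα, Category.assoc, Iso.inv_hom_id_app]; simp⟩
  refine ⟨shiftedAugmentation π hp ∘ₗ (α.f p).hom, fun x => ?_, α, rfl, ?_⟩
  · have e : (α.f p).hom ((C.complex.d m p).hom x) =
        ((D.complex⟦(i : ℤ)⟧).d m p).hom ((α.f m).hom x) :=
      congrArg (fun g => g.hom x) (α.comm m p).symm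
    rw [LinearMap.comp_apply, e]
    exact (shiftedAugmentation_exact hπ' (by omega) hp).apply_apply_eq_zero _
  · rw [sub_self]
    exact IsCoboundary.zero _ _

theorem Represents.eq_zero (hπ : Function.Surjective π)
    (hπ' : Function.Exact (D.complex.d (-1) 0).hom π) {i : ℕ} {p : ℤ} {hp : p + i = 0}
    {h : ShiftedHom C.obj D.obj (i : ℤ)} {g : C.complex.X p →ₗ[R] N}
    (H : Represents C D π i p hp h g) (hg : IsCoboundary C.complex p g) : h = 0 := by
  obtain ⟨α, rfl, r, hr, v, hv⟩ := H.congr (g' := 0) (by rwa [sub_zero])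
  obtain ⟨hα⟩ := C.property.nonempty_homotopy_zero (E := D.complex⟦(i : ℤ)⟧)
    (fun n => D.property.free (n + i)) (fun n => D.property.finite (n + i))
    (fun a b c hab hbc => shift_exact' _ _ _ _
      (Acyclic.function_exact D.property.acyclic _ _ _ (by omega) (by omega))) (p - 1) p r hr
    (shiftedAugmentation π hp) (shiftedAugmentation_surjective hπ hp)
    (shiftedAugmentation_exact hπ' (by omega) hp) α v
    (fun x => by rw [← hv, sub_zero]; rfl)
  rw [ShiftedHom.map, (HomotopyCategory.quotient_map_eq_zero_iff _).2 ⟨hα⟩, Limits.zero_comp]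

theorem Represents.isCoboundary (hπ' : Function.Exact (D.complex.d (-1) 0).hom π) {i : ℕ} {p : ℤ}
    {hp : p + i = 0} {g : C.complex.X p →ₗ[R] N} (H : Represents C D π i p hp 0 g) :
    IsCoboundary C.complex p g := by
  obtain ⟨α, hα, hg⟩ := H
  rw [ShiftedHom.map, eq_comm] at hα
  have h0 : (HomotopyCategory.quotient (ModuleCat.{u} R) (ComplexShape.up ℤ)).map α = 0 := by
    rwa [Preadditive.IsIso.comp_right_eq_zero] at hα
  obtain ⟨H⟩ := (HomotopyCategory.quotient_map_eq_zero_iff _).1 h0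
  obtain ⟨s, hs⟩ := exists_of_homotopy H
  have : IsCoboundary C.complex p (shiftedAugmentation π hp ∘ₗ (α.f p).hom) := by
    refine ⟨p + 1, rfl, shiftedAugmentation π hp ∘ₗ s p (p + 1), fun x => ?_⟩
    rw [LinearMap.comp_apply, hs (p - 1) p (p + 1) (by ring) rfl]
    change shiftedAugmentation π hp (_ + _ + (0 : (D.complex⟦(i : ℤ)⟧).X p)) = _
    rw [add_zero]
    refine (map_add (shiftedAugmentation π hp) _ _).trans ?_
    have := (shiftedAugmentation_exact hπ' (sub_add_cancel p 1) hp).apply_apply_eq_zero (s (p - 1) p x)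
    rw [this, zero_add]
    rfl
  convert this.add hg.neg using 1
  abel

end Representatives

/-! ### Eisenbud operators in terms of cocycles. -/

section Operators

variable {Q : Type u} [CommRing Q] [IsLocalRing Q] {R : Type u} [CommRing R] [Algebra Q R]
    {c : ℕ} {f : Fin c → Q} {N : Type u} [AddCommGroup N] [Module R N] {C D : Ktac R}
    {π : D.complex.X 0 →ₗ[R] N}

/-- Composing a class with `tₗ` amounts to precomposing its cocycle with the component of a chain
map representing `tₗ`, two places lower. What remains is the identification of the terms indexed by
equal integers. -/
theorem Represents.eisenbudOperator_comp (hf : IsCompleteIntersection f R)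
    {τ : Fin c → (C.complex ⟶ C.complex⟦(2 : ℤ)⟧)} (hτ : IsEisenbudFamily f τ) (l : Fin c)
    {i : ℕ} {q : ℤ} {hp : q + 2 + i = 0} {hq : q + (i + 2 : ℕ) = 0}
    {h : ShiftedHom C.obj D.obj (i : ℤ)} {g : C.complex.X (q + 2) →ₗ[R] N}
    (H : Represents C D π i (q + 2) hp h g) :
    Represents C D π (i + 2) q hq ((eisenbudOperator hf C l).comp h (by push_cast; rfl))
      (g ∘ₗ shiftComponent (τ l) q) := by
  obtain ⟨α, rfl, r, rfl, v, hv⟩ := H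
  rw [eisenbudOperator_eq hf C hτ, ← ShiftedHom.map_comp]
  refine ⟨_, rfl, q + 1, rfl, v ∘ₗ (C.complex.XIsoOfEq (by ring)).hom.hom ∘ₗ
    shiftComponent (τ l) (q + 1), fun x => ?_⟩
  rw [LinearMap.comp_apply, LinearMap.comp_apply, ← d_shiftComponent, ← ModuleCat.comp_apply,
    HomologicalComplex.d_comp_XIsoOfEq_hom, ← hv]
  rw [LinearMap.sub_apply, LinearMap.sub_apply]
  refine congrArg₂ _ ?_ rfl
  have key : ∀ (hn : q + (i + 2 : ℕ) = 0) (e : q + 2 + i = q + (i + 2 : ℕ)),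
      (D.complex.XIsoOfEq e).hom ≫ (D.complex.XIsoOfEq hn).hom = (D.complex.XIsoOfEq hp).hom :=
    fun hn e => D.complex.XIsoOfEq_hom_comp_XIsoOfEq_hom e hn
  change π ((D.complex.XIsoOfEq hq).hom.hom
    ((((shiftFunctorAdd' (CochainComplex (ModuleCat R) ℤ) (i : ℤ) 2
    ((i + 2 : ℕ) : ℤ) (by push_cast; ring)).inv.app D.complex).f q).hom (shiftComponent α (q + 2) _))) =
    π ((D.complex.XIsoOfEq hp).hom.hom (shiftComponent α (q + 2) _))
  rw [CochainComplex.shiftFunctorAdd'_inv_app_f', ← key hq (by push_cast; ring)]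
  rfl

end Operators

section Augmentation

variable {Q : Type u} [CommRing Q] {R : Type u} [CommRing R] [Algebra Q R] {c : ℕ} {ι : Type}
  [Fintype ι] {deg : ι → ℕ} {d : Matrix ι ι Q} {M : Type u} [AddCommGroup M]
  [Module R M] [Module Q M] [IsScalarTower Q R M] {ε : ι → M}

theorem contractionAugmentation_surjective (hε : IsFreeResolution deg d ε) :
    Function.Surjective (contractionAugmentation (c := c) (R := R) deg ε) := by
  intro m
  obtain ⟨a, ha⟩ := (Submodule.mem_span_range_iff_exists_fun Q).1
    (hε.span_eps ▸ Submodule.mem_top : m ∈ _)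
  refine ⟨restrictDegree R deg 0 fun i _ => algebraMap Q R (a i), ?_⟩
  rw [← ha]
  refine Finset.sum_congr rfl fun i _ => ?_
  by_cases hi : ε i = 0
  · simp [hi]
  · rw [extendDegree_restrictDegree_apply _ (by simp [hε.eps_deg i hi]), algebraMap_smul]

end Augmentation

/-! ### Comparison of a totally acyclic complex with a contraction complex. -/

section ComparisonMaps

variable {Q : Type u} [CommRing Q] [IsLocalRing Q] {R : Type u} [CommRing R] [Algebra Q R]
  {c : ℕ} {f : Fin c → Q} {ι : Type} [Fintype ι] [DecidableEq ι] {deg : ι → ℕ}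
  {D : Matrix ι ι (MvPolynomial (Fin c) Q)} {M : Type u} [AddCommGroup M] [Module R M] [Module Q M]
  [IsScalarTower Q R M] {ε : ι → M}

theorem IsCompleteIntersection.algebraMap_eq_zero (hf : IsCompleteIntersection f R) (l : Fin c) :
    algebraMap Q R (f l) = 0 := by
  rw [← RingHom.mem_ker, hf.ker_eq]
  exact Ideal.subset_span ⟨l, rfl⟩

theorem contractDegree_exact (hf : IsCompleteIntersection f R)
    (h : IsMatrixFactorization deg (potential f) D)
    (hε : IsFreeResolution deg (coeffMatrix 0 D) ε) {i j k : ℤ} (hij : i + 1 = j) (hjk : j + 1 = k)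
    (hj : j < 0) : Function.Exact (contractDegree R deg D i j) (contractDegree R deg D j k) := by
  subst hjk
  intro z
  constructor
  · intro hz
    -- In negative degrees the augmentation condition is empty, since `ε` is supported on basis
    -- elements of degree zero.
    obtain ⟨y, hy⟩ := contractionComplex_exact hf h hε hij z hz (Finset.sum_eq_zero fun i _ => by
      by_cases hi : ε i = 0
      · simp [hi]
      · rw [extendDegree_of_ne, zero_smul]
        simp [hε.eps_deg i hi]
        omega)
    exact ⟨y, hy⟩
  · rintro ⟨y, rfl⟩
    rw [contractDegree_contractDegree h.isHomogeneousOfDegree hij, h.sq, contractDegree_potential]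
    simp [hf.algebraMap_eq_zero]

theorem contractionAugmentation_exact (hf : IsCompleteIntersection f R)
    (h : IsMatrixFactorization deg (potential f) D)
    (hε : IsFreeResolution deg (coeffMatrix 0 D) ε) :
    Function.Exact (contractDegree R deg D (-1) 0)
      (contractionAugmentation (c := c) (R := R) deg ε) := by
  intro z
  constructor
  · intro hz
    have hd : contractDegree R deg D 0 (0 + 1) z = 0 := by
      have := position_isEmpty (c := c) (deg := deg) (show (0 : ℤ) < 0 + 1 by norm_num)
      exact Subsingleton.elim _ _
    exact contractionComplex_exact hf h hε (n := -1) (n' := 0) rfl z hd hz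
  · rintro ⟨y, rfl⟩
    change ∑ i, extendDegree R deg 0 (contractDegree R deg D (-1) 0 y) i 0 • ε i = 0
    rw [extendDegree_contractDegree h.isHomogeneousOfDegree (by norm_num)]
    exact hε.sum_contractMatrix h _

theorem isResolution_contractionComplex (hf : IsCompleteIntersection f R)
    (h : IsMatrixFactorization deg (potential f) D)
    (hε : IsFreeResolution deg (coeffMatrix 0 D) ε) :
    IsResolution (contractionComplex R h hf.algebraMap_eq_zero)
      (contractionAugmentation deg ε) := by
  have hd : ∀ i j, i + 1 = j → ⇑((contractionComplex R h hf.algebraMap_eq_zero).d i j).hom =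
      contractDegree R deg D i j :=
    fun i j hij => funext fun z => contractionComplex_d_apply h _ hij z
  refine ⟨fun n _ => ?_, contractionAugmentation_surjective hε, ?_, fun i j k hij hjk hj => ?_⟩
  · change Module.Projective R (Position c deg n → R)
    infer_instance
  · rw [hd _ _ (by norm_num)]
    exact contractionAugmentation_exact hf h hε
  · rw [hd _ _ hij, hd _ _ hjk]
    exact contractDegree_exact hf h hε hij hjk hj

theorem IsTotallyAcyclic.isResolution {C : CochainComplex (ModuleCat.{u} R) ℤ}
    (hC : IsTotallyAcyclic C) {ρ : C.X 0 →ₗ[R] M} (hρ : Function.Surjective ρ)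
    (hρ' : Function.Exact (C.d (-1) 0).hom ρ) : IsResolution C ρ where
  projective n _ := by
    have := hC.free n
    infer_instance
  surjective := hρ
  exact_zero := hρ'
  exact i j k hij hjk _ := Acyclic.function_exact hC.acyclic i j k hij hjk

/-- A family of maps from `C` to the contraction complex, commuting with the differentials. -/
def IsChainFamily (D : Matrix ι ι (MvPolynomial (Fin c) Q))
    (C : CochainComplex (ModuleCat.{u} R) ℤ)
    (θ : ∀ n, C.X n →ₗ[R] (Position c deg n → R)) : Prop :=
  ∀ i j, i + 1 = j → ∀ x, contractDegree R deg D i j (θ i x) = θ j ((C.d i j).hom x)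

/-- Comparison maps with the contraction complex intertwine the Eisenbud operators with the
contractions by the variables, up to coboundaries. -/
theorem IsChainFamily.operator (hf : IsCompleteIntersection f R)
    (h : IsMatrixFactorization deg (potential f) D) {C : CochainComplex (ModuleCat.{u} R) ℤ}
    {θ : ∀ n, C.X n →ₗ[R] (Position c deg n → R)} (hθ : IsChainFamily D C θ)
    {τ : Fin c → (C ⟶ C⟦(2 : ℤ)⟧)} (hτ : IsEisenbudFamily f τ) {N : Type u} [AddCommGroup N]
    [Module R N] (l : Fin c) (q : ℤ) (g : (Position c deg (q + 2) → R) →ₗ[R] N)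
    (hg : ∀ z, g (contractDegree R deg D (q + 1) (q + 2) z) = 0) :
    IsCoboundary C q (g ∘ₗ contractDegree R deg (variableMatrix Q ι l) q (q + 2) ∘ₗ θ q -
      g ∘ₗ θ (q + 2) ∘ₗ shiftComponent (τ l) q) := by
  set S := contractionComplex R h hf.algebraMap_eq_zero with hS
  let φ : C ⟶ S :=
    { f := fun n => ModuleCat.ofHom (θ n)
      comm' := fun i j hij => by
        ext1
        refine LinearMap.ext fun x => ?_
        exact (contractionComplex_d_apply h _ hij _).trans (hθ i j hij x) }
  -- Naturality of Eisenbud operators up to homotopy is applied to the chain map `φ`. One half of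
  -- the homotopy ends in boundaries, which `g` kills; the other half is the coboundary.
  obtain ⟨H⟩ := IsEisenbudFamily.homotopy hf hτ
    (isEisenbudFamily_contractionOperator h hf.algebraMap_eq_zero hf.surjective) φ l
  obtain ⟨s, hs⟩ := exists_of_homotopy H
  let t : C.X (q + 1) →ₗ[R] (Position c deg (q + 2) → R) := s q (q + 1)
  let t' : C.X q →ₗ[R] (Position c deg (q + 1) → R) :=
    (S.XIsoOfEq (show q - 1 + 2 = q + 1 by ring)).hom.hom ∘ₗ s (q - 1) q
  refine ⟨q + 1, rfl, -(g ∘ₗ t), fun x => ?_⟩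
  have h1 := hs (q - 1) q (q + 1) (by ring) rfl x
  have h2 : θ (q + 2) (shiftComponent (τ l) q x) =
      contractDegree R deg D (q + 1) (q + 2) (t' x) + t ((C.d q (q + 1)).hom x) +
        contractDegree R deg (variableMatrix Q ι l) q (q + 2) (θ q x) := by
    refine h1.trans (congrArg₂ _ (congrArg₂ _ ?_ rfl) rfl)
    refine Eq.trans ?_ (contractionComplex_d_apply h hf.algebraMap_eq_zero (by ring) (t' x))
    rw [CochainComplex.shiftFunctor_obj_d', Int.negOnePow_even 2 even_two, one_smul]
    change (S.d (q - 1 + 2) (q + 2)).hom (s (q - 1) q x) =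
      ((S.XIsoOfEq (show q - 1 + 2 = q + 1 by ring)).hom ≫ S.d _ _).hom _
    rw [HomologicalComplex.XIsoOfEq_hom_comp_d]
    rfl
  simp only [LinearMap.sub_apply, LinearMap.comp_apply, LinearMap.neg_apply]
  rw [h2, map_add, map_add, hg]
  abel

/-- In nonpositive degrees both complexes are projective resolutions of `M`, so they are homotopy
equivalent there, and cocycles modulo coboundaries agree in negative degrees. In positive degrees
the contraction complex vanishes, so the comparison commutes with the differentials everywhere. -/
theorem exists_comparison (hf : IsCompleteIntersection f R)
    (h : IsMatrixFactorization deg (potential f) D)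
    (hε : IsFreeResolution deg (coeffMatrix 0 D) ε) {C : CochainComplex (ModuleCat.{u} R) ℤ}
    {ρ : C.X 0 →ₗ[R] M} (hC : IsResolution C ρ) :
    ∃ θ : ∀ n, C.X n →ₗ[R] (Position c deg n → R), IsChainFamily D C θ ∧
      (∀ (N : Type u) [AddCommGroup N] [Module R N] (q p : ℤ) (_ : q + 1 = p) (_ : p < 0)
        (g : C.X p →ₗ[R] N), (∀ x, g ((C.d q p).hom x) = 0) →
        ∃ g' : (Position c deg p → R) →ₗ[R] N, (∀ z, g' (contractDegree R deg D q p z) = 0) ∧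
          IsCoboundary C p (g - g' ∘ₗ θ p)) ∧
      (∀ (N : Type u) [AddCommGroup N] [Module R N] (q p r : ℤ) (_ : q + 1 = p) (_ : p + 1 = r)
        (_ : p < 0) (g : (Position c deg p → R) →ₗ[R] N),
        (∀ z, g (contractDegree R deg D q p z) = 0) → IsCoboundary C p (g ∘ₗ θ p) →
        ∃ v : (Position c deg r → R) →ₗ[R] N, ∀ z, g z = v (contractDegree R deg D p r z)) := by
  have hS := isResolution_contractionComplex hf h hε
  have hd : ∀ i j, i + 1 = j → ∀ z, ((contractionComplex R h hf.algebraMap_eq_zero).d i j).hom z =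
      contractDegree R deg D i j z :=
    fun i j hij z => contractionComplex_d_apply h _ hij z
  obtain ⟨θ, hθ0, hθ⟩ := hC.exists_map hS
  obtain ⟨η, hη0, hη⟩ := hS.exists_map hC
  obtain ⟨s, hs⟩ := hC.exists_homotopy hC (fun n => LinearMap.id - η n ∘ₗ θ n)
    (fun x => by simp [hη0, hθ0]) (fun i j hij hj x => by
      simp only [LinearMap.sub_apply, LinearMap.id_apply, LinearMap.comp_apply, map_sub]
      rw [hη i j hij hj, hθ i j hij hj])
  obtain ⟨t, ht⟩ := hS.exists_homotopy hS (fun n => LinearMap.id - θ n ∘ₗ η n)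
    (fun x => (map_sub (contractionAugmentation deg ε) x (θ 0 (η 0 x))).trans
      (sub_eq_zero.2 ((hη0 x).symm.trans (hθ0 (η 0 x)).symm))) (fun i j hij hj x => by
      simp only [LinearMap.sub_apply, LinearMap.id_apply, LinearMap.comp_apply, map_sub]
      rw [hθ i j hij hj, hη i j hij hj])
  refine ⟨θ, fun i j hij x => ?_, ?_, ?_⟩
  · by_cases hj : j ≤ 0
    · exact (hd i j hij _).symm.trans (hθ i j hij hj x)
    · have := position_isEmpty (c := c) (deg := deg) (show 0 < j by omega)
      exact Subsingleton.elim _ _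
  · intro N _ _ q p hq hp g hg
    refine ⟨g ∘ₗ η p, fun z => ?_, p + 1, rfl, g ∘ₗ s p (p + 1), fun x => ?_⟩
    · change g (η p (contractDegree R deg D q p z)) = 0
      have := (hη q p hq hp.le z).trans (congrArg (η p) (hd q p hq z))
      exact (congrArg g this.symm).trans (hg _)
    · have := hs q p (p + 1) hq rfl hp x
      change g x - g (η p (θ p x)) = g (s p (p + 1) _)
      rw [← map_sub]
      refine (congrArg g this).trans ?_
      rw [map_add, hg, zero_add]
  · rintro N _ _ q p _ hq rfl hp g hg ⟨_, rfl, v, hv⟩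
    let t' : (Position c deg (p + 1) → R) →ₗ[R] (Position c deg p → R) := t p (p + 1)
    let t'' : (Position c deg p → R) →ₗ[R] (Position c deg q → R) := t q p
    let η' : (Position c deg (p + 1) → R) →ₗ[R] C.X (p + 1) := η (p + 1)
    let θ' : C.X p →ₗ[R] (Position c deg p → R) := θ p
    let η'' : (Position c deg p → R) →ₗ[R] C.X p := η p
    -- In `z = θ η z + d t'' z + t' d z`, the map `g` kills the middle term, while `g θ = v d` and
    -- `d η = η d` treat the first.
    refine ⟨g ∘ₗ t' + v ∘ₗ η', fun z => ?_⟩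
    have h1 : z - θ' (η'' z) = contractDegree R deg D q p (t'' z) +
        t' (contractDegree R deg D p (p + 1) z) :=
      (ht q p (p + 1) hq rfl hp z).trans (congrArg₂ _ (hd q p hq _) (congrArg t' (hd _ _ rfl z)))
    have h2 : (C.d p (p + 1)).hom (η'' z) = η' (contractDegree R deg D p (p + 1) z) :=
      (hη p (p + 1) rfl (by omega) z).trans (congrArg η' (hd _ _ rfl z))
    have h3 := congrArg g h1
    rw [map_sub, map_add, hg, zero_add, sub_eq_iff_eq_add] at h3
    rw [h3, LinearMap.add_apply, LinearMap.comp_apply, LinearMap.comp_apply, ← h2, ← hv]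
    rfl

end ComparisonMaps

/-! ### Matrices inducing zero in `N`: lifting and homotopy for matrix factorizations. -/

section NullMatrices

variable {Q : Type u} [CommRing Q] {c : ℕ} {ι κ τ : Type} [Fintype κ]
  {N : Type u} [AddCommGroup N] [Module Q N]

/-- All the columns of coefficients of `X` induce zero in `N`. -/
def IsNull (ν : κ → N) (X : Matrix κ ι (MvPolynomial (Fin c) Q)) : Prop :=
  ∀ e i, ∑ k, (X k i).coeff e • ν k = 0

theorem IsNull.add {ν : κ → N} {X Y : Matrix κ ι (MvPolynomial (Fin c) Q)} (hX : IsNull ν X)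
    (hY : IsNull ν Y) : IsNull ν (X + Y) := fun e i => by
  simp [add_smul, Finset.sum_add_distrib, hX e i, hY e i]

theorem IsNull.neg {ν : κ → N} {X : Matrix κ ι (MvPolynomial (Fin c) Q)} (hX : IsNull ν X) :
    IsNull ν (-X) := fun e i => by
  simp [hX e i]

theorem IsNull.sub {ν : κ → N} {X Y : Matrix κ ι (MvPolynomial (Fin c) Q)} (hX : IsNull ν X)
    (hY : IsNull ν Y) : IsNull ν (X - Y) := by
  rw [sub_eq_add_neg]
  exact hX.add hY.neg

theorem IsNull.zsmul {ν : κ → N} {X : Matrix κ ι (MvPolynomial (Fin c) Q)} (t : ℤ)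
    (hX : IsNull ν X) : IsNull ν (t • X) := fun e i => by
  simp only [Matrix.smul_apply, MvPolynomial.coeff_smul, smul_assoc, ← Finset.smul_sum, hX e i,
    smul_zero]

theorem IsNull.mul [Fintype ι] {ν : κ → N} {X : Matrix κ ι (MvPolynomial (Fin c) Q)} (hX : IsNull ν X)
    (Y : Matrix ι τ (MvPolynomial (Fin c) Q)) : IsNull ν (X * Y) := fun e j => by
  have h : ∀ k, ((X * Y) k j).coeff e • ν k =
      ∑ x ∈ Finset.HasAntidiagonal.antidiagonal e, ∑ i, (Y i j).coeff x.2 • (X k i).coeff x.1 • ν k := by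
    intro k
    rw [← coeffMatrix_apply, coeffMatrix_mul, Matrix.sum_apply, Finset.sum_smul]
    refine Finset.sum_congr rfl fun x _ => ?_
    rw [Matrix.mul_apply, Finset.sum_smul]
    refine Finset.sum_congr rfl fun i _ => ?_
    rw [coeffMatrix_apply, coeffMatrix_apply, mul_comm, mul_smul]
  simp_rw [h]
  rw [Finset.sum_comm]
  refine Finset.sum_eq_zero fun x _ => ?_
  rw [Finset.sum_comm]
  refine Finset.sum_eq_zero fun i _ => ?_
  rw [← Finset.smul_sum, hX, smul_zero]

variable {deg : κ → ℕ}

theorem isNull_of_rows {ν : κ → N} (hν : ∀ k, ν k ≠ 0 → deg k = 0)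
    {X : Matrix κ ι (MvPolynomial (Fin c) Q)} (hX : ∀ k i, X k i ≠ 0 → deg k ≠ 0) :
    IsNull ν X := fun e i => Finset.sum_eq_zero fun k _ => by
  by_cases hk : ν k = 0
  · rw [hk, smul_zero]
  · by_cases hki : X k i = 0
    · simp [hki]
    · exact absurd (hν k hk) (hX k i hki)

theorem IsMatrixFactorization.apply_eq_zero [DecidableEq κ] {W : MvPolynomial (Fin c) Q}
    {D : Matrix κ κ (MvPolynomial (Fin c) Q)} (h : IsMatrixFactorization deg W D) {i j : κ}
    (hij : deg i + 1 < deg j) : D i j = 0 := by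
  ext e
  by_contra h0
  have := h.homog i j e h0
  omega

theorem IsMatrixFactorization.apply_eq_C [DecidableEq κ] {W : MvPolynomial (Fin c) Q}
    {D : Matrix κ κ (MvPolynomial (Fin c) Q)} (h : IsMatrixFactorization deg W D) {i j : κ}
    (hij : deg j = deg i + 1) : D i j = MvPolynomial.C (coeffMatrix 0 D i j) := by
  ext e
  rw [MvPolynomial.coeff_C]
  split_ifs with he
  · rw [← he]; rfl
  · by_contra h0
    have := h.homog i j e h0
    exact he (((Finsupp.degree_eq_zero_iff e).1 (by omega)).symm)

/-- Only rows of degree zero matter; there homogeneity leaves the constant coefficient of `D`, whose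
columns `ε` sends to zero. -/
theorem IsFreeResolution.isNull_mul [DecidableEq κ] {W : MvPolynomial (Fin c) Q}
    {D : Matrix κ κ (MvPolynomial (Fin c) Q)} (h : IsMatrixFactorization deg W D) {ν : κ → N}
    (hν : IsFreeResolution deg (coeffMatrix 0 D) ν) (X : Matrix κ ι (MvPolynomial (Fin c) Q)) :
    IsNull ν (D * X) := by
  refine IsNull.mul (fun e j => ?_) X
  by_cases he : e = 0
  · subst he
    exact hν.eps_d j
  · refine Finset.sum_eq_zero fun k _ => ?_
    by_cases hk : ν k = 0
    · rw [hk, smul_zero]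
    · by_cases h0 : (D k j).coeff e = 0
      · rw [h0, zero_smul]
      · have h1 := h.homog k j e h0
        have h2 := hν.eps_deg k hk
        have h3 : e.degree ≠ 0 := fun h => he ((Finsupp.degree_eq_zero_iff e).1 h)
        omega

theorem IsFreeResolution.exists_matrix_eq [Fintype ι] {d : Matrix κ κ Q} {ν : κ → N}
    (h : IsFreeResolution deg d ν) {p : ℕ} (Z : Matrix κ ι (MvPolynomial (Fin c) Q))
    (hp : ∀ k i, Z k i ≠ 0 → deg k = p) (hZ : d.map (MvPolynomial.C (σ := Fin c)) * Z = 0) (hZ' : IsNull ν Z) :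
    ∃ V : Matrix κ ι (MvPolynomial (Fin c) Q), (∀ k i, V k i ≠ 0 → deg k = p + 1) ∧
      Z = d.map (MvPolynomial.C (σ := Fin c)) * V := by
  classical
  have hw : ∀ e i, ∃ w : κ → Q, (∀ k, w k ≠ 0 → deg k = p + 1) ∧
      (fun k => (Z k i).coeff e) = d.mulVec w := by
    intro e i
    refine h.exact_homogeneous _ (fun k hk => hp k i fun h0 => hk ?_) ?_ (hZ' e i)
    · rw [h0, MvPolynomial.coeff_zero]
    · ext k
      have := congrArg (MvPolynomial.coeff e) (congrFun (congrFun hZ k) i)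
      simpa [Matrix.mul_apply, MvPolynomial.coeff_sum, Matrix.mulVec, dotProduct] using this
  choose w hw1 hw2 using hw
  let S : Finset (Fin c →₀ ℕ) := Finset.univ.biUnion fun k => Finset.univ.biUnion fun i =>
    (Z k i).support
  have hS : ∀ e k i, e ∉ S → (Z k i).coeff e = 0 := fun e k i he => by
    by_contra h0
    exact he (Finset.mem_biUnion.2 ⟨k, Finset.mem_univ _, Finset.mem_biUnion.2
      ⟨i, Finset.mem_univ _, MvPolynomial.mem_support_iff.2 h0⟩⟩)
  have hV : ∀ k i e, (∑ e' ∈ S, MvPolynomial.monomial e' (w e' i k)).coeff e =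
      if e ∈ S then w e i k else 0 := by
    intro k i e
    simp [MvPolynomial.coeff_sum, MvPolynomial.coeff_monomial]
  refine ⟨Matrix.of fun k i => ∑ e ∈ S, MvPolynomial.monomial e (w e i k), fun k i hki => ?_, ?_⟩
  · by_contra h0
    refine hki (Finset.sum_eq_zero fun e _ => ?_)
    rw [show w e i k = 0 by by_contra h1; exact h0 (hw1 e i k h1), map_zero]
  · ext k i e
    have h1 := congrFun (hw2 e i) k
    simp only [Matrix.mulVec, dotProduct] at h1
    simp only [Matrix.mul_apply, MvPolynomial.coeff_sum, Matrix.map_apply, MvPolynomial.coeff_C_mul,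
      Matrix.of_apply, MvPolynomial.coeff_monomial, Finset.sum_ite_eq']
    by_cases he : e ∈ S
    · simpa [he] using h1
    · simp [he, hS e k i he]

/-- The differential on matrices, with sign `t` and then `-t`, squares to zero because both
factorizations square to the same scalar `W`. -/
theorem mul_coboundary {B : Type*} [CommRing B] [DecidableEq κ] [Fintype ι] [DecidableEq ι] {W : B}
    {D : Matrix κ κ B} {D' : Matrix ι ι B} (hD : D * D = W • 1) (hD' : D' * D' = W • 1) {t : ℤ}
    (ht : t * t = 1) (V : Matrix κ ι B) :
    D * (D * V + t • (V * D')) = t • ((D * V + t • (V * D')) * D') := by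
  have h1 : D * (D * V) = W • V := by rw [← Matrix.mul_assoc, hD, Matrix.smul_mul, Matrix.one_mul]
  have h2 : V * D' * D' = W • V := by rw [Matrix.mul_assoc, hD', Matrix.mul_smul, Matrix.mul_one]
  rw [Matrix.mul_add, Matrix.add_mul, h1, Matrix.mul_smul, Matrix.smul_mul, h2, smul_add, smul_smul,
    ht, one_smul, ← Matrix.mul_assoc, add_comm]

/-- A cocycle inducing zero in the module resolved by `G` is a coboundary: `D` denotes the
matrix factorization extending the resolution, `D'` any other matrix factorization. -/
theorem IsFreeResolution.exists_eq_of_isNull [DecidableEq κ] [Fintype ι] [DecidableEq ι]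
    {W : MvPolynomial (Fin c) Q}
    {D : Matrix κ κ (MvPolynomial (Fin c) Q)} (h : IsMatrixFactorization deg W D) {ν : κ → N}
    (hν : IsFreeResolution deg (coeffMatrix 0 D) ν) {D' : Matrix ι ι (MvPolynomial (Fin c) Q)}
    (hD' : D' * D' = W • 1) {t : ℤ} (ht : t * t = 1) (r : Matrix κ ι (MvPolynomial (Fin c) Q))
    (hr : D * r = t • (r * D')) (hr' : IsNull ν r) :
    ∃ V : Matrix κ ι (MvPolynomial (Fin c) Q), IsNull ν V ∧ r = D * V + t • (V * D') := by
  -- Induction on the row degree: after step `p` the remainder `r'` only has rows of degree at least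
  -- `p`. Its rows of degree `p` form a cycle for `d`, the other terms of `D r' = t r' D'` vanishing
  -- in degree `p - 1`, and exactness writes them as `d U`.
  have key : ∀ p : ℕ, ∃ V : Matrix κ ι (MvPolynomial (Fin c) Q), IsNull ν V ∧
      ∀ k i, (r - (D * V + t • (V * D'))) k i ≠ 0 → p ≤ deg k := by
    intro p
    induction p with
    | zero => exact ⟨0, fun e i => by simp, fun k i _ => Nat.zero_le _⟩
    | succ p ih =>
      obtain ⟨V, hV, hVp⟩ := ih
      set r' := r - (D * V + t • (V * D')) with hr'def
      have hcomm : D * r' = t • (r' * D') := by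
        rw [hr'def, Matrix.mul_sub, Matrix.sub_mul, hr, mul_coboundary h.sq hD' ht, smul_sub]
      have hnull : IsNull ν r' :=
        hr'.sub ((hν.isNull_mul h V).add ((hV.mul D').zsmul t))
      let Z : Matrix κ ι (MvPolynomial (Fin c) Q) := Matrix.of fun k i =>
        if deg k = p then r' k i else 0
      have hZp : ∀ k i, Z k i ≠ 0 → deg k = p := fun k i hki => by
        by_contra h0
        exact hki (if_neg h0)
      have hZ : (coeffMatrix 0 D).map (MvPolynomial.C (σ := Fin c)) * Z = 0 := by
        ext1 k i
        by_cases hk : deg k + 1 = p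
        · have h1 : ((coeffMatrix 0 D).map (MvPolynomial.C (σ := Fin c)) * Z) k i = (D * r') k i := by
            simp only [Matrix.mul_apply]
            refine Finset.sum_congr rfl fun j _ => ?_
            simp only [Z, Matrix.of_apply, Matrix.map_apply]
            split_ifs with hj
            · rw [h.apply_eq_C (by omega)]
            · by_cases h0 : r' j i = 0
              · rw [h0, mul_zero, mul_zero]
              · have := hVp j i h0
                rw [h.apply_eq_zero (by omega), zero_mul, mul_zero]
          rw [h1, hcomm, Matrix.smul_apply, matrix_mul_apply_eq_zero, smul_zero, Matrix.zero_apply]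
          intro j
          left
          by_contra h0
          have := hVp k j h0
          omega
        · refine matrix_mul_apply_eq_zero fun j => ?_
          by_cases hj : deg j = p
          · left
            rw [Matrix.map_apply]
            by_contra h0
            have := hν.homog k j fun h1 => h0 (by rw [h1, map_zero])
            omega
          · right
            exact if_neg hj
      -- For `p = 0` this is the hypothesis that the cocycle is null; above degree zero it holds
      -- automatically.
      have hZ' : IsNull ν Z := by
        by_cases hp : p = 0
        · intro e i
          rw [← hnull e i]
          refine Finset.sum_congr rfl fun k _ => ?_
          by_cases hk : ν k = 0
          · rw [hk, smul_zero, smul_zero]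
          · simp only [Z, Matrix.of_apply]
            rw [if_pos (by rw [hν.eps_deg k hk, hp])]
        · exact isNull_of_rows hν.eps_deg fun k i hki => by rw [hZp k i hki]; exact hp
      obtain ⟨U, hU, hUZ⟩ := hν.exists_matrix_eq Z hZp hZ hZ'
      have hUn : IsNull ν U := isNull_of_rows hν.eps_deg fun k i hki => by
        rw [hU k i hki]; omega
      refine ⟨V + U, hV.add hUn, fun k i hki => ?_⟩
      by_contra hk
      refine hki ?_
      have e1 : r - (D * (V + U) + t • ((V + U) * D')) = r' - D * U - t • (U * D') := by
        simp only [hr'def, Matrix.mul_add, Matrix.add_mul, smul_add]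
        abel
      have e2 : (U * D') k i = 0 := matrix_mul_apply_eq_zero fun j => by
        left
        by_contra h0
        have := hU k j h0
        omega
      rw [e1, Matrix.sub_apply, Matrix.sub_apply, Matrix.smul_apply, e2, smul_zero, sub_zero]
      by_cases hkp : deg k = p
      · have e3 : r' k i = Z k i := by simp [Z, hkp]
        rw [e3, hUZ, sub_eq_zero, Matrix.mul_apply, Matrix.mul_apply]
        refine Finset.sum_congr rfl fun j _ => ?_
        by_cases h0 : U j i = 0
        · rw [h0, mul_zero, mul_zero]
        · rw [Matrix.map_apply, h.apply_eq_C (by rw [hU j i h0, hkp])]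
      · have e3 : r' k i = 0 := by
          by_contra h0
          have := hVp k i h0
          omega
        rw [e3, matrix_mul_apply_eq_zero, sub_zero]
        intro j
        by_cases h0 : U j i = 0
        · exact Or.inr h0
        · left
          exact h.apply_eq_zero (by rw [hU j i h0]; omega)
  obtain ⟨V, hV, hVr⟩ := key (Finset.univ.sup deg + 1)
  refine ⟨V, hV, ?_⟩
  rw [← sub_eq_zero]
  ext1 k i
  by_contra h0
  have h1 := hVr k i h0
  have h2 : deg k ≤ Finset.univ.sup deg := Finset.le_sup (Finset.mem_univ k)
  omega

/-- Row matrices inducing cocycles lift to morphisms of matrix factorizations. -/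
theorem IsFreeResolution.exists_lift [DecidableEq κ] [Fintype ι] [DecidableEq ι] {W : MvPolynomial (Fin c) Q}
    {D : Matrix κ κ (MvPolynomial (Fin c) Q)} (h : IsMatrixFactorization deg W D) {ν : κ → N}
    (hν : IsFreeResolution deg (coeffMatrix 0 D) ν) {D' : Matrix ι ι (MvPolynomial (Fin c) Q)}
    (hD' : D' * D' = W • 1) {s : ℤ} (hs : s * s = 1) (X₀ : Matrix κ ι (MvPolynomial (Fin c) Q))
    (hX₀ : IsNull ν (X₀ * D')) : ∃ X : Matrix κ ι (MvPolynomial (Fin c) Q), D * X = s • (X * D') ∧ IsNull ν (X - X₀) := by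
  -- The failure of `X₀` to be a morphism is a null cocycle for the opposite sign, hence the
  -- boundary of a null correction `V`.
  obtain ⟨V, hV, hV'⟩ := hν.exists_eq_of_isNull h hD' (t := -s) (by rw [neg_mul_neg, hs])
    (s • (X₀ * D') - D * X₀) (by
      have e := mul_coboundary h.sq hD' (t := -s) (by rw [neg_mul_neg, hs]) X₀
      have e' : s • (X₀ * D') - D * X₀ = -(D * X₀ + -s • (X₀ * D')) := by
        rw [neg_smul]; abel
      rw [e', Matrix.mul_neg, Matrix.neg_mul, e, smul_neg]) ((hX₀.zsmul s).sub (hν.isNull_mul h X₀))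
  refine ⟨X₀ + V, ?_, by rwa [add_sub_cancel_left]⟩
  rw [neg_smul] at hV'
  rw [Matrix.mul_add, Matrix.add_mul, smul_add, ← sub_eq_zero]
  rw [← sub_eq_zero] at hV'
  rw [← neg_eq_zero, ← hV']
  abel

/-- Morphisms of matrix factorizations inducing coboundaries are null-homotopic. -/
theorem IsFreeResolution.exists_homotopy_of_isNull [DecidableEq κ] [Fintype ι] [DecidableEq ι]
    {W : MvPolynomial (Fin c) Q}
    {D : Matrix κ κ (MvPolynomial (Fin c) Q)} (h : IsMatrixFactorization deg W D) {ν : κ → N}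
    (hν : IsFreeResolution deg (coeffMatrix 0 D) ν) {D' : Matrix ι ι (MvPolynomial (Fin c) Q)}
    (hD' : D' * D' = W • 1) {s : ℤ} (hs : s * s = 1) (X U : Matrix κ ι (MvPolynomial (Fin c) Q))
    (hX : D * X = s • (X * D')) (hXU : IsNull ν (X - U * D')) :
    ∃ Y : Matrix κ ι (MvPolynomial (Fin c) Q), X = D * Y + s • (Y * D') := by
  -- Since `s² = 1`, the boundary of `s • U` contains exactly `U D'`; its other term is null.
  have e : s • (s • U * D') = U * D' := by rw [Matrix.smul_mul, smul_smul, hs, one_smul]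
  obtain ⟨V, -, hV⟩ := hν.exists_eq_of_isNull h hD' hs (X - (D * (s • U) + s • (s • U * D'))) (by
      rw [Matrix.mul_sub, Matrix.sub_mul, smul_sub, hX, mul_coboundary h.sq hD' hs]) (by
      rw [e, add_comm, ← sub_sub]
      exact hXU.sub (hν.isNull_mul h _))
  refine ⟨V + s • U, ?_⟩
  rw [sub_eq_iff_eq_add] at hV
  rw [hV, Matrix.mul_add, Matrix.add_mul, smul_add]
  abel

end NullMatrices

/-! ### Matrices as families of functionals on the contraction complex. -/

section Rows

variable {Q : Type u} [CommRing Q] (R : Type u) [CommRing R] [Algebra Q R] {c : ℕ} {ι κ : Type}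
  [Fintype ι] [Fintype κ] {N : Type u} [AddCommGroup N] [Module R N] [Module Q N]
  [IsScalarTower Q R N] (deg : ι → ℕ) (ν : κ → N)

/-- The functional with values in `N` given by a matrix of polynomials and elements of `N`. -/
noncomputable def rowDegree (X : Matrix κ ι (MvPolynomial (Fin c) Q)) (n : ℤ) :
    (Position c deg n → R) →ₗ[R] N where
  toFun z := ∑ k, contractMatrix R X (extendDegree R deg n z) k 0 • ν k
  map_add' x y := by simp [add_smul, Finset.sum_add_distrib]
  map_smul' r x := by simp [mul_smul, Finset.smul_sum]

variable {R deg ν}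

theorem rowDegree_apply (X : Matrix κ ι (MvPolynomial (Fin c) Q)) (n : ℤ)
    (z : Position c deg n → R) :
    rowDegree R deg ν X n z = ∑ k, contractMatrix R X (extendDegree R deg n z) k 0 • ν k := rfl

theorem rowDegree_mul {m : ℤ} (X : Matrix κ ι (MvPolynomial (Fin c) Q))
    {Y : Matrix ι ι (MvPolynomial (Fin c) Q)} (hY : IsHomogeneousOfDegree deg deg m Y) {n n' : ℤ}
    (hn : n + m = n') (z : Position c deg n → R) :
    rowDegree R deg ν (X * Y) n z = rowDegree R deg ν X n' (contractDegree R deg Y n n' z) := by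
  simp only [rowDegree_apply, contractMatrix_mul, extendDegree_contractDegree hY hn]

theorem rowDegree_add (X Y : Matrix κ ι (MvPolynomial (Fin c) Q)) (n : ℤ) :
    rowDegree R deg ν (X + Y) n = rowDegree R deg ν X n + rowDegree R deg ν Y n :=
  LinearMap.ext fun z => by
    simp [rowDegree_apply, contractMatrix_add, add_smul, Finset.sum_add_distrib]

theorem rowDegree_sub (X Y : Matrix κ ι (MvPolynomial (Fin c) Q)) (n : ℤ) :
    rowDegree R deg ν (X - Y) n = rowDegree R deg ν X n - rowDegree R deg ν Y n :=
  LinearMap.ext fun z => by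
    simp [rowDegree_apply, contractMatrix_sub, sub_smul, Finset.sum_sub_distrib]

theorem rowDegree_zero (n : ℤ) :
    rowDegree R deg ν (0 : Matrix κ ι (MvPolynomial (Fin c) Q)) n = 0 := by
  rw [← sub_self (0 : Matrix κ ι (MvPolynomial (Fin c) Q)), rowDegree_sub, sub_self]

theorem rowDegree_C_smul (q : Q) (X : Matrix κ ι (MvPolynomial (Fin c) Q)) (n : ℤ) :
    rowDegree R deg ν ((MvPolynomial.C q : MvPolynomial (Fin c) Q) • X) n = algebraMap Q R q • rowDegree R deg ν X n :=
  LinearMap.ext fun z => by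
    have : (fun i => contract R (MvPolynomial.C q : MvPolynomial (Fin c) Q)
        (extendDegree R deg n z i)) = algebraMap Q R q • extendDegree R deg n z :=
      funext fun i => contract_C q _
    simp only [rowDegree_apply, contractMatrix_smul, LinearMap.smul_apply, this, map_smul,
      Pi.smul_apply, smul_assoc, Finset.smul_sum]

theorem rowDegree_sum {α : Type*} (s : Finset α) (X : α → Matrix κ ι (MvPolynomial (Fin c) Q))
    (n : ℤ) : rowDegree R deg ν (∑ a ∈ s, X a) n = ∑ a ∈ s, rowDegree R deg ν (X a) n := by
  classical
  induction s using Finset.induction_on with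
  | empty => simp [rowDegree_zero]
  | insert a s ha ih => rw [Finset.sum_insert ha, Finset.sum_insert ha, rowDegree_add, ih]

/-- On the basis function at `(i, e)` the functional reads off the coefficient `e` of column `i`.
Hence matrices modulo null ones correspond to families of functionals, and multiplication of
matrices to composition. -/
theorem rowDegree_single [DecidableEq ι] (X : Matrix κ ι (MvPolynomial (Fin c) Q)) (n : ℤ)
    (x : Position c deg n) :
    rowDegree R deg ν X n (Pi.single x 1) = ∑ k, (X k x.1.1).coeff x.1.2 • ν k := by
  classical
  rw [rowDegree_apply]
  refine Finset.sum_congr rfl fun k _ => ?_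
  have hz : ∀ i e, extendDegree R deg n (Pi.single x 1) i e =
      if (i, e) = x.1 then (1 : R) else 0 := by
    intro i e
    by_cases h : ((2 * e.degree + deg i : ℕ) : ℤ) = -n
    · refine (extendDegree_coe (Pi.single x (1 : R)) ⟨(i, e), h⟩).trans ?_
      rw [Pi.single_apply]
      exact if_congr Subtype.ext_iff rfl rfl
    · rw [extendDegree_of_ne _ h, if_neg]
      intro h0
      exact h (by rw [← x.2, ← h0])
  rw [contractMatrix_apply', Finset.sum_eq_single x.1.1]
  · by_cases hc : (X k x.1.1).coeff x.1.2 = 0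
    · rw [hc, zero_smul, Finset.sum_eq_zero, zero_smul]
      intro e he
      rw [hz, if_neg, mul_zero]
      intro h0
      rw [zero_add] at h0
      have : e = x.1.2 := congrArg Prod.snd h0
      exact MvPolynomial.mem_support_iff.1 he (by rw [this, hc])
    · rw [Finset.sum_eq_single x.1.2]
      · rw [zero_add, hz, if_pos rfl, mul_one, algebraMap_smul]
      · intro e _ he
        rw [hz, if_neg, mul_zero]
        intro h0
        rw [zero_add] at h0
        exact he (congrArg Prod.snd h0)
      · intro h0
        exact absurd (MvPolynomial.notMem_support_iff.1 h0) hc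
  · intro i _ hi
    refine Finset.sum_eq_zero fun e _ => ?_
    rw [hz, if_neg, mul_zero]
    intro h0
    exact hi (congrArg Prod.fst h0)
  · simp

theorem rowDegree_eq_iff [DecidableEq ι] (X : Matrix κ ι (MvPolynomial (Fin c) Q)) (n : ℤ)
    (g : (Position c deg n → R) →ₗ[R] N) : rowDegree R deg ν X n = g ↔
      ∀ x : Position c deg n, ∑ k, (X k x.1.1).coeff x.1.2 • ν k = g (Pi.single x 1) := by
  classical
  constructor
  · rintro rfl x
    rw [rowDegree_single]
  · intro h
    refine LinearMap.pi_ext' fun x => LinearMap.ext_ring ?_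
    change rowDegree R deg ν X n (Pi.single x 1) = g (Pi.single x 1)
    rw [rowDegree_single, h]

theorem isNull_iff_rowDegree [DecidableEq ι] (X : Matrix κ ι (MvPolynomial (Fin c) Q)) :
    IsNull ν X ↔ ∀ n, rowDegree R deg ν X n = 0 := by
  constructor
  · intro h n
    exact (rowDegree_eq_iff X n 0).2 fun x => h _ _
  · intro h e i
    exact (rowDegree_eq_iff X _ 0).1 (h (-((2 * e.degree + deg i : ℕ) : ℤ)))
      ⟨(i, e), (neg_neg _).symm⟩

theorem exists_rowDegree_eq [DecidableEq ι] (hν : Submodule.span Q (Set.range ν) = ⊤)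
    (n : ℤ) (g : (Position c deg n → R) →ₗ[R] N) :
    ∃ X : Matrix κ ι (MvPolynomial (Fin c) Q), rowDegree R deg ν X n = g ∧
      ∀ n', n' ≠ n → rowDegree R deg ν X n' = 0 := by
  classical
  have := Fintype.ofFinite (Position c deg n)
  choose q hq using fun x : Position c deg n => (Submodule.mem_span_range_iff_exists_fun Q).1
    (hν ▸ Submodule.mem_top : g (Pi.single x 1) ∈ _)
  let X : Matrix κ ι (MvPolynomial (Fin c) Q) := Matrix.of fun k i =>
    ∑ x : Position c deg n, if x.1.1 = i then MvPolynomial.monomial x.1.2 (q x k) else 0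
  have hX : ∀ k i e, (X k i).coeff e =
      ∑ x : Position c deg n, if x.1 = (i, e) then q x k else 0 := by
    intro k i e
    simp only [X, Matrix.of_apply, MvPolynomial.coeff_sum]
    refine Finset.sum_congr rfl fun x _ => ?_
    by_cases h1 : x.1.1 = i
    · rw [if_pos h1, MvPolynomial.coeff_monomial]
      exact if_congr ⟨fun h => Prod.ext h1 h, fun h => congrArg Prod.snd h⟩ rfl rfl
    · rw [if_neg h1, if_neg (fun h => h1 (congrArg Prod.fst h)), MvPolynomial.coeff_zero]
  refine ⟨X, (rowDegree_eq_iff X n g).2 fun x => ?_, fun n' hn' => ?_⟩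
  · rw [← hq]
    refine Finset.sum_congr rfl fun k _ => ?_
    rw [hX, Finset.sum_eq_single x]
    · rw [if_pos rfl]
    · intro y _ hy
      exact if_neg fun h => hy (Subtype.ext h)
    · simp
  · refine (rowDegree_eq_iff X n' 0).2 fun x => Finset.sum_eq_zero fun k _ => ?_
    rw [hX, Finset.sum_eq_zero, zero_smul]
    intro y _
    refine if_neg fun h => hn' ?_
    have h1 := x.2
    have h2 := y.2
    rw [h] at h2
    change _ = -n at h2
    have : -n' = -n := h1.symm.trans h2
    exact neg_injective this

theorem rowDegree_eq_zero_of_pos (X : Matrix κ ι (MvPolynomial (Fin c) Q)) {n : ℤ} (hn : 0 < n) :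
    rowDegree R deg ν X n = 0 := by
  have := position_isEmpty (c := c) (deg := deg) hn
  refine LinearMap.ext fun z => ?_
  rw [Subsingleton.elim z 0, map_zero, map_zero]

theorem exists_rowDegree_eq_family [DecidableEq ι] (hν : Submodule.span Q (Set.range ν) = ⊤)
    (g : ∀ n : ℤ, (Position c deg n → R) →ₗ[R] N) (B : ℕ) (hB : ∀ n < -(B : ℤ), g n = 0) :
    ∃ X : Matrix κ ι (MvPolynomial (Fin c) Q), ∀ n, rowDegree R deg ν X n = g n := by
  choose X hX hX' using fun n => exists_rowDegree_eq (c := c) (deg := deg) (R := R) hν n (g n)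
  refine ⟨∑ j ∈ Finset.range (B + 1), X (-(j : ℤ)), fun n => ?_⟩
  rw [rowDegree_sum]
  by_cases hn : 0 < n
  · have := position_isEmpty (c := c) (deg := deg) hn
    refine LinearMap.ext fun z => ?_
    rw [Subsingleton.elim z 0, map_zero, map_zero]
  · obtain ⟨m, rfl⟩ : ∃ m : ℕ, n = -(m : ℤ) := ⟨(-n).toNat, by omega⟩
    by_cases hm : m ≤ B
    · rw [Finset.sum_eq_single m, hX]
      · intro j _ hj
        exact hX' _ _ (by omega)
      · intro h0
        exact absurd (Finset.mem_range.2 (by omega)) h0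
    · rw [hB _ (by omega)]
      refine Finset.sum_eq_zero fun j hj => hX' _ _ ?_
      have := Finset.mem_range.1 hj
      omega

/-- A matrix has finitely many monomials, so it induces nonzero functionals in finitely many degrees
only. This matches the direct sum over degrees on the side of `Hom`. -/
theorem exists_forall_rowDegree_eq_zero [DecidableEq ι] (X : Matrix κ ι (MvPolynomial (Fin c) Q)) :
    ∃ B : ℕ, ∀ n < -(B : ℤ), rowDegree R deg ν X n = 0 := by
  refine ⟨∑ k, ∑ i, (2 * (X k i).totalDegree + deg i), fun n hn =>
    (rowDegree_eq_iff X n 0).2 fun x => Finset.sum_eq_zero fun k _ => ?_⟩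
  by_contra h0
  have h1 : (X k x.1.1).coeff x.1.2 ≠ 0 := fun h => h0 (by rw [h, zero_smul])
  have h2 : x.1.2.degree ≤ (X k x.1.1).totalDegree :=
    MvPolynomial.le_totalDegree (MvPolynomial.mem_support_iff.2 h1)
  have h3 : 2 * (X k x.1.1).totalDegree + deg x.1.1 ≤
      ∑ k, ∑ i, (2 * (X k i).totalDegree + deg i) :=
    (Finset.single_le_sum (f := fun i => 2 * (X k i).totalDegree + deg i)
      (fun _ _ => Nat.zero_le _) (Finset.mem_univ x.1.1)).trans
      (Finset.single_le_sum (f := fun k => ∑ i, (2 * (X k i).totalDegree + deg i))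
        (fun _ _ => Nat.zero_le _) (Finset.mem_univ k))
  have := x.2
  omega

theorem isNull_mul_iff [DecidableEq ι] {D : Matrix ι ι (MvPolynomial (Fin c) Q)}
    (hD : IsHomogeneousOfDegree deg deg 1 D) (X : Matrix κ ι (MvPolynomial (Fin c) Q)) :
    IsNull ν (X * D) ↔ ∀ n n', n + 1 = n' → ∀ z : Position c deg n → R,
      rowDegree R deg ν X n' (contractDegree R deg D n n' z) = 0 := by
  rw [isNull_iff_rowDegree (R := R) (deg := deg)]
  constructor
  · intro h n n' hn z
    rw [← rowDegree_mul X hD hn, h]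
    rfl
  · intro h n
    refine LinearMap.ext fun z => ?_
    rw [rowDegree_mul X hD rfl, h n _ rfl]
    rfl

theorem rowDegree_X_smul [DecidableEq ι] (X : Matrix κ ι (MvPolynomial (Fin c) Q)) (l : Fin c) (p : ℤ) :
    rowDegree R deg ν ((MvPolynomial.X l : MvPolynomial (Fin c) Q) • X) p =
      rowDegree R deg ν X (p + 2) ∘ₗ contractDegree R deg (variableMatrix Q ι l) p (p + 2) := by
  have e : (MvPolynomial.X l : MvPolynomial (Fin c) Q) • X = X * variableMatrix Q ι l := by
    rw [variableMatrix, Matrix.mul_smul, Matrix.mul_one]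
  refine LinearMap.ext fun z => ?_
  rw [e, rowDegree_mul X (isHomogeneousOfDegree_variableMatrix l) rfl]
  rfl

theorem IsNull.smul_mul [DecidableEq ι] {F : Matrix ι ι (MvPolynomial (Fin c) Q)}
    {X : Matrix κ ι (MvPolynomial (Fin c) Q)} (hX : IsNull ν (X * F))
    (p : MvPolynomial (Fin c) Q) : IsNull ν (p • X * F) := by
  have : p • X * F = X * F * p • (1 : Matrix ι ι (MvPolynomial (Fin c) Q)) := by
    rw [Matrix.mul_smul, Matrix.mul_one, Matrix.smul_mul]
  rw [this]
  exact hX.mul _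

end Rows

/-! ### The polynomial action before reduction to the residue field. -/

section Action

variable {Q : Type u} [CommRing Q] [IsLocalRing Q] {R : Type u} [CommRing R] [Algebra Q R]
    {c : ℕ} {f : Fin c → Q}

/-- The action of `R[χ₁, …, χ_c]` on `⨁ Hom(C, Σⁱ D)`. -/
noncomputable def gradedHomAction (hf : IsCompleteIntersection f R) (C D : Ktac R) :
    MvPolynomial (Fin c) R →ₐ[R] Module.End R (GradedHom C D) :=
  haveI := Algebra.isMulCommutative_adjoin R (s := Set.range (cohomologyOperator hf C D))
    (by rintro _ ⟨l, rfl⟩ _ ⟨m, rfl⟩; exact cohomologyOperator_comm hf C D l m)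
  letI : CommSemiring (Algebra.adjoin R (Set.range (cohomologyOperator hf C D))) :=
    { Subalgebra.toSemiring _ with mul_comm := mul_comm' }
  (Algebra.adjoin R (Set.range (cohomologyOperator hf C D))).val.comp
    (MvPolynomial.aeval fun l => ⟨cohomologyOperator hf C D l, Algebra.subset_adjoin ⟨l, rfl⟩⟩)

theorem gradedHomAction_X (hf : IsCompleteIntersection f R) (C D : Ktac R) (l : Fin c) :
    gradedHomAction hf C D (MvPolynomial.X l) = cohomologyOperator hf C D l := by
  simp [gradedHomAction]

theorem gradedHomAction_C (hf : IsCompleteIntersection f R) (C D : Ktac R) (r : R)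
    (h : GradedHom C D) : gradedHomAction hf C D (MvPolynomial.C r) h = r • h := by
  rw [← MvPolynomial.algebraMap_eq, AlgHom.commutes, Module.algebraMap_end_apply]

theorem cohomologyOperator_apply_add_two (hf : IsCompleteIntersection f R) (C D : Ktac R)
    (l : Fin c) (h : GradedHom C D) (i : ℕ) : cohomologyOperator hf C D l h (i + 2) =
      (eisenbudOperator hf C l).comp (h i) (by push_cast; rfl) := by
  induction h using DirectSum.induction_on with
  | zero => rw [map_zero, DirectSum.zero_apply, DirectSum.zero_apply, ShiftedHom.comp_zero]
  | of j x =>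
    rw [← DirectSum.lof_eq_of R, cohomologyOperator_lof]
    by_cases hij : j = i
    · subst hij
      rw [DirectSum.lof_apply, DirectSum.lof_apply]
    · rw [DirectSum.lof_eq_of, DirectSum.lof_eq_of, DirectSum.of_eq_of_ne _ _ _ (by omega),
        DirectSum.of_eq_of_ne _ _ _ (by omega), ShiftedHom.comp_zero]
  | add x y hx hy => rw [map_add, DirectSum.add_apply, DirectSum.add_apply, hx, hy,
      ShiftedHom.comp_add]

theorem cohomologyOperator_apply_of_lt (hf : IsCompleteIntersection f R) (C D : Ktac R)
    (l : Fin c) (h : GradedHom C D) {i : ℕ} (hi : i < 2) : cohomologyOperator hf C D l h i = 0 := by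
  induction h using DirectSum.induction_on with
  | zero => rw [map_zero, DirectSum.zero_apply]
  | of j x =>
    rw [← DirectSum.lof_eq_of R, cohomologyOperator_lof, DirectSum.lof_eq_of,
      DirectSum.of_eq_of_ne _ _ _ (by omega)]
  | add x y hx hy => rw [map_add, DirectSum.add_apply, hx, hy, add_zero]

end Action

/-! ### Matrices representing elements of `⨁ Hom(C, Σⁱ D)`. -/

section Related

variable {Q : Type u} [CommRing Q] [IsLocalRing Q] {R : Type u} [CommRing R] [Algebra Q R]
  {c : ℕ} {f : Fin c → Q} {ι κ : Type} [Fintype ι] [DecidableEq ι] [Fintype κ] {deg : ι → ℕ}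
  {F : Matrix ι ι (MvPolynomial (Fin c) Q)} {N : Type u} [AddCommGroup N] [Module R N] [Module Q N]
  [IsScalarTower Q R N] {ν : κ → N} {C D : Ktac R} {π : D.complex.X 0 →ₗ[R] N}
  {θ : ∀ n, C.complex.X n →ₗ[R] (Position c deg n → R)}

/-- The matrix `X` represents the element `h` of `⨁ Hom(C, Σⁱ D)`. -/
def IsRelated (π : D.complex.X 0 →ₗ[R] N) (θ : ∀ n, C.complex.X n →ₗ[R] (Position c deg n → R))
    (ν : κ → N) (h : GradedHom C D) (X : Matrix κ ι (MvPolynomial (Fin c) Q)) : Prop :=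
  ∀ (i : ℕ) (p : ℤ) (hp : p + i = 0),
    Represents C D π i p hp (h i) (rowDegree R deg ν X p ∘ₗ θ p)

theorem IsRelated.add {h h' : GradedHom C D} {X X' : Matrix κ ι (MvPolynomial (Fin c) Q)}
    (H : IsRelated π θ ν h X) (H' : IsRelated π θ ν h' X') :
    IsRelated π θ ν (h + h') (X + X') := fun i p hp => by
  rw [rowDegree_add, LinearMap.add_comp]
  exact (H i p hp).add (H' i p hp)

theorem IsRelated.smul {h : GradedHom C D} {X : Matrix κ ι (MvPolynomial (Fin c) Q)} (q : Q)
    (H : IsRelated π θ ν h X) :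
    IsRelated π θ ν (algebraMap Q R q • h) ((MvPolynomial.C q : MvPolynomial (Fin c) Q) • X) := fun i p hp => by
  rw [rowDegree_C_smul, LinearMap.smul_comp]
  exact (H i p hp).smul _

/-- The comparison map carries the Eisenbud operator to contraction with `χₗ` up to coboundaries,
and contraction followed by the functionals of `X` gives those of `χₗ X`. In degrees below two both
sides vanish. -/
theorem IsRelated.operator (hf : IsCompleteIntersection f R)
    (hF : IsMatrixFactorization deg (potential f) F) (hθ : IsChainFamily F C.complex θ)
    {h : GradedHom C D} {X : Matrix κ ι (MvPolynomial (Fin c) Q)} (H : IsRelated π θ ν h X)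
    (hX : IsNull ν (X * F)) (l : Fin c) :
    IsRelated π θ ν (cohomologyOperator hf C D l h)
      ((MvPolynomial.X l : MvPolynomial (Fin c) Q) • X) := by
  intro j p hp
  rw [rowDegree_X_smul]
  by_cases hj : j < 2
  · rw [cohomologyOperator_apply_of_lt hf C D l h hj, rowDegree_eq_zero_of_pos X (by omega)]
    exact Represents.zero _ _ _
  · obtain ⟨i, rfl⟩ : ∃ i, j = i + 2 := ⟨j - 2, by omega⟩
    rw [cohomologyOperator_apply_add_two]
    obtain ⟨τ, hτ⟩ := exists_isEisenbudFamily hf C.property.free C.property.finite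
    refine ((H i (p + 2) (by push_cast at hp; omega)).eisenbudOperator_comp hf hτ l).congr ?_
    have h1 := hθ.operator hf hF hτ l p (rowDegree R deg ν X (p + 2))
      ((isNull_mul_iff hF.isHomogeneousOfDegree X).1 hX _ _ (by ring))
    convert h1.neg using 1
    rw [neg_sub]
    rfl

theorem IsRelated.action (hf : IsCompleteIntersection f R)
    (hF : IsMatrixFactorization deg (potential f) F) (hθ : IsChainFamily F C.complex θ)
    {h : GradedHom C D} {X : Matrix κ ι (MvPolynomial (Fin c) Q)} (H : IsRelated π θ ν h X)
    (hX : IsNull ν (X * F)) (p : MvPolynomial (Fin c) Q) :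
    IsRelated π θ ν (gradedHomAction hf C D (MvPolynomial.map (algebraMap Q R) p) h) (p • X) ∧
      IsNull ν (p • X * F) := by
  refine ⟨?_, hX.smul_mul p⟩
  induction p using MvPolynomial.induction_on with
  | C q =>
    rw [MvPolynomial.map_C, gradedHomAction_C]
    exact H.smul q
  | add p q hp hq =>
    rw [map_add, map_add, add_smul]
    exact hp.add hq
  | mul_X p l hp =>
    rw [map_mul, MvPolynomial.map_X, mul_comm, map_mul, gradedHomAction_X, mul_comm p, mul_smul]
    exact hp.operator hf hF hθ (hX.smul_mul p) l

theorem exists_isRelated (hF : IsMatrixFactorization deg (potential f) F)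
    (hθ : IsChainFamily F C.complex θ) (hπ : Function.Surjective π)
    (hπ' : Function.Exact (D.complex.d (-1) 0).hom π) (X : Matrix κ ι (MvPolynomial (Fin c) Q))
    (hX : IsNull ν (X * F)) : ∃ h : GradedHom C D, IsRelated π θ ν h X := by
  obtain ⟨B, hB⟩ := exists_forall_rowDegree_eq_zero (R := R) (deg := deg) (ν := ν) X
  have key : ∀ i : ℕ, ∃ h : ShiftedHom C.obj D.obj (i : ℤ),
      (B < i → h = 0) ∧ ∀ (p : ℤ) (hp : p + i = 0),
        Represents C D π i p hp h (rowDegree R deg ν X p ∘ₗ θ p) := by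
    intro i
    by_cases hi : B < i
    · refine ⟨0, fun _ => rfl, fun p hp => ?_⟩
      rw [hB p (by omega)]
      exact Represents.zero _ _ _
    · obtain ⟨h, hh⟩ := exists_represents (C := C) hπ hπ' (m := -(i : ℤ) - 1)
        (p := -(i : ℤ)) (neg_add_cancel _) (sub_add_cancel _ _)
        (rowDegree R deg ν X (-(i : ℤ)) ∘ₗ θ (-(i : ℤ))) (fun x => by
          rw [LinearMap.comp_apply, ← hθ _ _ (sub_add_cancel _ _)]
          exact (isNull_mul_iff hF.isHomogeneousOfDegree X).1 hX _ _ (sub_add_cancel _ _) _)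
      refine ⟨h, fun h0 => absurd h0 hi, fun p hp => ?_⟩
      obtain rfl : p = -(i : ℤ) := by omega
      exact hh
  choose h hh0 hh using key
  refine ⟨∑ i ∈ Finset.range (B + 1), DirectSum.lof R ℕ _ i (h i), fun i p hp => ?_⟩
  have e : (∑ i ∈ Finset.range (B + 1), DirectSum.lof R ℕ
      (fun i => ShiftedHom C.obj D.obj (i : ℤ)) i (h i)) i = h i := by
    rw [DFinsupp.finsetSum_apply]
    by_cases hi : i ≤ B
    · rw [Finset.sum_eq_single i]
      · exact DirectSum.lof_apply (M := fun i : ℕ => ShiftedHom C.obj D.obj (i : ℤ)) R i (h i)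
      · intro j _ hj
        exact DirectSum.of_eq_of_ne _ _ _ (Ne.symm hj)
      · intro h0
        exact absurd (Finset.mem_range.2 (by omega)) h0
    · rw [hh0 i (by omega)]
      refine Finset.sum_eq_zero fun j hj => DirectSum.of_eq_of_ne _ _ _ ?_
      have := Finset.mem_range.1 hj
      omega
  rw [e]
  exact hh i p hp

end Related

/-! ### Models: `⨁ Hom(C, Σⁱ D)` against morphisms of matrix factorizations. -/

section Models

variable {Q : Type u} [CommRing Q] [IsLocalRing Q] {R : Type u} [CommRing R] [Algebra Q R]
  {c : ℕ} {f : Fin c → Q}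

/-- A matrix factorization of `∑ fₗ χₗ` extending a finite free resolution over `Q` of the
cokernel of the differential `C⁻¹ → C⁰`, with comparison maps. -/
structure Model (hf : IsCompleteIntersection f R) (C : Ktac R) where
  N : Type u
  [addCommGroup : AddCommGroup N]
  [module : Module R N]
  [moduleBase : Module Q N]
  [isScalarTower : IsScalarTower Q R N]
  π : C.complex.X 0 →ₗ[R] N
  surjective : Function.Surjective π
  exact : Function.Exact (C.complex.d (-1) 0).hom π
  ι : Type
  [fintype : Fintype ι]
  [decidableEq : DecidableEq ι]
  deg : ι → ℕ
  matrix : Matrix ι ι (MvPolynomial (Fin c) Q)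
  ε : ι → N
  isMatrixFactorization : IsMatrixFactorization deg (potential f) matrix
  isFreeResolution : IsFreeResolution deg (coeffMatrix 0 matrix) ε
  θ : ∀ n, C.complex.X n →ₗ[R] (Position c deg n → R)
  isChainFamily : IsChainFamily matrix C.complex θ
  exists_cocycle : ∀ (N : Type u) [AddCommGroup N] [Module R N] (q p : ℤ) (_ : q + 1 = p)
    (_ : p < 0) (g : C.complex.X p →ₗ[R] N), (∀ x, g ((C.complex.d q p).hom x) = 0) →
    ∃ g' : (Position c deg p → R) →ₗ[R] N, (∀ z, g' (contractDegree R deg matrix q p z) = 0) ∧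
      IsCoboundary C.complex p (g - g' ∘ₗ θ p)
  exists_coboundary : ∀ (N : Type u) [AddCommGroup N] [Module R N] (q p r : ℤ) (_ : q + 1 = p)
    (_ : p + 1 = r) (_ : p < 0) (g : (Position c deg p → R) →ₗ[R] N),
    (∀ z, g (contractDegree R deg matrix q p z) = 0) → IsCoboundary C.complex p (g ∘ₗ θ p) →
    ∃ v : (Position c deg r → R) →ₗ[R] N, ∀ z, g z = v (contractDegree R deg matrix p r z)

attribute [instance] Model.addCommGroup Model.module Model.moduleBase Model.isScalarTower
  Model.fintype Model.decidableEq

theorem Model.exists_model {Q : Type u} [CommRing Q] [IsRegularLocalRing Q] {R : Type u}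
    [CommRing R] [Algebra Q R] {c : ℕ} {f : Fin c → Q} (hf : IsCompleteIntersection f R)
    (C : Ktac R) : Nonempty (Model hf C) := by
  let N := C.complex.X 0 ⧸ LinearMap.range (C.complex.d (-1) 0).hom
  let : Module Q N := Module.compHom N (algebraMap Q R)
  have : IsScalarTower Q R N := ⟨fun q r n => by
    rw [Algebra.smul_def, mul_smul]; rfl⟩
  have := C.property.finite 0
  have : Module.Finite Q R := Module.Finite.of_surjective (Algebra.linearMap Q R) hf.surjective
  have : Module.Finite Q N := Module.Finite.trans R N
  have hsurj : Function.Surjective (LinearMap.range (C.complex.d (-1) 0).hom).mkQ :=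
    Submodule.mkQ_surjective _
  have hex : Function.Exact (C.complex.d (-1) 0).hom
      (LinearMap.range (C.complex.d (-1) 0).hom).mkQ := LinearMap.exact_map_mkQ_range _
  obtain ⟨ι, _, _, deg, d, ε, h⟩ := hasFiniteFreeResolution (Q := Q) N
  obtain ⟨F, hF, rfl⟩ := h.exists_matrixFactorization f (fun l m => by
    rw [← algebraMap_smul R (f l) m, hf.algebraMap_eq_zero, zero_smul])
  obtain ⟨θ, hθ, hA, hB⟩ := exists_comparison hf hF h (C.property.isResolution hsurj hex)
  exact ⟨{ N := N, π := _, surjective := hsurj, exact := hex, ι := ι, deg := deg, matrix := F,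
           ε := ε, isMatrixFactorization := hF, isFreeResolution := h, θ := θ, isChainFamily := hθ,
           exists_cocycle := hA, exists_coboundary := hB }⟩

variable {hf : IsCompleteIntersection f R} {C D : Ktac R} (M : Model hf C) (M' : Model hf D)

/-- The matrix `X` represents the element `h` of `⨁ Hom(C, Σⁱ D)`. -/
def Model.Related (h : GradedHom C D)
    (X : Matrix M'.ι M.ι (MvPolynomial (Fin c) Q)) : Prop :=
  IsRelated M'.π M.θ M'.ε h X

variable {M M'}

theorem Model.Related.congr {h : GradedHom C D} {X X' : Matrix M'.ι M.ι (MvPolynomial (Fin c) Q)}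
    (H : M.Related M' h X) (hX : IsNull M'.ε (X' - X)) : M.Related M' h X' := fun i p hp => by
  have := (isNull_iff_rowDegree (R := R) (deg := M.deg) _).1 hX p
  rw [rowDegree_sub, sub_eq_zero] at this
  rw [this]
  exact H i p hp

/-- Cocycles on `C` come from the contraction complex only in negative degrees, which is why the
component of `h` in degree zero has to vanish. Elements of the form `χₗ h` satisfy this. -/
theorem Model.exists_matrix (h : GradedHom C D) (h0 : h 0 = 0) :
    ∃ X : Matrix M'.ι M.ι (MvPolynomial (Fin c) Q), IsNull M'.ε (X * M.matrix) ∧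
      rowDegree R M.deg M'.ε X 0 = 0 ∧ M.Related M' h X := by
  classical
  have key : ∀ i : ℕ, ∃ g : (Position c M.deg (-(i : ℤ)) → R) →ₗ[R] M'.N,
      (h i = 0 → g = 0) ∧ (∀ q, q + 1 = -(i : ℤ) →
        ∀ z, g (contractDegree R M.deg M.matrix q _ z) = 0) ∧
      Represents C D M'.π i (-(i : ℤ)) (neg_add_cancel _) (h i) (g ∘ₗ M.θ _) := by
    intro i
    by_cases hi : h i = 0
    · refine ⟨0, fun _ => rfl, fun _ _ _ => rfl, ?_⟩
      rw [hi]
      exact Represents.zero _ _ _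
    · obtain ⟨g, hg, hrep⟩ := exists_represents' (C := C) M'.exact (neg_add_cancel (i : ℤ))
        (sub_add_cancel _ 1) (h i)
      have hi0 : i ≠ 0 := by rintro rfl; exact hi h0
      obtain ⟨g', hg', hgg⟩ := M.exists_cocycle M'.N _ _ (sub_add_cancel _ 1) (by omega) g hg
      refine ⟨g', fun h1 => absurd h1 hi, fun q hq => ?_, hrep.congr hgg⟩
      obtain rfl : q = -(i : ℤ) - 1 := by omega
      exact hg'
  choose g hg0 hg hrep using key
  -- This reindexes by integers the functionals so far indexed by natural numbers, with zero in
  -- positive degrees.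
  have key2 : ∀ n : ℤ, ∃ g' : (Position c M.deg n → R) →ₗ[R] M'.N, ∀ (i : ℕ) (hi : n = -(i : ℤ)),
      hi ▸ g' = g i := by
    intro n
    by_cases hn : n ≤ 0
    · obtain ⟨i, rfl⟩ : ∃ i : ℕ, n = -(i : ℤ) := ⟨(-n).toNat, by omega⟩
      refine ⟨g i, fun j hj => ?_⟩
      obtain rfl : i = j := by omega
      rfl
    · exact ⟨0, fun i hi => by omega⟩
  choose g' hg' using key2
  have hg'' : ∀ i : ℕ, g' (-(i : ℤ)) = g i := fun i => hg' _ i rfl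
  obtain ⟨X, hX⟩ := exists_rowDegree_eq_family (R := R) (deg := M.deg)
    M'.isFreeResolution.span_eps g' (h.support.sup id) (fun n hn => by
      obtain ⟨i, rfl⟩ : ∃ i : ℕ, n = -(i : ℤ) := ⟨(-n).toNat, by omega⟩
      rw [hg'']
      refine hg0 i ?_
      by_contra h1
      have : i ≤ h.support.sup id := Finset.le_sup (f := id) (DFinsupp.mem_support_iff.2 h1)
      omega)
  refine ⟨X, (isNull_mul_iff (R := R) (N := M'.N) M.isMatrixFactorization.isHomogeneousOfDegree X).2
    fun n n' hn z => ?_, ?_, fun i p hp => ?_⟩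
  · by_cases hn' : 0 < n'
    · rw [rowDegree_eq_zero_of_pos X hn']
      rfl
    · obtain ⟨i, rfl⟩ : ∃ i : ℕ, n' = -(i : ℤ) := ⟨(-n').toNat, by omega⟩
      rw [hX, hg'']
      exact hg i n hn z
  · refine (hX 0).trans ((hg'' 0).trans (hg0 0 h0))
  · obtain rfl : p = -(i : ℤ) := by omega
    rw [hX, hg'']
    exact hrep i

/-- In each negative degree the functional is a coboundary on `C`, hence on the contraction complex.
Degree zero is out of reach of that comparison and is covered by `h0`; positive degrees are empty.
-/
theorem Model.Related.exists_isNull {X : Matrix M'.ι M.ι (MvPolynomial (Fin c) Q)}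
    (H : M.Related M' 0 X) (hX : IsNull M'.ε (X * M.matrix))
    (h0 : rowDegree R M.deg M'.ε X 0 = 0) :
    ∃ U : Matrix M'.ι M.ι (MvPolynomial (Fin c) Q), IsNull M'.ε (X - U * M.matrix) := by
  obtain ⟨B, hB⟩ := exists_forall_rowDegree_eq_zero (R := R) (deg := M.deg) (ν := M'.ε) X
  have key : ∀ r : ℤ, ∃ v : (Position c M.deg r → R) →ₗ[R] M'.N, (r < -(B : ℤ) → v = 0) ∧
      ∀ p, p + 1 = r → ∀ z, rowDegree R M.deg M'.ε X p z =
        v (contractDegree R M.deg M.matrix p r z) := by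
    intro r
    by_cases hr : r < -(B : ℤ)
    · refine ⟨0, fun _ => rfl, fun p hp z => ?_⟩
      rw [hB p (by omega)]
      rfl
    · by_cases hr' : 1 ≤ r
      · refine ⟨0, fun _ => rfl, fun p hp z => ?_⟩
        by_cases hp0 : p = 0
        · subst hp0
          rw [h0]
          rfl
        · rw [rowDegree_eq_zero_of_pos X (by omega)]
          rfl
      · obtain ⟨i, hi⟩ : ∃ i : ℕ, (r - 1) + (i : ℤ) = 0 := ⟨(1 - r).toNat, by omega⟩
        obtain ⟨v, hv⟩ := M.exists_coboundary M'.N (r - 1 - 1) (r - 1) r (by ring) (by ring)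
          (by omega) (rowDegree R M.deg M'.ε X (r - 1))
          ((isNull_mul_iff M.isMatrixFactorization.isHomogeneousOfDegree X).1 hX _ _ (by ring))
          ((H i _ hi).isCoboundary M'.exact)
        refine ⟨v, fun h1 => absurd h1 hr, fun p hp => ?_⟩
        obtain rfl : p = r - 1 := by omega
        exact hv
  choose v hv0 hv using key
  obtain ⟨U, hU⟩ := exists_rowDegree_eq_family (R := R) (deg := M.deg)
    M'.isFreeResolution.span_eps v B hv0
  refine ⟨U, (isNull_iff_rowDegree (R := R) (deg := M.deg) _).2 fun n => LinearMap.ext fun z => ?_⟩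
  rw [rowDegree_sub, LinearMap.sub_apply,
    rowDegree_mul U M.isMatrixFactorization.isHomogeneousOfDegree rfl, hU, hv _ n rfl, sub_self]
  rfl

theorem Model.Related.eq_zero {h : GradedHom C D} {X U : Matrix M'.ι M.ι (MvPolynomial (Fin c) Q)}
    (H : M.Related M' h X) (hX : IsNull M'.ε (X - U * M.matrix)) : h = 0 := by
  refine DFinsupp.ext fun i => ?_
  refine (H i (-(i : ℤ)) (neg_add_cancel _)).eq_zero M'.surjective M'.exact
    ⟨-(i : ℤ) + 1, rfl, rowDegree R M.deg M'.ε U (-(i : ℤ) + 1) ∘ₗ M.θ _, fun x => ?_⟩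
  have h1 := LinearMap.congr_fun ((isNull_iff_rowDegree (R := R) (deg := M.deg) _).1 hX (-(i : ℤ)))
    (M.θ _ x)
  rw [rowDegree_sub, LinearMap.sub_apply, LinearMap.zero_apply, sub_eq_zero,
    rowDegree_mul U M.isMatrixFactorization.isHomogeneousOfDegree rfl,
    M.isChainFamily _ _ rfl] at h1
  exact h1

/-- The functional of `χₗ X` in degree zero is that of `X` in degree two, where there are no
positions. Multiplying by a variable thus secures the hypothesis on degree zero. -/
theorem rowDegree_X_smul_zero {ι κ : Type} [Fintype ι] [DecidableEq ι] [Fintype κ] {deg : ι → ℕ}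
    {N : Type u} [AddCommGroup N] [Module R N] [Module Q N] [IsScalarTower Q R N] (ν : κ → N)
    (X : Matrix κ ι (MvPolynomial (Fin c) Q)) (l : Fin c) :
    rowDegree R deg ν ((MvPolynomial.X l : MvPolynomial (Fin c) Q) • X) 0 = 0 := by
  rw [rowDegree_X_smul, rowDegree_eq_zero_of_pos X (by norm_num), LinearMap.zero_comp]

variable (M M')

/-- The morphisms of degree `s = ±1` between the matrix factorizations of two models. -/
def Model.cocycles (s : ℤ) : Submodule (MvPolynomial (Fin c) Q)
    (Matrix M'.ι M.ι (MvPolynomial (Fin c) Q)) where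
  carrier := {X | M'.matrix * X = s • (X * M.matrix)}
  add_mem' {X Y} hX hY := by
    change _ = _ at hX hY ⊢
    rw [Matrix.mul_add, hX, hY, Matrix.add_mul, smul_add]
  zero_mem' := by simp
  smul_mem' a X hX := by
    change _ = _ at hX ⊢
    rw [Matrix.mul_smul, hX, Matrix.smul_mul, smul_comm]

/-- The null-homotopic morphisms between the matrix factorizations of two models. -/
def Model.coboundaries (s : ℤ) : Submodule (MvPolynomial (Fin c) Q)
    (Matrix M'.ι M.ι (MvPolynomial (Fin c) Q)) where
  carrier := {X | ∃ Y : Matrix M'.ι M.ι (MvPolynomial (Fin c) Q), X = M'.matrix * Y + s • (Y * M.matrix)}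
  add_mem' := by
    rintro _ _ ⟨Y, rfl⟩ ⟨Z, rfl⟩
    exact ⟨Y + Z, by rw [Matrix.mul_add, Matrix.add_mul, smul_add]; abel⟩
  zero_mem' := ⟨0, by simp⟩
  smul_mem' := by
    rintro a _ ⟨Y, rfl⟩
    exact ⟨a • Y, by rw [Matrix.mul_smul, Matrix.smul_mul, smul_add, smul_comm]⟩

variable {M M'}

theorem Model.isNull_of_mem_cocycles {s : ℤ} (hs : s * s = 1)
    {X : Matrix M'.ι M.ι (MvPolynomial (Fin c) Q)} (hX : X ∈ M.cocycles M' s) :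
    IsNull M'.ε (X * M.matrix) := by
  have h : M'.matrix * X = s • (X * M.matrix) := hX
  have := (M'.isFreeResolution.isNull_mul M'.isMatrixFactorization X).zsmul s
  rwa [h, smul_smul, hs, one_smul] at this

/-- For `y = r h` with `r` in the maximal ideal, `χₗ h` is represented by a genuine morphism of sign
`s`, and a lift of `r` to `Q` is placed in front of it. -/
theorem Model.exists_mem_smul_cocycles [IsLocalRing R] {s : ℤ} (hs : s * s = 1) (l : Fin c)
    {y : GradedHom C D}
    (hy : y ∈ IsLocalRing.maximalIdeal R • (⊤ : Submodule R (GradedHom C D))) :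
    ∃ X ∈ (IsLocalRing.maximalIdeal Q).map (MvPolynomial.C (σ := Fin c)) • M.cocycles M' s,
      M.Related M' (cohomologyOperator hf C D l y) X ∧ rowDegree R M.deg M'.ε X 0 = 0 := by
  induction hy using Submodule.smul_induction_on' with
  | smul r hr h _ =>
    obtain ⟨q, rfl⟩ := hf.surjective r
    have hq : q ∈ IsLocalRing.maximalIdeal Q := fun hu => hr (hu.map _)
    obtain ⟨X₀, hX₀, h0, H⟩ := Model.exists_matrix (M := M) (M' := M')
      (cohomologyOperator hf C D l h) (cohomologyOperator_apply_of_lt hf C D l h (by norm_num))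
    obtain ⟨X, hX, hXX⟩ := M'.isFreeResolution.exists_lift M'.isMatrixFactorization
      M.isMatrixFactorization.sq hs X₀ hX₀
    have hr0 : rowDegree R M.deg M'.ε X 0 = 0 := by
      have h1 := (isNull_iff_rowDegree (R := R) (deg := M.deg) _).1 hXX 0
      rwa [rowDegree_sub, h0, sub_zero] at h1
    refine ⟨(MvPolynomial.C q : MvPolynomial (Fin c) Q) • X,
      Submodule.smul_mem_smul (Ideal.mem_map_of_mem _ hq) hX, ?_, ?_⟩
    · rw [map_smul]
      exact IsRelated.smul q (H.congr hXX)
    · rw [rowDegree_C_smul, hr0, smul_zero]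
  | add x _ y _ hx hy =>
    obtain ⟨X, hX, H, h0⟩ := hx
    obtain ⟨Y, hY, H', h0'⟩ := hy
    refine ⟨X + Y, add_mem hX hY, ?_, ?_⟩
    · rw [map_add]
      exact IsRelated.add H H'
    · rw [rowDegree_add, h0, h0', add_zero]

/-- If `φ` maps `⨁ Hom(C, Σⁱ D)` to its product with the maximal ideal, then `χₗ φ` maps morphisms of
matrix factorizations to combinations with coefficients in the maximal ideal, up to homotopy. -/
theorem Model.smul_mem [IsLocalRing R] {s : ℤ} (hs : s * s = 1) (l : Fin c)
    {φ : MvPolynomial (Fin c) Q} (hφ : ∀ h : GradedHom C D,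
      gradedHomAction hf C D (MvPolynomial.map (algebraMap Q R) φ) h ∈
        IsLocalRing.maximalIdeal R • (⊤ : Submodule R (GradedHom C D)))
    {X : Matrix M'.ι M.ι (MvPolynomial (Fin c) Q)} (hX : X ∈ M.cocycles M' s) :
    (MvPolynomial.X l * φ) • X ∈
      (IsLocalRing.maximalIdeal Q).map (MvPolynomial.C (σ := Fin c)) • M.cocycles M' s ⊔
        M.coboundaries M' s := by
  have hXn := Model.isNull_of_mem_cocycles hs hX
  obtain ⟨h, H⟩ := exists_isRelated M.isMatrixFactorization M.isChainFamily M'.surjective M'.exact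
    X hXn
  have H1 := H.action hf M.isMatrixFactorization M.isChainFamily hXn (MvPolynomial.X l * φ)
  obtain ⟨X', hX', H', h0'⟩ := Model.exists_mem_smul_cocycles (M := M) (M' := M') hs l (hφ h)
  have hX'Z : X' ∈ M.cocycles M' s := Submodule.smul_le_right hX'
  have e : gradedHomAction hf C D (MvPolynomial.map (algebraMap Q R) (MvPolynomial.X l * φ)) h =
      cohomologyOperator hf C D l
        (gradedHomAction hf C D (MvPolynomial.map (algebraMap Q R) φ) h) := by
    rw [map_mul, MvPolynomial.map_X, map_mul, gradedHomAction_X]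
    rfl
  -- Both terms represent the same class, so the difference is a morphism representing zero, with no
  -- functional in degree zero, and is null-homotopic.
  have hsub : (MvPolynomial.X l * φ) • X - X' ∈ M.cocycles M' s :=
    sub_mem (Submodule.smul_mem _ _ hX) hX'Z
  have H2 : M.Related M' 0 ((MvPolynomial.X l * φ) • X - X') := by
    have h1 := IsRelated.add H1.1 (IsRelated.smul (-1) H')
    rw [map_neg, map_one, map_neg, map_one, neg_smul, neg_smul, one_smul, one_smul, e,
      add_neg_cancel, ← sub_eq_add_neg] at h1
    exact h1
  obtain ⟨U, hU⟩ := H2.exists_isNull (Model.isNull_of_mem_cocycles hs hsub) (by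
    rw [rowDegree_sub, h0', mul_smul, rowDegree_X_smul_zero, sub_zero])
  obtain ⟨Y, hY⟩ := M'.isFreeResolution.exists_homotopy_of_isNull M'.isMatrixFactorization
    M.isMatrixFactorization.sq hs _ U hsub hU
  rw [← add_sub_cancel X' ((MvPolynomial.X l * φ) • X)]
  exact Submodule.add_mem_sup hX' ⟨Y, hY⟩

/-- If `ψ` annihilates morphisms of matrix factorizations up to homotopy, then `χₗ ψ` annihilates
`⨁ Hom(C, Σⁱ D)`. -/
theorem Model.action_eq_zero (l : Fin c) {ψ : MvPolynomial (Fin c) Q}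
    (hψ : ∀ X : Matrix M'.ι M.ι (MvPolynomial (Fin c) Q), IsNull M'.ε (X * M.matrix) →
      ∃ U : Matrix M'.ι M.ι (MvPolynomial (Fin c) Q), IsNull M'.ε (ψ • X - U * M.matrix)) (h : GradedHom C D) :
    gradedHomAction hf C D (MvPolynomial.map (algebraMap Q R) (MvPolynomial.X l * ψ)) h = 0 := by
  obtain ⟨X, hX, -, H⟩ := Model.exists_matrix (M := M) (M' := M')
    (cohomologyOperator hf C D l h) (cohomologyOperator_apply_of_lt hf C D l h (by norm_num))
  obtain ⟨U, hU⟩ := hψ X hX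
  have H1 := (IsRelated.action hf M.isMatrixFactorization M.isChainFamily H hX ψ).1
  have := Model.Related.eq_zero H1 hU
  rw [← this, mul_comm, map_mul, MvPolynomial.map_X, map_mul, gradedHomAction_X]
  rfl

end Models

/-! ### Annihilation up to homotopy under reduction modulo regular elements. -/

section Transfer

variable {ι κ : Type} [Fintype ι] [Fintype κ]

/-- Multiplication by `ψ` annihilates, up to homotopy, the even and odd morphisms from the
factorization `E` to the factorization `D`. -/
def Annihilates {B : Type*} [CommRing B] (D : Matrix κ κ B) (E : Matrix ι ι B) (ψ : B) : Prop :=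
  ∀ s : ℤ, s * s = 1 → ∀ X : Matrix κ ι B, D * X = s • (X * E) →
    ∃ Y : Matrix κ ι B, ψ • X = D * Y + s • (Y * E)

theorem exists_matrix_map_eq {B B' : Type*} [CommRing B] [CommRing B'] {σ : B →+* B'}
    (hσ : Function.Surjective σ) (X : Matrix κ ι B') : ∃ Y : Matrix κ ι B, Y.map σ = X := by
  choose y hy using fun k i => hσ (X k i)
  exact ⟨Matrix.of y, Matrix.ext fun k i => hy k i⟩

theorem matrix_map_mul_add_smul {B B' : Type*} [CommRing B] [CommRing B'] (σ : B →+* B')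
    (D : Matrix κ κ B) (E : Matrix ι ι B) (Y : Matrix κ ι B) (s : ℤ) :
    (D * Y + s • (Y * E)).map σ = D.map σ * Y.map σ + s • (Y.map σ * E.map σ) := by
  rw [Matrix.map_add σ (map_add σ), Matrix.map_mul, Matrix.map_smul σ s (fun _ => map_zsmul σ _ _),
    Matrix.map_mul]

theorem matrix_map_smul' {B B' : Type*} [CommRing B] [CommRing B'] (σ : B →+* B')
    (ψ : B) (Y : Matrix κ ι B) : (ψ • Y).map σ = σ ψ • Y.map σ := by
  ext; simp

/-- A morphism modulo `r` lifts to a matrix `X` whose boundary is `r T'`, and `T'` is a morphism of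
opposite sign because `r` is regular. If `Y` is a homotopy for `ψ T'`, then `ψ X - r Y` is a
morphism that still reduces to `ψ X`; a second factor `ψ` makes it null-homotopic. -/
theorem Annihilates.map_of_regular [DecidableEq ι] [DecidableEq κ] {B B' : Type*} [CommRing B]
    [CommRing B'] {D : Matrix κ κ B}
    {E : Matrix ι ι B} {ψ W : B} (h : Annihilates D E ψ) (hD : D * D = W • 1) (hE : E * E = W • 1)
    {σ : B →+* B'} (hσ : Function.Surjective σ) {r : B} (hr : ∀ x, r * x = 0 → x = 0)
    (hr0 : σ r = 0) (hker : ∀ x, σ x = 0 → r ∣ x) :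
    Annihilates (D.map σ) (E.map σ) (σ ψ ^ 2) := by
  intro s hs X hX
  obtain ⟨X, rfl⟩ := exists_matrix_map_eq hσ X
  have h1 : ∀ k i, r ∣ (D * X + (-s) • (X * E)) k i := fun k i => hker _ <| by
    have := matrix_map_mul_add_smul σ D E X (-s)
    rw [hX, neg_smul s (X.map σ * E.map σ), add_neg_cancel] at this
    exact congrFun (congrFun this k) i
  choose T hT using h1
  let T' : Matrix κ ι B := Matrix.of T
  have hT' : D * X + (-s) • (X * E) = r • T' := Matrix.ext hT
  have hs' : -s * -s = 1 := by rw [neg_mul_neg, hs]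
  have h2 : D * T' = (-s) • (T' * E) := by
    have := mul_coboundary hD hE hs' X
    rw [hT', Matrix.mul_smul, Matrix.smul_mul, smul_comm (-s) r, ← sub_eq_zero, ← smul_sub] at this
    rw [← sub_eq_zero]
    ext k i
    exact hr _ (congrFun (congrFun this k) i)
  obtain ⟨Y, hY⟩ := h (-s) hs' T' h2
  have h3 : D * (ψ • X - r • Y) = s • ((ψ • X - r • Y) * E) := by
    rw [← sub_eq_zero]
    have e : D * (ψ • X - r • Y) - s • ((ψ • X - r • Y) * E) =
        ψ • (D * X + (-s) • (X * E)) - r • (D * Y + (-s) • (Y * E)) := by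
      simp only [Matrix.mul_sub, Matrix.sub_mul, Matrix.mul_smul, Matrix.smul_mul, smul_add,
        smul_sub, neg_smul, smul_neg, smul_comm s]
      abel
    rw [e, hT', ← hY, smul_comm, sub_self]
  obtain ⟨Z, hZ⟩ := h s hs _ h3
  refine ⟨Z.map σ, ?_⟩
  rw [← matrix_map_mul_add_smul, ← hZ, matrix_map_smul', Matrix.map_sub σ (map_sub σ),
    matrix_map_smul', matrix_map_smul', hr0, zero_smul, sub_zero, smul_smul, sq]

theorem map_mul_self [DecidableEq ι] {B B' : Type*} [CommRing B]
    [CommRing B'] (σ : B →+* B') {E : Matrix ι ι B} {W : B} (hE : E * E = W • 1) :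
    E.map σ * E.map σ = σ W • 1 := by
  rw [← Matrix.map_mul, hE, matrix_map_smul', Matrix.map_one σ (map_zero σ) (map_one σ)]

theorem Annihilates.map_of_injective {B B' : Type*} [CommRing B] [CommRing B'] {D : Matrix κ κ B}
    {E : Matrix ι ι B} {ψ : B} (h : Annihilates D E ψ) {σ : B →+* B'}
    (hσ : Function.Surjective σ) (hσ' : Function.Injective σ) :
    Annihilates (D.map σ) (E.map σ) (σ ψ) := by
  intro s hs X hX
  obtain ⟨X, rfl⟩ := exists_matrix_map_eq hσ X
  obtain ⟨Y, hY⟩ := h s hs X (by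
    have := matrix_map_mul_add_smul σ D E X (-s)
    rw [hX, neg_smul s (X.map σ * E.map σ), add_neg_cancel] at this
    rw [← sub_eq_zero, sub_eq_add_neg, ← neg_smul]
    ext k i
    exact hσ' ((congrFun (congrFun this k) i).trans (map_zero σ).symm))
  exact ⟨Y.map σ, by rw [← matrix_map_mul_add_smul, ← hY, matrix_map_smul']⟩

/-- The variables are specialized one at a time: evaluation of the first one at `b 0` is reduction
modulo the monic, hence regular, element `X - b 0`. The exponent doubles with each variable. -/
theorem Annihilates.exists_map_eval [DecidableEq ι] [DecidableEq κ] {Q : Type*} [CommRing Q] :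
    ∀ {c : ℕ} {D : Matrix κ κ (MvPolynomial (Fin c) Q)} {E : Matrix ι ι (MvPolynomial (Fin c) Q)}
      {ψ W : MvPolynomial (Fin c) Q} (_ : Annihilates D E ψ) (_ : D * D = W • 1)
      (_ : E * E = W • 1) (b : Fin c → Q),
      ∃ m : ℕ, Annihilates (D.map (MvPolynomial.eval b)) (E.map (MvPolynomial.eval b))
        (MvPolynomial.eval b ψ ^ m)
  | 0, D, E, ψ, W, h, hD, hE, b => by
    refine ⟨1, ?_⟩
    rw [pow_one]
    refine h.map_of_injective (fun q => ⟨MvPolynomial.C q, MvPolynomial.eval_C q⟩) ?_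
    intro x y hxy
    rw [MvPolynomial.eq_C_of_isEmpty x, MvPolynomial.eq_C_of_isEmpty y] at hxy ⊢
    rw [MvPolynomial.eval_C, MvPolynomial.eval_C] at hxy
    rw [hxy]
  | c + 1, D, E, ψ, W, h, hD, hE, b => by
    let e := MvPolynomial.finSuccEquiv Q c
    let σ : MvPolynomial (Fin (c + 1)) Q →+* MvPolynomial (Fin c) Q :=
      (Polynomial.evalRingHom (MvPolynomial.C (b 0))).comp (e : _ →+* _)
    have hσ : ∀ x, σ x = Polynomial.eval (MvPolynomial.C (b 0)) (e x) := fun _ => rfl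
    have hσb : ∀ x, MvPolynomial.eval (fun i => b i.succ) (σ x) = MvPolynomial.eval b x := by
      intro x
      have : (MvPolynomial.eval (fun i => b i.succ)).comp σ = MvPolynomial.eval b := by
        refine MvPolynomial.ringHom_ext (fun q => ?_) (fun i => ?_)
        · simp [hσ, e, MvPolynomial.finSuccEquiv_apply]
        · rw [RingHom.comp_apply, hσ]
          refine Fin.cases ?_ (fun j => ?_) i
          · simp [e, MvPolynomial.finSuccEquiv_X_zero]
          · simp [e, MvPolynomial.finSuccEquiv_X_succ]
      exact RingHom.congr_fun this x
    have key := h.map_of_regular hD hE (σ := σ)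
      (fun p => ⟨e.symm (Polynomial.C p), by rw [hσ, AlgEquiv.apply_symm_apply, Polynomial.eval_C]⟩)
      (r := e.symm (Polynomial.X - Polynomial.C (MvPolynomial.C (b 0)))) (fun x hx => by
        have h1 : (Polynomial.X - Polynomial.C (MvPolynomial.C (b 0))) * e x = 0 := by
          rw [← map_zero e, ← hx, map_mul, AlgEquiv.apply_symm_apply]
        have h2 := (Polynomial.monic_X_sub_C (MvPolynomial.C (b 0) : MvPolynomial (Fin c) Q))
        have h3 := h2.mul_right_eq_zero_iff.1 h1
        rwa [map_eq_zero_iff e e.injective] at h3)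
      (by rw [hσ, AlgEquiv.apply_symm_apply]; simp)
      (fun x hx => by
        obtain ⟨y, hy⟩ := Polynomial.dvd_iff_isRoot.2 hx
        exact ⟨e.symm y, by rw [← map_mul, ← hy]; exact (e.symm_apply_apply x).symm⟩)
    obtain ⟨m, hm⟩ := key.exists_map_eval (map_mul_self σ hD) (map_mul_self σ hE)
      (fun i => b i.succ)
    refine ⟨2 * m, ?_⟩
    have hmat : ∀ {τ : Type} (D : Matrix τ τ (MvPolynomial (Fin (c + 1)) Q)),
        (D.map σ).map (MvPolynomial.eval fun i => b i.succ) = D.map (MvPolynomial.eval b) :=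
      fun D => Matrix.ext fun i j => hσb _
    rw [hmat, hmat, map_pow, hσb, ← pow_mul] at hm
    exact hm

-- The same descent along a weakly regular sequence, dividing by its first element and doubling the
-- exponent each time.
open RingTheory.Sequence in
theorem Annihilates.exists_map_of_isWeaklyRegular [DecidableEq ι] [DecidableEq κ] {K : Type u}
    [CommRing K] : ∀ (n : ℕ) {B : Type u} [CommRing B] (rs : List B), rs.length = n →
      IsWeaklyRegular B rs → ∀ {D : Matrix κ κ B} {E : Matrix ι ι B}
      {ψ W : B} (_ : Annihilates D E ψ) (_ : D * D = W • 1) (_ : E * E = W • 1) (σ : B →+* K)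
      (_ : Function.Surjective σ) (_ : RingHom.ker σ = Ideal.ofList rs),
      ∃ m : ℕ, Annihilates (D.map σ) (E.map σ) (σ ψ ^ m)
  | 0, B, _, rs, hn, hrs, D, E, ψ, W, h, hD, hE, σ, hσ, hker => by
    rw [List.length_eq_zero_iff] at hn
    subst hn
    refine ⟨1, ?_⟩
    rw [pow_one]
    refine h.map_of_injective hσ ((RingHom.injective_iff_ker_eq_bot σ).2 ?_)
    rw [hker, Ideal.ofList_nil]
  | n + 1, B, _, [], hn, hrs, D, E, ψ, W, h, hD, hE, σ, hσ, hker => by simp at hn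
  | n + 1, B, _, r :: rs, hn, hrs, D, E, ψ, W, h, hD, hE, σ, hσ, hker => by
    obtain ⟨hr, hrs'⟩ := (isWeaklyRegular_cons_iff' B r rs).1 hrs
    have hle : Ideal.span {r} ≤ RingHom.ker σ := by
      rw [hker, Ideal.ofList_cons]
      exact le_sup_left
    let σ' : B ⧸ Ideal.span {r} →+* K := Ideal.Quotient.lift _ σ fun x hx => hle hx
    have hσ' : ∀ x, σ' (Ideal.Quotient.mk _ x) = σ x := fun _ => rfl
    have h1 := h.map_of_regular hD hE (σ := Ideal.Quotient.mk (Ideal.span {r}))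
      Ideal.Quotient.mk_surjective (r := r) (fun x hx => hr (by simpa using hx))
      (Ideal.Quotient.eq_zero_iff_mem.2 (Ideal.mem_span_singleton_self r))
      (fun x hx => Ideal.mem_span_singleton.1 (Ideal.Quotient.eq_zero_iff_mem.1 hx))
    have hrs'' : IsWeaklyRegular (B ⧸ Ideal.span {r}) (rs.map (Ideal.Quotient.mk (Ideal.span {r}))) := by
      rw [isWeaklyRegular_cons_iff] at hrs
      refine (isWeaklyRegular_map_algebraMap_iff (B ⧸ Ideal.span {r}) (B ⧸ Ideal.span {r}) rs).2 ?_
      refine (LinearEquiv.isWeaklyRegular_congr (Submodule.quotEquivOfEq _ _ ?_) rs).1 hrs.2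
      ext x
      rw [Submodule.mem_smul_pointwise_iff_exists, Ideal.mem_span_singleton']
      exact ⟨fun ⟨y, _, hy⟩ => ⟨y, by rw [← hy, smul_eq_mul, mul_comm]⟩,
        fun ⟨y, hy⟩ => ⟨y, trivial, by rw [← hy, smul_eq_mul, mul_comm]⟩⟩
    obtain ⟨m, hm⟩ := h1.exists_map_of_isWeaklyRegular n _ (by simpa using hn) hrs''
      (map_mul_self _ hD) (map_mul_self _ hE) σ' (Ideal.Quotient.lift_surjective_of_surjective _ _ hσ)
      (by
        ext x
        obtain ⟨x, rfl⟩ := Ideal.Quotient.mk_surjective x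
        rw [RingHom.mem_ker, hσ', ← RingHom.mem_ker, hker, Ideal.ofList_cons, ← Ideal.map_ofList,
          ← Ideal.mem_comap, Ideal.comap_map_of_surjective _ Ideal.Quotient.mk_surjective,
          ← RingHom.ker_eq_comap_bot, Ideal.mk_ker, sup_comm])
    refine ⟨2 * m, ?_⟩
    rw [map_pow, hσ', ← pow_mul] at hm
    exact hm

end Transfer

/-! ### Contractible matrices over a field, and spreading out a contraction. -/

section Contractible

variable {ι κ : Type} [Fintype ι] [Fintype κ] [DecidableEq ι] [DecidableEq κ] {k : Type*}

/-- A square matrix with a contracting homotopy. -/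
def IsContractible [CommRing k] (D : Matrix ι ι k) : Prop := ∃ h : Matrix ι ι k, D * h + h * D = 1

/-- Over a field `D` is split onto its image; extending the section gives `G` with `D G D = D`. Thus
`D G` is the identity on the image of `D`, which by exactness contains the image of `1 - G D`. -/
theorem IsContractible.of_exact [Field k] {D : Matrix ι ι k} (hD : D * D = 0)
    (h : ∀ v, D.mulVec v = 0 → ∃ w, D.mulVec w = v) : IsContractible D := by
  let L := D.mulVecLin
  obtain ⟨s, hs⟩ := L.rangeRestrict.exists_rightInverse_of_surjective L.range_rangeRestrict
  obtain ⟨g, hg⟩ := LinearMap.exists_extend s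
  let G := LinearMap.toMatrix' g
  have hG : ∀ v, G.mulVec v = g v := fun v => by
    rw [← Matrix.toLin'_apply, Matrix.toLin'_toMatrix']
  have h1 : ∀ v, D.mulVec (G.mulVec (D.mulVec v)) = D.mulVec v := by
    intro v
    have e1 : g (L v) = s (L.rangeRestrict v) := LinearMap.congr_fun hg (L.rangeRestrict v)
    have e2 := congrArg Subtype.val (LinearMap.congr_fun hs (L.rangeRestrict v))
    rw [hG]
    exact (congrArg L e1).trans e2
  have h2 : D * G * D = D := by
    refine Matrix.toLin'.injective (LinearMap.ext fun v => ?_)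
    rw [Matrix.toLin'_apply, Matrix.toLin'_apply, ← Matrix.mulVec_mulVec, ← Matrix.mulVec_mulVec, h1]
  have h3 : D * G * (1 - G * D) = 1 - G * D := by
    refine Matrix.toLin'.injective (LinearMap.ext fun v => ?_)
    obtain ⟨w, hw⟩ := h ((1 - G * D).mulVec v) (by
      rw [Matrix.mulVec_mulVec, Matrix.mul_sub, ← Matrix.mul_assoc, h2, Matrix.mul_one, sub_self,
        Matrix.zero_mulVec])
    rw [Matrix.toLin'_apply, Matrix.toLin'_apply, ← Matrix.mulVec_mulVec, ← hw,
      Matrix.mulVec_mulVec, h2]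
  -- The factor `1 - G D` makes `D h` equal to `1 - G D`, and `D² = 0` reduces `h D` to `G D`.
  refine ⟨G * (1 - G * D), ?_⟩
  rw [← Matrix.mul_assoc, h3, Matrix.mul_assoc G, Matrix.sub_mul, Matrix.mul_assoc G D D, hD,
    Matrix.mul_zero, sub_zero, Matrix.one_mul, sub_add_cancel]

theorem exists_functional [Field k] {D : Matrix ι ι k} (hD : D * D = 0)
    (h : ¬ IsContractible D) : ∃ v a : ι → k, D.mulVec v = 0 ∧ Matrix.vecMul a D = 0 ∧
      dotProduct a v = 1 := by
  have : ∃ v, D.mulVec v = 0 ∧ ¬ ∃ w, D.mulVec w = v := by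
    by_contra h0
    push Not at h0
    exact h (.of_exact hD h0)
  obtain ⟨v, hv, hv'⟩ := this
  obtain ⟨φ, hφ, hφ'⟩ := Submodule.exists_le_ker_of_notMem (p := LinearMap.range D.mulVecLin)
    (v := v) (fun ⟨w, hw⟩ => hv' ⟨w, hw⟩)
  have hdot : ∀ w, dotProduct (fun i => φ (Pi.single i 1)) w = φ w := fun w => by
    conv_rhs => rw [pi_eq_sum_univ' w]
    simp [dotProduct, mul_comm]
  refine ⟨v, (φ v)⁻¹ • fun i => φ (Pi.single i 1), hv, ?_, ?_⟩
  · refine dotProduct_eq _ _ fun w => ?_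
    rw [← Matrix.dotProduct_mulVec, smul_dotProduct, hdot, zero_dotProduct]
    rw [show φ (D.mulVec w) = 0 from hφ' ⟨w, rfl⟩, smul_zero]
  · rw [smul_dotProduct, hdot, smul_eq_mul, inv_mul_cancel₀ hφ]

/-- A Künneth argument. If neither matrix were contractible, a cycle `v` of `D` and a cocycle `e` of
`E`, detected by a cocycle `a` and a cycle `w`, would give the morphism `v eᵗ`. Pairing a homotopy
for `ψ v eᵗ` with `a` and `w` yields `ψ = 0`. -/
theorem Annihilates.isContractible_or [Field k] {D : Matrix κ κ k} {E : Matrix ι ι k} {ψ : k}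
    (h : Annihilates D E ψ) (hψ : ψ ≠ 0) (hD : D * D = 0) (hE : E * E = 0) :
    IsContractible D ∨ IsContractible E := by
  by_contra! h0
  obtain ⟨v, a, hv, ha, hav⟩ := exists_functional hD h0.1
  obtain ⟨w, e, hw, he, hew⟩ := exists_functional hE h0.2
  obtain ⟨Y, hY⟩ := h 1 (by norm_num) (Matrix.vecMulVec v e) (by
    rw [Matrix.mul_vecMulVec, hv, Matrix.vecMulVec_mul, he, one_smul]
    ext
    simp [Matrix.vecMulVec_apply])
  refine hψ ?_
  have h1 := congrArg (fun X : Matrix κ ι k => dotProduct a (X.mulVec w)) hY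
  simp only [one_smul, Matrix.add_mulVec, dotProduct_add, Matrix.smul_mulVec, dotProduct_smul] at h1
  rw [← Matrix.mulVec_mulVec, ← Matrix.mulVec_mulVec, hw, Matrix.mulVec_zero, dotProduct_zero,
    Matrix.dotProduct_mulVec a D, ha, zero_dotProduct, Matrix.vecMulVec_mulVec, hew] at h1
  simpa [hav] using h1

/-- A contraction at a point spreads out. -/
theorem IsContractible.exists_homotopy {B : Type*} [CommRing B] {K : Type*} [CommRing K]
    {D : Matrix ι ι B} {W : B} (hD : D * D = W • 1) {σ : B →+* K} (hσ : Function.Surjective σ)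
    (h : IsContractible (D.map σ)) (hB : IsDomain B) [Nontrivial K] :
    ∃ (ψ : B) (Y : Matrix ι ι B), σ ψ = 1 ∧ D * Y + Y * D = ψ • 1 := by
  obtain ⟨h, hh⟩ := h
  obtain ⟨h, rfl⟩ := exists_matrix_map_eq hσ h
  let U := D * h + h * D
  have hU : U.map σ = 1 := by
    rw [Matrix.map_add σ (map_add σ), Matrix.map_mul, Matrix.map_mul, hh]
  have hdet : σ U.det = 1 := by
    rw [RingHom.map_det, RingHom.mapMatrix_apply, hU, Matrix.det_one]
  have hcomm : D * U = U * D := by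
    rw [Matrix.mul_add, Matrix.add_mul, ← Matrix.mul_assoc, hD, Matrix.mul_assoc h, hD,
      Matrix.smul_mul, Matrix.mul_smul, Matrix.one_mul, Matrix.mul_one, add_comm, Matrix.mul_assoc]
  -- `U` commutes with `D` because `D²` is scalar; the adjugate then does so after multiplication by
  -- `det U`, which is nonzero since it maps to `1`, and the ring is a domain.
  have hadj : D * U.adjugate = U.adjugate * D := by
    have h0 : U.det ≠ 0 := fun h0 => by rw [h0, map_zero] at hdet; exact zero_ne_one hdet
    have h1 : U.det • (D * U.adjugate - U.adjugate * D) = 0 := by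
      have : U.det • (D * U.adjugate - U.adjugate * D) =
          U.adjugate * (U * D) * U.adjugate - U.adjugate * (D * U) * U.adjugate := by
        rw [← Matrix.mul_assoc, Matrix.adjugate_mul, Matrix.mul_assoc U.adjugate,
          Matrix.mul_assoc D U, Matrix.mul_adjugate]
        simp [smul_sub]
      rw [this, hcomm, sub_self]
    exact sub_eq_zero.1 ((smul_eq_zero.1 h1).resolve_left h0)
  refine ⟨U.det, U.adjugate * h, hdet, ?_⟩
  rw [← Matrix.mul_assoc, hadj, Matrix.mul_assoc, Matrix.mul_assoc, ← Matrix.mul_add,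
    Matrix.adjugate_mul]

end Contractible

/-! ### Evaluation at points over the residue field. -/

section Evaluation

variable (Q : Type u) [CommRing Q] {R : Type u} [CommRing R] [IsLocalRing R] [Algebra Q R] {c : ℕ}

/-- The evaluation of polynomials over `Q` at a point of `k^c`. -/
noncomputable def evalAt (b : Fin c → IsLocalRing.ResidueField R) :
    MvPolynomial (Fin c) Q →+* IsLocalRing.ResidueField R :=
  MvPolynomial.eval₂Hom ((IsLocalRing.residue R).comp (algebraMap Q R)) b

variable {Q}

theorem eval_map_residue (b : Fin c → IsLocalRing.ResidueField R) (p : MvPolynomial (Fin c) Q) :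
    MvPolynomial.eval b (MvPolynomial.map (IsLocalRing.residue R)
      (MvPolynomial.map (algebraMap Q R) p)) = evalAt Q b p := by
  rw [MvPolynomial.map_map, MvPolynomial.eval_map]
  rfl

theorem evalAt_eval (b : Fin c → Q) (p : MvPolynomial (Fin c) Q) :
    evalAt Q (fun i => IsLocalRing.residue R (algebraMap Q R (b i))) p =
      IsLocalRing.residue R (algebraMap Q R (MvPolynomial.eval b p)) := by
  have : evalAt Q (fun i => IsLocalRing.residue R (algebraMap Q R (b i))) =
      ((IsLocalRing.residue R).comp (algebraMap Q R)).comp (MvPolynomial.eval b) :=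
    MvPolynomial.ringHom_ext (fun q => by simp [evalAt]) (fun i => by simp [evalAt])
  exact RingHom.congr_fun this p

variable [IsLocalRing Q] {f : Fin c → Q}

theorem IsCompleteIntersection.residue_surjective (hf : IsCompleteIntersection f R) :
    Function.Surjective ((IsLocalRing.residue R).comp (algebraMap Q R)) :=
  (IsLocalRing.residue_surjective (R := R)).comp hf.surjective

theorem IsCompleteIntersection.ker_residue (hf : IsCompleteIntersection f R) :
    RingHom.ker ((IsLocalRing.residue R).comp (algebraMap Q R)) = IsLocalRing.maximalIdeal Q := by
  have := RingHom.ker_isMaximal_of_surjective _ hf.residue_surjective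
  exact IsLocalRing.eq_maximalIdeal this

theorem IsCompleteIntersection.evalAt_surjective (hf : IsCompleteIntersection f R)
    (b : Fin c → IsLocalRing.ResidueField R) : Function.Surjective (evalAt Q b) := fun x => by
  obtain ⟨q, rfl⟩ := hf.residue_surjective x
  exact ⟨MvPolynomial.C q, by simp [evalAt]⟩

theorem IsCompleteIntersection.evalAt_potential (hf : IsCompleteIntersection f R)
    (b : Fin c → IsLocalRing.ResidueField R) : evalAt Q b (potential f) = 0 := by
  simp [evalAt, potential, hf.algebraMap_eq_zero]

theorem polynomialAction_map (hf : IsCompleteIntersection f R) (C D : Ktac R)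
    (p : MvPolynomial (Fin c) R) :
    polynomialAction hf C D (MvPolynomial.map (IsLocalRing.residue R) p) =
      (gradedHomAction hf C D p).baseChange (IsLocalRing.ResidueField R) := by
  induction p using MvPolynomial.induction_on with
  | C r =>
    rw [MvPolynomial.map_C, ← MvPolynomial.algebraMap_eq, AlgHom.commutes,
      ← MvPolynomial.algebraMap_eq, AlgHom.commutes]
    refine TensorProduct.AlgebraTensorModule.ext fun a x => ?_
    rw [Module.algebraMap_end_apply, LinearMap.baseChange_tmul, Module.algebraMap_end_apply,
      ← TensorProduct.smul_tmul, TensorProduct.smul_tmul']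
    rfl
  | add p q hp hq => rw [map_add, map_add, hp, hq, map_add, LinearMap.baseChange_add]
  | mul_X p l hp =>
    rw [map_mul, MvPolynomial.map_X, map_mul, hp, polynomialAction_X, map_mul, gradedHomAction_X,
      LinearMap.baseChange_mul, reducedOperator]

theorem one_tmul_eq_zero_iff {H : Type u} [AddCommGroup H] [Module R H] (h : H) :
    (1 : IsLocalRing.ResidueField R) ⊗ₜ[R] h = 0 ↔
      h ∈ IsLocalRing.maximalIdeal R • (⊤ : Submodule R H) := by
  rw [← Submodule.Quotient.mk_eq_zero]
  have := TensorProduct.quotTensorEquivQuotSMul_mk_tmul (IsLocalRing.maximalIdeal R) 1 h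
  rw [one_smul] at this
  rw [← this]
  exact (LinearEquiv.map_eq_zero_iff _).symm

end Evaluation

/-! ### The contractibility criterion for the support variety. -/

section Main

/-- If an element `a` maps `Z` to `J Z + B`, then some `ψ ≡ aⁿ` modulo `J` maps `Z` to `B`. -/
theorem exists_smul_mem {A V k : Type*} [CommRing A] [AddCommGroup V] [Module A V] [Field k]
    (Z B : Submodule A V) [Module.Finite A Z] (J : Ideal A) (a : A)
    (h : ∀ x ∈ Z, a • x ∈ J • Z ⊔ B) (σ : A →+* k) (hσ : ∀ x ∈ J, σ x = 0) (ha : σ a ≠ 0) :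
    ∃ ψ : A, σ ψ ≠ 0 ∧ ∀ x ∈ Z, ψ • x ∈ B := by
  let B' : Submodule A Z := B.comap Z.subtype
  -- Cayley–Hamilton for `a` acting on `Z` modulo its intersection with `B`, which it maps into `J`
  -- times itself: a monic polynomial with lower coefficients in `J` vanishes at `a`. Its value at
  -- `a` in the ring is `ψ`.
  obtain ⟨p, hp, -, hpJ, hp0⟩ :=
    LinearMap.exists_monic_and_natDegree_eq_and_coeff_mem_pow_and_aeval_eq_zero A
      (a • LinearMap.id : Module.End A (Z ⧸ B')) J (by
        rintro _ ⟨y, rfl⟩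
        obtain ⟨⟨x, hx⟩, rfl⟩ := Submodule.Quotient.mk_surjective _ y
        obtain ⟨z, hz, w, hw, hzw⟩ := Submodule.mem_sup.1 (h x hx)
        have hz' : (⟨z, Submodule.smul_le_right hz⟩ : Z) ∈ J • (⊤ : Submodule A Z) := by
          have h1 : z ∈ (J • (⊤ : Submodule A Z)).map Z.subtype := by
            rwa [Submodule.map_smul'', Submodule.map_subtype_top]
          obtain ⟨z', hz', rfl⟩ := h1
          exact hz'
        have h2 : Submodule.Quotient.mk (⟨z, Submodule.smul_le_right hz⟩ : Z) ∈
            J • (⊤ : Submodule A (Z ⧸ B')) := by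
          have := Submodule.mem_map_of_mem (f := B'.mkQ) hz'
          rw [Submodule.map_smul''] at this
          exact Submodule.smul_mono le_rfl le_top this
        have h3 : a • (Submodule.Quotient.mk (⟨x, hx⟩ : Z) : Z ⧸ B') =
            Submodule.Quotient.mk (⟨z, Submodule.smul_le_right hz⟩ : Z) := by
          rw [← Submodule.Quotient.mk_smul, Submodule.Quotient.eq]
          change a • x - z ∈ B
          rwa [← hzw, add_sub_cancel_left]
        rw [LinearMap.smul_apply, LinearMap.id_apply, h3]
        exact h2)
  refine ⟨p.eval a, ?_, fun x hx => ?_⟩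
  · have : p.map σ = Polynomial.X ^ p.natDegree := by
      ext i
      rw [Polynomial.coeff_map, Polynomial.coeff_X_pow]
      split_ifs with hi
      · rw [hi, hp.coeff_natDegree, map_one]
      · by_cases hi' : p.natDegree < i
        · rw [Polynomial.coeff_eq_zero_of_natDegree_lt hi', map_zero]
        · exact hσ _ (Ideal.pow_le_self (by omega) (hpJ i))
    rw [← Polynomial.eval₂_hom, ← Polynomial.eval_map, this, Polynomial.eval_pow, Polynomial.eval_X]
    exact pow_ne_zero _ ha
  · have h1 : Polynomial.aeval (a • LinearMap.id : Module.End A (Z ⧸ B')) p =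
        p.eval a • LinearMap.id := by
      have : (a • LinearMap.id : Module.End A (Z ⧸ B')) = algebraMap A _ a := rfl
      rw [this, Polynomial.aeval_algebraMap_apply,
        Polynomial.coe_aeval_eq_eval]
      rfl
    have h2 := LinearMap.congr_fun (h1.symm.trans hp0) (Submodule.Quotient.mk ⟨x, hx⟩)
    rw [LinearMap.smul_apply, LinearMap.id_apply, LinearMap.zero_apply,
      ← Submodule.Quotient.mk_smul, Submodule.Quotient.mk_eq_zero] at h2
    exact h2

variable {Q : Type u} [CommRing Q] [IsRegularLocalRing Q] {R : Type u} [CommRing R] [IsLocalRing R]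
  [Algebra Q R] {c : ℕ} {f : Fin c → Q} {hf : IsCompleteIntersection f R} {C D : Ktac R}
  (M : Model hf C) (M' : Model hf D) {b : Fin c → IsLocalRing.ResidueField R}

/-- The reduction of the matrix factorization of a model at the point `b` is contractible. -/
def Model.ContractibleAt {Q : Type u} [CommRing Q] [IsLocalRing Q] {R : Type u} [CommRing R]
    [IsLocalRing R] [Algebra Q R] {c : ℕ} {f : Fin c → Q} {hf : IsCompleteIntersection f R}
    {C : Ktac R} (M : Model hf C) (b : Fin c → IsLocalRing.ResidueField R) : Prop :=
  IsContractible (M.matrix.map (evalAt Q b))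

theorem exists_apply_ne_zero (hb : b ≠ 0) : ∃ l, b l ≠ 0 := by
  by_contra! h
  exact hb (funext h)

/-- A polynomial killing `E` and nonzero at `b` maps `⨁ Hom(C, Σⁱ D)` into `𝔪` times itself.
Multiplied by a variable nonzero at `b`, it acts likewise on morphisms of matrix factorizations up
to homotopy, and the determinant trick applies. Each sign has its own `ψ`; their product serves
both. -/
theorem Model.exists_annihilates (hb : b ≠ 0) (h : b ∉ supportVariety hf C D) :
    ∃ ψ : MvPolynomial (Fin c) Q, evalAt Q b ψ ≠ 0 ∧ Annihilates M'.matrix M.matrix ψ := by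
  obtain ⟨l, hl⟩ := exists_apply_ne_zero hb
  rw [supportVariety, Set.mem_union, not_or, Set.mem_ofPred_eq] at h
  have h1 := h.1
  push Not at h1
  obtain ⟨φ, hφ, hφb⟩ := h1
  obtain ⟨φ, rfl⟩ := MvPolynomial.map_surjective _ (IsLocalRing.residue_surjective (R := R)) φ
  obtain ⟨φ, rfl⟩ := MvPolynomial.map_surjective _ hf.surjective φ
  rw [eval_map_residue] at hφb
  have hφ' : ∀ h : GradedHom C D,
      gradedHomAction hf C D (MvPolynomial.map (algebraMap Q R) φ) h ∈
        IsLocalRing.maximalIdeal R • (⊤ : Submodule R (GradedHom C D)) := by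
    intro h
    rw [← one_tmul_eq_zero_iff, ← LinearMap.baseChange_tmul, ← polynomialAction_map,
      RingHom.mem_ker.1 hφ, LinearMap.zero_apply]
  have key : ∀ s : ℤ, s * s = 1 → ∃ ψ : MvPolynomial (Fin c) Q, evalAt Q b ψ ≠ 0 ∧
      ∀ X ∈ M.cocycles M' s, ψ • X ∈ M.coboundaries M' s := by
    intro s hs
    refine exists_smul_mem _ _ ((IsLocalRing.maximalIdeal Q).map (MvPolynomial.C (σ := Fin c)))
      (MvPolynomial.X l * φ) (fun X hX => Model.smul_mem hs l hφ' hX) (evalAt Q b) ?_ ?_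
    · intro x hx
      refine (Ideal.map_le_iff_le_comap.2 ?_ : _ ≤ RingHom.ker (evalAt Q b)) hx
      intro q hq
      rw [← hf.ker_residue] at hq
      rw [Ideal.mem_comap, RingHom.mem_ker, evalAt, MvPolynomial.coe_eval₂Hom, MvPolynomial.eval₂_C]
      exact hq
    · rw [map_mul]
      refine mul_ne_zero ?_ hφb
      rw [evalAt, MvPolynomial.coe_eval₂Hom, MvPolynomial.eval₂_X]
      exact hl
  obtain ⟨ψ, hψ, H⟩ := key 1 (by norm_num)
  obtain ⟨ψ', hψ', H'⟩ := key (-1) (by norm_num)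
  refine ⟨ψ * ψ', by rw [map_mul]; exact mul_ne_zero hψ hψ', fun s hs X hX => ?_⟩
  rcases mul_self_eq_one_iff.1 hs with rfl | rfl
  · rw [mul_comm, mul_smul]
    exact Submodule.smul_mem _ ψ' (H X hX)
  · rw [mul_smul]
    exact Submodule.smul_mem _ ψ (H' X hX)

/-- The annihilation is specialized first in the variables, at a lift of `b` to `Q`, and then along
a regular sequence generating `𝔪`; the result lives over the residue field, where `W` becomes zero.
-/
theorem Model.contractibleAt_or (hb : b ≠ 0) (h : b ∉ supportVariety hf C D) :
    M.ContractibleAt b ∨ M'.ContractibleAt b := by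
  obtain ⟨ψ, hψ, H⟩ := Model.exists_annihilates M M' hb h
  obtain ⟨-, rs, hrs, hrs'⟩ := isDomain_and_exists_isWeaklyRegular Q
  choose b' hb' using fun i => hf.residue_surjective (b i)
  obtain rfl : (fun i => IsLocalRing.residue R (algebraMap Q R (b' i))) = b := funext hb'
  have hD := M'.isMatrixFactorization.sq
  have hE := M.isMatrixFactorization.sq
  obtain ⟨m, hm⟩ := H.exists_map_eval hD hE b'
  obtain ⟨m', hm'⟩ := hm.exists_map_of_isWeaklyRegular _ rs rfl hrs (map_mul_self _ hD)
    (map_mul_self _ hE) _ hf.residue_surjective (hf.ker_residue.trans hrs'.symm)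
  have hmat : ∀ {τ : Type} (D : Matrix τ τ (MvPolynomial (Fin c) Q)),
      (D.map (MvPolynomial.eval b')).map ((IsLocalRing.residue R).comp (algebraMap Q R)) =
        D.map (evalAt Q fun i => IsLocalRing.residue R (algebraMap Q R (b' i))) :=
    fun D => Matrix.ext fun i j => (evalAt_eval b' _).symm
  rw [hmat, hmat] at hm'
  refine (hm'.isContractible_or ?_ ?_ ?_).symm
  · refine pow_ne_zero _ ?_
    rw [map_pow]
    refine pow_ne_zero _ ?_
    rw [evalAt_eval] at hψ
    exact hψ
  · rw [map_mul_self _ hD, hf.evalAt_potential, zero_smul]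
  · rw [map_mul_self _ hE, hf.evalAt_potential, zero_smul]

variable {M M'}

theorem Model.ContractibleAt.exists_homotopy (h : M.ContractibleAt b) :
    ∃ (ψ : MvPolynomial (Fin c) Q) (Y : Matrix M.ι M.ι (MvPolynomial (Fin c) Q)),
      evalAt Q b ψ = 1 ∧ M.matrix * Y + Y * M.matrix = ψ • 1 := by
  have := (isDomain_and_exists_isWeaklyRegular Q).1
  exact IsContractible.exists_homotopy M.isMatrixFactorization.sq (hf.evalAt_surjective b) h
    inferInstance

/-- A homotopy `Y` from `ψ • 1` to zero, on either factorization, is composed with any morphism and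
shows that `ψ` annihilates it. The extra variable `χₗ`, nonzero at `b`, again takes care of degree
zero. -/
theorem Model.exists_action_eq_zero (hb : b ≠ 0) (h : M.ContractibleAt b ∨ M'.ContractibleAt b) :
    ∃ ψ : MvPolynomial (Fin c) Q, evalAt Q b ψ ≠ 0 ∧
      gradedHomAction hf C D (MvPolynomial.map (algebraMap Q R) ψ) = 0 := by
  obtain ⟨l, hl⟩ := exists_apply_ne_zero hb
  have key : ∃ ψ : MvPolynomial (Fin c) Q, evalAt Q b ψ = 1 ∧
      ∀ X : Matrix M'.ι M.ι (MvPolynomial (Fin c) Q), IsNull M'.ε (X * M.matrix) →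
        ∃ U : Matrix M'.ι M.ι (MvPolynomial (Fin c) Q), IsNull M'.ε (ψ • X - U * M.matrix) := by
    rcases h with h | h
    · obtain ⟨ψ, Y, hψ, hY⟩ := h.exists_homotopy
      refine ⟨ψ, hψ, fun X hX => ⟨X * Y, ?_⟩⟩
      have e : ψ • X - X * Y * M.matrix = X * M.matrix * Y := by
        rw [sub_eq_iff_eq_add, Matrix.mul_assoc, Matrix.mul_assoc, ← Matrix.mul_add, hY,
          Matrix.mul_smul, Matrix.mul_one]
      rw [e]
      exact hX.mul Y
    · obtain ⟨ψ, Y, hψ, hY⟩ := h.exists_homotopy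
      refine ⟨ψ, hψ, fun X₀ hX₀ => ?_⟩
      obtain ⟨X, hX, hXX⟩ := M'.isFreeResolution.exists_lift M'.isMatrixFactorization
        M.isMatrixFactorization.sq (s := 1) (by norm_num) X₀ hX₀
      rw [one_smul] at hX
      refine ⟨Y * X, ?_⟩
      -- The homotopy acts on the left and needs a genuine morphism `X` lifting `X₀`; both terms on
      -- the right are null.
      have e : ψ • X₀ - Y * X * M.matrix =
          M'.matrix * (Y * X) - (X - X₀) * (ψ • (1 : Matrix M.ι M.ι (MvPolynomial (Fin c) Q))) := by
        have h1 : ψ • X = M'.matrix * (Y * X) + Y * X * M.matrix := by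
          rw [Matrix.mul_assoc, ← hX, ← Matrix.mul_assoc, ← Matrix.mul_assoc, ← Matrix.add_mul, hY,
            Matrix.smul_mul, Matrix.one_mul]
        rw [Matrix.mul_smul, Matrix.mul_one, smul_sub, h1]
        abel
      rw [e]
      exact (M'.isFreeResolution.isNull_mul M'.isMatrixFactorization _).sub (hXX.mul _)
  obtain ⟨ψ, hψ, H⟩ := key
  refine ⟨MvPolynomial.X l * ψ, ?_, LinearMap.ext fun h => Model.action_eq_zero l H h⟩
  rw [map_mul, hψ, mul_one, evalAt, MvPolynomial.coe_eval₂Hom, MvPolynomial.eval₂_X]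
  exact hl

theorem notMem_supportVariety (hb : b ≠ 0) {ψ : MvPolynomial (Fin c) Q} (hψ : evalAt Q b ψ ≠ 0)
    (h : gradedHomAction hf C D (MvPolynomial.map (algebraMap Q R) ψ) = 0) :
    b ∉ supportVariety hf C D := by
  rintro (hb' | hb')
  · refine hψ ?_
    rw [← eval_map_residue]
    refine hb' _ ?_
    rw [RingHom.mem_ker]
    refine (polynomialAction_map hf C D _).trans ?_
    rw [h, LinearMap.baseChange_zero]
  · exact hb hb'

variable (M M')

theorem Model.notMem_supportVariety_iff (hb : b ≠ 0) :
    b ∉ supportVariety hf C D ↔ M.ContractibleAt b ∨ M'.ContractibleAt b :=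
  ⟨Model.contractibleAt_or M M' hb, fun h => by
    obtain ⟨ψ, hψ, H⟩ := Model.exists_action_eq_zero hb h
    exact notMem_supportVariety hb hψ H⟩

variable (hf C D)

/-- Annihilation before reduction to the residue field already detects the support. Triangles need
this form, since tensoring with `k` does not preserve exact sequences. -/
theorem notMem_supportVariety_iff (hb : b ≠ 0) : b ∉ supportVariety hf C D ↔
    ∃ ψ : MvPolynomial (Fin c) Q, evalAt Q b ψ ≠ 0 ∧
      gradedHomAction hf C D (MvPolynomial.map (algebraMap Q R) ψ) = 0 := by
  obtain ⟨M⟩ := Model.exists_model hf C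
  obtain ⟨M'⟩ := Model.exists_model hf D
  exact ⟨fun h => Model.exists_action_eq_zero hb (Model.contractibleAt_or M M' hb h),
    fun ⟨ψ, hψ, h⟩ => notMem_supportVariety hb hψ h⟩

theorem zero_mem_supportVariety : (0 : Fin c → IsLocalRing.ResidueField R) ∈ supportVariety hf C D :=
  Or.inr rfl

theorem supportVariety_eq_inter :
    supportVariety hf C D = supportVariety hf C C ∩ supportVariety hf D D := by
  ext b
  by_cases hb : b = 0
  · subst hb
    exact iff_of_true (zero_mem_supportVariety hf C D)
      ⟨zero_mem_supportVariety hf C C, zero_mem_supportVariety hf D D⟩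
  · obtain ⟨M⟩ := Model.exists_model hf C
    obtain ⟨M'⟩ := Model.exists_model hf D
    rw [← not_iff_not, Set.mem_inter_iff, not_and_or, Model.notMem_supportVariety_iff M M' hb,
      Model.notMem_supportVariety_iff M M hb, Model.notMem_supportVariety_iff M' M' hb, or_self,
      or_self]

theorem supportVariety_comm : supportVariety hf C D = supportVariety hf D C := by
  rw [supportVariety_eq_inter, Set.inter_comm, ← supportVariety_eq_inter]

end Main

open Pretriangulated

/-! ### Postcomposition and the polynomial action. -/

section Postcomposition

variable {R : Type u} [CommRing R]

/-- Postcomposition with a map `D ⟶ Σᵃ D'`. -/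
noncomputable def postcomposition (C : Ktac R) {D D' : Ktac R} (a : ℕ)
    (β : ShiftedHom D.obj D'.obj (a : ℤ)) : GradedHom C D →ₗ[R] GradedHom C D' :=
  DirectSum.toModule R ℕ _ fun i =>
    DirectSum.lof R ℕ (fun i => ShiftedHom C.obj D'.obj (i : ℤ)) (i + a) ∘ₗ
      { toFun := fun α => α.comp β (by push_cast; ring)
        map_add' := fun α β => ShiftedHom.add_comp _ _ _ _
        map_smul' := fun r α => ShiftedHom.smul_comp r _ _ _ }

theorem postcomposition_lof (C : Ktac R) {D D' : Ktac R} (a : ℕ)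
    (β : ShiftedHom D.obj D'.obj (a : ℤ)) (i : ℕ) (α : ShiftedHom C.obj D.obj (i : ℤ)) :
    postcomposition C a β (DirectSum.lof R ℕ (fun i => ShiftedHom C.obj D.obj (i : ℤ)) i α) =
      DirectSum.lof R ℕ (fun i => ShiftedHom C.obj D'.obj (i : ℤ)) (i + a)
        (α.comp β (by push_cast; ring)) := by
  simp [postcomposition]

theorem postcomposition_apply (C : Ktac R) {D D' : Ktac R} (a : ℕ)
    (β : ShiftedHom D.obj D'.obj (a : ℤ)) (h : GradedHom C D) (i : ℕ) :
    postcomposition C a β h (i + a) = (h i).comp β (by push_cast; ring) := by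
  induction h using DirectSum.induction_on with
  | zero => rw [map_zero, DirectSum.zero_apply, DirectSum.zero_apply, ShiftedHom.zero_comp]
  | of j x =>
    rw [← DirectSum.lof_eq_of R, postcomposition_lof]
    by_cases hij : j = i
    · subst hij
      rw [DirectSum.lof_apply, DirectSum.lof_apply]
    · rw [DirectSum.lof_eq_of, DirectSum.lof_eq_of, DirectSum.of_eq_of_ne _ _ _ (by omega),
        DirectSum.of_eq_of_ne _ _ _ (by omega), ShiftedHom.zero_comp]
  | add x y hx hy => rw [map_add, DirectSum.add_apply, DirectSum.add_apply, hx, hy,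
      ShiftedHom.add_comp]

variable {Q : Type u} [CommRing Q] [IsLocalRing Q] [Algebra Q R] {c : ℕ} {f : Fin c → Q}

theorem postcomposition_operator (hf : IsCompleteIntersection f R) (C : Ktac R) {D D' : Ktac R}
    (a : ℕ) (β : ShiftedHom D.obj D'.obj (a : ℤ)) (l : Fin c) (h : GradedHom C D) :
    postcomposition C a β (cohomologyOperator hf C D l h) =
      cohomologyOperator hf C D' l (postcomposition C a β h) := by
  induction h using DirectSum.induction_on with
  | zero => simp
  | of j x =>
    rw [← DirectSum.lof_eq_of R, cohomologyOperator_lof, postcomposition_lof, postcomposition_lof,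
      cohomologyOperator_lof, ShiftedHom.comp_assoc _ _ _ _
        (show (a : ℤ) + j = ((j + a : ℕ) : ℤ) by push_cast; ring) (by push_cast; ring)]
    -- The degrees `j + 2 + a` and `j + a + 2` are equal but not syntactically so.
    have : ∀ {m n : ℕ} (hmn : m = n) (h1 : ((j + a : ℕ) : ℤ) + 2 = m)
        (h2 : ((j + a : ℕ) : ℤ) + 2 = n) (y : ShiftedHom C.obj D'.obj ((j + a : ℕ) : ℤ)),
        DirectSum.lof R ℕ (fun i => ShiftedHom C.obj D'.obj (i : ℤ)) m
          ((eisenbudOperator hf C l).comp y h1) =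
        DirectSum.lof R ℕ (fun i => ShiftedHom C.obj D'.obj (i : ℤ)) n
          ((eisenbudOperator hf C l).comp y h2) := by
      rintro m _ rfl _ _ _
      rfl
    exact this (by ring) _ _ _
  | add x y hx hy => simp only [map_add, hx, hy]

theorem postcomposition_action (hf : IsCompleteIntersection f R) (C : Ktac R) {D D' : Ktac R}
    (a : ℕ) (β : ShiftedHom D.obj D'.obj (a : ℤ)) (p : MvPolynomial (Fin c) R)
    (h : GradedHom C D) :
    postcomposition C a β (gradedHomAction hf C D p h) =
      gradedHomAction hf C D' p (postcomposition C a β h) := by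
  induction p using MvPolynomial.induction_on generalizing h with
  | C r => rw [gradedHomAction_C, gradedHomAction_C, map_smul]
  | add p q hp hq => rw [map_add, map_add, LinearMap.add_apply, LinearMap.add_apply, map_add, hp, hq]
  | mul_X p l hp =>
    rw [map_mul, map_mul, Module.End.mul_apply, Module.End.mul_apply, hp, gradedHomAction_X,
      gradedHomAction_X, postcomposition_operator]

/-- `D ⟶ Σᵃ D' ⟶ Σᵃ⁺ᵉ D''` induces exact sequences of morphisms out of `C`. -/
def IsExactPair (C : Ktac R) {D D' D'' : Ktac R} {a e : ℕ} (β : ShiftedHom D.obj D'.obj (a : ℤ))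
    (γ : ShiftedHom D'.obj D''.obj (e : ℤ)) : Prop :=
  ∀ (i j n : ℕ) (h : i + a = j) (hn : j + e = n) (x : ShiftedHom C.obj D'.obj (j : ℤ)),
    x.comp γ (c := (n : ℤ)) (by omega) = 0 →
    ∃ y : ShiftedHom C.obj D.obj (i : ℤ), y.comp β (by omega) = x

/-- Preimages are chosen degree by degree. Components of degree below `a` would need a source of
negative degree, which the direct sum omits; hence `h0`. -/
theorem IsExactPair.exists_postcomposition {C : Ktac R} {D D' D'' : Ktac R} {a e : ℕ}
    {β : ShiftedHom D.obj D'.obj (a : ℤ)} {γ : ShiftedHom D'.obj D''.obj (e : ℤ)}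
    (H : IsExactPair C β γ) (h : GradedHom C D') (h0 : ∀ i < a, h i = 0)
    (hγ : postcomposition C e γ h = 0) : ∃ y, postcomposition C a β y = h := by
  have key : ∀ i : ℕ, ∃ y : ShiftedHom C.obj D.obj (i : ℤ),
      y.comp β (c := ((i + a : ℕ) : ℤ)) (by omega) = h (i + a) := fun i =>
    H i (i + a) _ rfl rfl _ (by rw [← postcomposition_apply, hγ, DirectSum.zero_apply])
  choose y hy using key
  classical
  refine ⟨∑ i ∈ Finset.range (h.support.sup id + 1), DirectSum.lof R ℕ
    (fun i => ShiftedHom C.obj D.obj (i : ℤ)) i (y i), DFinsupp.ext fun n => ?_⟩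
  rw [map_sum, DFinsupp.finsetSum_apply]
  simp only [postcomposition_lof, hy]
  by_cases hn : n < a
  · rw [h0 n hn]
    exact Finset.sum_eq_zero fun i _ => DirectSum.of_eq_of_ne _ _ _ (by omega)
  · obtain ⟨m, rfl⟩ : ∃ m, n = m + a := ⟨n - a, by omega⟩
    by_cases hm : m ≤ h.support.sup id
    · rw [Finset.sum_eq_single m]
      · exact DirectSum.lof_apply (M := fun i : ℕ => ShiftedHom C.obj D'.obj (i : ℤ)) R (m + a) _
      · intro j _ hj
        exact DirectSum.of_eq_of_ne _ _ _ (by omega)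
      · intro h1
        exact absurd (Finset.mem_range.2 (by omega)) h1
    · have : h (m + a) = 0 := by
        by_contra h1
        have : m + a ≤ h.support.sup id := Finset.le_sup (f := id) (DFinsupp.mem_support_iff.2 h1)
        omega
      rw [this]
      refine Finset.sum_eq_zero fun i hi => DirectSum.of_eq_of_ne _ _ _ ?_
      have := Finset.mem_range.1 hi
      omega

end Postcomposition

/-! ### Exact triangles and support varieties. -/

section Triangles

variable {Q : Type u} [CommRing Q] [IsRegularLocalRing Q] {R : Type u} [CommRing R] [IsLocalRing R]
  [Algebra Q R] {c : ℕ} {f : Fin c → Q} (hf : IsCompleteIntersection f R)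

/-- If `ψ'` kills the third term and `ψ` the first, then `ψ' x` lifts to the first term and `ψ`
kills the lift. The variable `χₗ`, of degree two, removes the components of degree below `a ≤ 2`
that may fail to lift. -/
theorem IsExactPair.supportVariety_subset {C D D' D'' : Ktac R} {a e : ℕ} (ha : a ≤ 2)
    {β : ShiftedHom D.obj D'.obj (a : ℤ)} {γ : ShiftedHom D'.obj D''.obj (e : ℤ)}
    (H : IsExactPair C β γ) :
    supportVariety hf C D' ⊆ supportVariety hf C D ∪ supportVariety hf C D'' := by
  intro b hb'
  by_contra h
  rw [Set.mem_union, not_or] at h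
  have hb : b ≠ 0 := fun hb => h.1 (Or.inr hb)
  obtain ⟨ψ, hψ, h1⟩ := (notMem_supportVariety_iff hf C D hb).1 h.1
  obtain ⟨ψ', hψ', h1'⟩ := (notMem_supportVariety_iff hf C D'' hb).1 h.2
  obtain ⟨l, hl⟩ := exists_apply_ne_zero hb
  refine notMem_supportVariety hb (ψ := MvPolynomial.X l * ψ' * ψ) ?_
    (LinearMap.ext fun x => ?_) hb'
  · rw [map_mul, map_mul]
    refine mul_ne_zero (mul_ne_zero ?_ hψ') hψ
    rw [evalAt, MvPolynomial.coe_eval₂Hom, MvPolynomial.eval₂_X]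
    exact hl
  · rw [mul_comm, map_mul, map_mul, Module.End.mul_apply]
    set z := gradedHomAction hf C D' (MvPolynomial.map (algebraMap Q R) (MvPolynomial.X l * ψ')) x
    have hz : z = cohomologyOperator hf C D' l
        (gradedHomAction hf C D' (MvPolynomial.map (algebraMap Q R) ψ') x) := by
      rw [← gradedHomAction_X, ← Module.End.mul_apply, ← map_mul, ← MvPolynomial.map_X (algebraMap Q R),
        ← map_mul]
    obtain ⟨y, hy⟩ := H.exists_postcomposition z
      (fun i hi => by rw [hz]; exact cohomologyOperator_apply_of_lt hf C D' l _ (by omega)) (by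
        rw [hz, postcomposition_operator, postcomposition_action, h1', LinearMap.zero_apply,
          map_zero])
    rw [← hy, ← postcomposition_action, h1, LinearMap.zero_apply, map_zero, LinearMap.zero_apply]

/-- The three inclusions are the three exact spots of the long exact sequence of `Hom(C, -)`, with
the connecting map counted in degree one. -/
theorem IsExactTriangle.supportVariety_subset {C D D' D'' : Ktac R} (h : IsExactTriangle D D' D'') :
    supportVariety hf C D ⊆ supportVariety hf C D' ∪ supportVariety hf C D'' ∧
    supportVariety hf C D' ⊆ supportVariety hf C D ∪ supportVariety hf C D'' ∧
    supportVariety hf C D'' ⊆ supportVariety hf C D ∪ supportVariety hf C D' := by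
  obtain ⟨α, β, γ, hT⟩ := h
  let F := preadditiveCoyoneda.obj (Opposite.op C.obj)
  let α' : ShiftedHom D.obj D'.obj ((0 : ℕ) : ℤ) := ShiftedHom.mk₀ _ rfl α
  let β' : ShiftedHom D'.obj D''.obj ((0 : ℕ) : ℤ) := ShiftedHom.mk₀ _ rfl β
  let γ' : ShiftedHom D''.obj D.obj ((1 : ℕ) : ℤ) := γ
  have h1 : IsExactPair C γ' α' := by
    rintro i _ _ rfl rfl x hx
    have := F.homologySequence_exact₁ _ hT i ((i + 1 : ℕ) : ℤ) rfl
    rw [ShortComplex.ab_exact_iff] at this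
    obtain ⟨y, hy⟩ := this x ((ShiftedHom.comp_mk₀ x _ rfl α).symm.trans hx)
    refine ⟨y, ?_⟩
    rw [← hy]
    exact (preadditiveCoyoneda_homologySequenceδ_apply (Triangle.mk α β γ) _ _ rfl
      (A := Opposite.op C.obj) y).symm
  have h2 : IsExactPair C α' β' := by
    rintro i _ _ rfl rfl x hx
    have := F.homologySequence_exact₂ _ hT i
    rw [ShortComplex.ab_exact_iff] at this
    obtain ⟨y, hy⟩ := this x ((ShiftedHom.comp_mk₀ x _ rfl β).symm.trans hx)
    exact ⟨y, (ShiftedHom.comp_mk₀ y _ rfl α).trans hy⟩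
  have h3 : IsExactPair C β' γ' := by
    rintro i _ _ rfl rfl x hx
    have := F.homologySequence_exact₃ _ hT i ((i + 1 : ℕ) : ℤ) rfl
    rw [ShortComplex.ab_exact_iff] at this
    obtain ⟨y, hy⟩ := this x ((preadditiveCoyoneda_homologySequenceδ_apply (Triangle.mk α β γ) _ _ rfl
      (A := Opposite.op C.obj) x).trans hx)
    exact ⟨y, (ShiftedHom.comp_mk₀ y _ rfl β).trans hy⟩
  refine ⟨?_, h2.supportVariety_subset hf (by norm_num), ?_⟩
  · rw [Set.union_comm]
    exact h1.supportVariety_subset hf (by norm_num)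
  · rw [Set.union_comm]
    exact h3.supportVariety_subset hf (by norm_num)

/-- Symmetry of the support variety reduces the first variable to the second. -/
theorem IsExactTriangle.supportVariety_subset' {C C' C'' D : Ktac R} (h : IsExactTriangle C C' C'') :
    supportVariety hf C D ⊆ supportVariety hf C' D ∪ supportVariety hf C'' D ∧
    supportVariety hf C' D ⊆ supportVariety hf C D ∪ supportVariety hf C'' D ∧
    supportVariety hf C'' D ⊆ supportVariety hf C D ∪ supportVariety hf C' D := by
  simp only [supportVariety_comm hf _ D]
  exact h.supportVariety_subset hf

end Triangles

open IsLocalRing RingTheory.Sequence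

/-! ### Cones of multiplication by a ring element. -/

section Cone

variable {Q : Type u} [CommRing Q] {ι : Type} [Fintype ι] [DecidableEq ι] {deg : ι → ℕ}

/-- The degrees of the basis of the cone of multiplication by a ring element. -/
def coneDegree (deg : ι → ℕ) : ι ⊕ ι → ℕ := Sum.elim deg fun i => deg i + 1

/-- The mapping cone of a regular element `x` on a resolution of `M` resolves `M/xM`. -/
theorem IsFreeResolution.cone {d : Matrix ι ι Q} {M M' : Type u} [AddCommGroup M]
    [Module Q M] [AddCommGroup M'] [Module Q M'] {ε : ι → M} (h : IsFreeResolution deg d ε) {x : Q}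
    (hx : IsSMulRegular M x) (π : M →ₗ[Q] M') (hπ : Function.Surjective π)
    (hker : ∀ m, π m = 0 ↔ ∃ m', x • m' = m) :
    IsFreeResolution (coneDegree deg) (Matrix.fromBlocks d (x • 1) 0 (-d))
      (Sum.elim (fun i => π (ε i)) 0) where
  homog := by
    rintro (i | i) (j | j) hij
    · exact h.homog i j hij
    · have : i = j := by
        by_contra h0
        exact hij (by simp [h0])
      simp [coneDegree, this]
    · exact (hij rfl).elim
    · have := h.homog i j (fun h0 => hij (by simp [h0]))
      simp [coneDegree, this]
  eps_deg := by
    rintro (i | i) hi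
    · exact h.eps_deg i fun h0 => hi (by simp [h0])
    · exact (hi rfl).elim
  span_eps := by
    rw [eq_top_iff]
    rintro m -
    obtain ⟨m, rfl⟩ := hπ m
    obtain ⟨a, -, rfl⟩ := h.exists_combination m
    rw [map_sum]
    refine sum_mem fun i _ => ?_
    rw [map_smul]
    exact Submodule.smul_mem _ _ (Submodule.subset_span ⟨Sum.inl i, rfl⟩)
  sq := by
    rw [Matrix.fromBlocks_multiply]
    simp [h.sq]
  eps_d := by
    have h1 : ∀ i, x • π (ε i) = 0 := fun i => by
      rw [← map_smul]
      exact (hker _).2 ⟨_, rfl⟩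
    rintro (j | j)
    · have := congrArg π (h.eps_d j)
      simp only [map_sum, map_smul, map_zero] at this
      simpa using this
    · simp [Matrix.one_apply, h1]
  exact := by
    intro v hv hv'
    obtain ⟨v1, v2, rfl⟩ : ∃ v1 v2, v = Sum.elim v1 v2 := ⟨_, _, (Sum.elim_comp_inl_inr v).symm⟩
    simp only [Fintype.sum_sum_type, Sum.elim_inl, Sum.elim_inr, Pi.zero_apply, smul_zero,
      Finset.sum_const_zero, add_zero, ← map_smul, ← map_sum] at hv'
    rw [Matrix.fromBlocks_mulVec] at hv
    simp only [Sum.elim_comp_inl, Sum.elim_comp_inr, Matrix.zero_mulVec, zero_add,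
      Matrix.smul_mulVec, Matrix.one_mulVec] at hv
    have h1 : d.mulVec v1 + x • v2 = 0 := funext fun i => congrFun hv (Sum.inl i)
    have h2 : d.mulVec v2 = 0 := by
      rw [← neg_eq_zero, ← Matrix.neg_mulVec]
      exact funext fun i => congrFun hv (Sum.inr i)
    have hd : ∀ w, ∑ i, d.mulVec w i • ε i = 0 := by
      intro w
      simp only [Matrix.mulVec, dotProduct, Finset.sum_smul, mul_comm (d _ _), mul_smul]
      rw [Finset.sum_comm]
      simp [← Finset.smul_sum, h.eps_d]
    have h3 : ∑ i, v2 i • ε i = 0 := by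
      refine (isSMulRegular_iff_right_eq_zero_of_smul.1 hx) _ ?_
      have : x • v2 = - d.mulVec v1 := by rw [← neg_eq_of_add_eq_zero_right h1]
      have h4 : x • ∑ i, v2 i • ε i = ∑ i, (x • v2) i • ε i := by
        simp [Finset.smul_sum, mul_smul]
      rw [h4, this]
      simp [hd]
    obtain ⟨y, rfl⟩ := h.exact v2 h2 h3
    obtain ⟨m, hm⟩ := (hker _).1 hv'
    -- The cycle `a` is chosen with the augmentation that makes `v1 + x y - x a` a boundary.
    obtain ⟨a, ha0, ha⟩ := h.exists_combination (m + ∑ i, y i • ε i)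
    obtain ⟨w, hw⟩ := h.exact (v1 + x • y - x • a) (by
        rw [Matrix.mulVec_sub, Matrix.mulVec_add, Matrix.mulVec_smul, Matrix.mulVec_smul, h1, ha0,
          smul_zero, sub_zero]) (by
        have : ∑ i, (v1 + x • y - x • a) i • ε i =
            ∑ i, v1 i • ε i + x • ∑ i, y i • ε i - x • ∑ i, a i • ε i := by
          simp [sub_smul, add_smul, Finset.sum_add_distrib, Finset.sum_sub_distrib,
            Finset.smul_sum, mul_smul]
        rw [this, ha, ← hm, smul_add, sub_self])
    refine ⟨Sum.elim w (a - y), ?_⟩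
    rw [Matrix.fromBlocks_mulVec]
    simp only [Sum.elim_comp_inl, Sum.elim_comp_inr, Matrix.zero_mulVec, zero_add,
      Matrix.smul_mulVec, Matrix.one_mulVec, Matrix.neg_mulVec, Matrix.mulVec_sub, ha0, ← hw]
    congr 1
    · abel
    · simp

variable {c : ℕ}

/-- This is the tensor product with the rank-one factorization of `x · g`: the blocks `D` and `-D`
cancel off the diagonal, while the two scalar blocks add `x · g` to `W` on it. -/
theorem IsMatrixFactorization.cone {W : MvPolynomial (Fin c) Q}
    {D : Matrix ι ι (MvPolynomial (Fin c) Q)} (h : IsMatrixFactorization deg W D) (x : Q)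
    (g : Fin c → Q) :
    IsMatrixFactorization (coneDegree deg) (W + MvPolynomial.C x * potential g)
      (Matrix.fromBlocks D ((MvPolynomial.C x : MvPolynomial (Fin c) Q) • 1) (potential g • 1) (-D))
      where
  homog := by
    have hg : ∀ e, (potential g).coeff e ≠ 0 → e.degree = 1 := by
      intro e he
      rw [potential, MvPolynomial.coeff_sum] at he
      obtain ⟨l, -, hl⟩ := Finset.exists_ne_zero_of_sum_ne_zero he
      rw [MvPolynomial.coeff_C_mul, MvPolynomial.coeff_X] at hl
      have : Finsupp.single l 1 = e := by
        by_contra h0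
        simp [h0] at hl
      rw [← this]
      simp
    rintro (i | i) (j | j) e hij
    · exact h.homog i j e hij
    · have h1 : i = j := by
        by_contra h0
        exact hij (by simp [h0])
      have h2 : e = 0 := by
        by_contra h0
        exact hij (by simp [h1, MvPolynomial.coeff_C, Ne.symm h0])
      simp [coneDegree, h1, h2]
    · have h1 : i = j := by
        by_contra h0
        exact hij (by simp [h0])
      have h2 := hg e (fun h0 => hij (by simp [h1, h0]))
      simp only [coneDegree, h1, h2, Sum.elim_inl, Sum.elim_inr]
      ring
    · have := h.homog i j e (fun h0 => hij (by simp [h0]))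
      simp only [coneDegree, Sum.elim_inr]
      omega
  sq := by
    rw [Matrix.fromBlocks_multiply, h.sq, neg_mul_neg, h.sq]
    simp only [Matrix.smul_mul, Matrix.mul_smul, Matrix.one_mul, Matrix.mul_one, smul_neg,
      Matrix.mul_neg, add_neg_cancel, smul_smul, ← add_smul]
    rw [mul_comm (potential g), add_comm (_ * _) W, ← Matrix.fromBlocks_one,
      Matrix.fromBlocks_smul, smul_zero]

theorem coeffMatrix_zero_cone (D : Matrix ι ι (MvPolynomial (Fin c) Q)) (x : Q) (g : Fin c → Q) :
    coeffMatrix 0 (Matrix.fromBlocks D ((MvPolynomial.C x : MvPolynomial (Fin c) Q) • 1)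
      (potential g • 1) (-D)) = Matrix.fromBlocks (coeffMatrix 0 D) (x • 1) 0 (-coeffMatrix 0 D) := by
  ext (i | i) (j | j)
  · rfl
  · by_cases h : i = j
    · simp [coeffMatrix_apply, h]
    · simp [coeffMatrix_apply, h]
  · by_cases h : i = j
    · simp [coeffMatrix_apply, h, potential, MvPolynomial.coeff_sum]
    · simp [coeffMatrix_apply, h]
  · simp [coeffMatrix_apply]

end Cone

/-! ### The Koszul matrix factorization of the residue field. -/

section Koszul

variable {Q : Type u} [CommRing Q] {c : ℕ}

/-- The Koszul matrix factorization, with coefficients in an ideal `J`. -/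
theorem exists_koszul (J : Ideal Q) : ∀ (L : List (Q × (Fin c → Q))),
    IsWeaklyRegular Q (L.map Prod.fst) → (∀ p ∈ L, p.1 ∈ J ∧ ∀ l, p.2 l ∈ J) →
    ∀ (M : Type u) [AddCommGroup M] [Module Q M] (q : Q →ₗ[Q] M), Function.Surjective q →
    LinearMap.ker q = Ideal.ofList (L.map Prod.fst) →
    ∃ (ι : Type) (_ : Fintype ι) (_ : DecidableEq ι) (deg : ι → ℕ)
      (D : Matrix ι ι (MvPolynomial (Fin c) Q)) (ε : ι → M),
      IsMatrixFactorization deg (L.map fun p => MvPolynomial.C p.1 * potential p.2).sum D ∧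
      IsFreeResolution deg (coeffMatrix 0 D) ε ∧ ∀ i j e, (D i j).coeff e ∈ J := by
  intro L
  induction L using List.reverseRecOn with
  | nil =>
    intro _ _ M _ _ q hq hker
    refine ⟨Unit, inferInstance, inferInstance, fun _ => 0, 0, fun _ => q 1, ⟨by simp, by simp⟩,
      ⟨by simp [coeffMatrix_apply], by simp, ?_, ?_, by simp [coeffMatrix_apply], ?_⟩, by simp⟩
    · rw [eq_top_iff]
      rintro m -
      obtain ⟨a, rfl⟩ := hq m
      rw [← mul_one a, ← smul_eq_mul, map_smul]
      exact Submodule.smul_mem _ _ (Submodule.subset_span ⟨(), rfl⟩)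
    · ext; simp [coeffMatrix_apply, Matrix.mul_apply]
    · intro v _ hv
      refine ⟨0, funext fun i => ?_⟩
      rw [Fintype.sum_unique, ← map_smul, ← LinearMap.mem_ker, hker, List.map_nil,
        Ideal.ofList_nil] at hv
      simpa using hv
  | append_singleton L p ih =>
    intro hreg hJ M _ _ q hq hker
    rw [List.map_append, isWeaklyRegular_append_iff, List.map_singleton,
      isWeaklyRegular_singleton_iff] at hreg
    rw [List.map_append, List.map_singleton, Ideal.ofList_append, Ideal.ofList_singleton] at hker
    let I := Ideal.ofList (L.map Prod.fst)
    -- Elements are appended at the end, so the earlier ones give a resolution of `Q/I`, on which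
    -- the new element is regular.
    obtain ⟨ι, _, _, deg, D, ε, h1, h2, h3⟩ := ih hreg.1 (fun p hp => hJ p (by simp [hp]))
      (Q ⧸ I) I.mkQ (Submodule.mkQ_surjective _) (Submodule.ker_mkQ _)
    have hI : I ≤ LinearMap.ker q := hker ▸ le_sup_left
    have hπ : ∀ m, I.liftQ q hI m = 0 ↔ ∃ m', p.1 • m' = m := by
      intro m
      obtain ⟨y, rfl⟩ := Submodule.mkQ_surjective _ m
      rw [Submodule.mkQ_apply, Submodule.liftQ_apply, ← LinearMap.mem_ker, hker]
      constructor
      · intro hy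
        obtain ⟨a, ha, z, hz, rfl⟩ := Submodule.mem_sup.1 hy
        obtain ⟨w, rfl⟩ := Ideal.mem_span_singleton'.1 hz
        refine ⟨Submodule.Quotient.mk w, ?_⟩
        rw [← Submodule.Quotient.mk_smul, Submodule.Quotient.eq, smul_eq_mul, mul_comm w]
        simpa using ha
      · rintro ⟨m', hm'⟩
        obtain ⟨w, rfl⟩ := Submodule.mkQ_surjective _ m'
        rw [Submodule.mkQ_apply, ← Submodule.Quotient.mk_smul, eq_comm, Submodule.Quotient.eq] at hm'
        rw [← sub_add_cancel y (p.1 • w)]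
        exact Submodule.add_mem_sup hm' (Ideal.mem_span_singleton'.2 ⟨w, mul_comm _ _⟩)
    have hreg' : IsSMulRegular (Q ⧸ I) p.1 := by
      have := hreg.2
      rwa [(LinearEquiv.isSMulRegular_congr (Submodule.quotEquivOfEq
        (I • (⊤ : Submodule Q Q)) I (by rw [smul_eq_mul, Ideal.mul_top])) p.1)] at this
    refine ⟨ι ⊕ ι, inferInstance, inferInstance, coneDegree deg,
      Matrix.fromBlocks D ((MvPolynomial.C p.1 : MvPolynomial (Fin c) Q) • 1)
        (potential p.2 • 1) (-D), Sum.elim (fun i => I.liftQ q hI (ε i)) 0, ?_, ?_, ?_⟩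
    · rw [List.map_append, List.sum_append, List.map_singleton, List.sum_singleton]
      exact h1.cone p.1 p.2
    · rw [coeffMatrix_zero_cone]
      exact h2.cone hreg' _ (fun m => ⟨Submodule.Quotient.mk (hq m).choose, (hq m).choose_spec⟩) hπ
    · have hp := hJ p (by simp)
      rintro (i | i) (j | j) e
      · exact h3 i j e
      · by_cases hij : i = j
        · simp only [Matrix.fromBlocks_apply₁₂, hij, Matrix.smul_apply, Matrix.one_apply_eq,
            smul_eq_mul, mul_one, MvPolynomial.coeff_C]
          split_ifs
          · exact hp.1
          · exact zero_mem _
        · simp [hij]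
      · by_cases hij : i = j
        · simp only [Matrix.fromBlocks_apply₂₁, hij, Matrix.smul_apply, Matrix.one_apply_eq,
            smul_eq_mul, mul_one, potential, MvPolynomial.coeff_sum, MvPolynomial.coeff_C_mul]
          exact sum_mem fun l _ => Ideal.mul_mem_right _ _ (hp.2 l)
        · simp [hij]
      · simpa using h3 i j e

/-- Membership of `fₗ` in `𝔪²` enters here: with a regular sequence `xᵢ` generating `𝔪`, write `fₗ =
∑ gₗᵢ xᵢ` with `gₗᵢ ∈ 𝔪`, so that `W = ∑ xᵢ (∑ gₗᵢ χₗ)` and both factors of every summand have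
coefficients in `𝔪`. -/
theorem exists_koszul_residueField {Q : Type u} [CommRing Q] [IsRegularLocalRing Q] {c : ℕ}
    {f : Fin c → Q} (hf : ∀ l, f l ∈ maximalIdeal Q ^ 2) (k : Type u) [AddCommGroup k] [Module Q k]
    (q : Q →ₗ[Q] k) (hq : Function.Surjective q) (hker : LinearMap.ker q = maximalIdeal Q) :
    ∃ (ι : Type) (_ : Fintype ι) (_ : DecidableEq ι) (deg : ι → ℕ)
      (D : Matrix ι ι (MvPolynomial (Fin c) Q)) (ε : ι → k),
      IsMatrixFactorization deg (potential f) D ∧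
      IsFreeResolution deg (coeffMatrix 0 D) ε ∧ ∀ i j e, (D i j).coeff e ∈ maximalIdeal Q := by
  obtain ⟨-, rs, hrs, hm⟩ := isDomain_and_exists_isWeaklyRegular Q
  have hm' : maximalIdeal Q = Ideal.span (Set.range rs.get) := by
    rw [← hm, Ideal.ofList, Set.range_list_get]
  have hg : ∀ l, ∃ g : Fin rs.length → Q, (∀ i, g i ∈ maximalIdeal Q) ∧
      ∑ i, g i * rs.get i = f l := by
    intro l
    have h1 := hf l
    rw [sq, ← smul_eq_mul] at h1
    nth_rewrite 2 [hm'] at h1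
    obtain ⟨a, ha, h2⟩ := (Submodule.mem_ideal_smul_span_iff_exists_sum _ _ _).1 h1
    refine ⟨a, ha, ?_⟩
    rw [← h2, Finsupp.sum_fintype _ _ (by simp)]
    rfl
  choose g hg hgf using hg
  let L : List (Q × (Fin c → Q)) := List.ofFn fun i => (rs.get i, fun l => g l i)
  have hL : L.map Prod.fst = rs := by
    simp only [L, List.map_ofFn]
    exact List.ofFn_get rs
  obtain ⟨ι, _, _, deg, D, ε, h1, h2, h3⟩ := exists_koszul (maximalIdeal Q) L (hL ▸ hrs) (by
    intro p hp
    obtain ⟨i, rfl⟩ := (List.mem_ofFn' _ _).1 hp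
    refine ⟨?_, fun l => hg l i⟩
    rw [hm']
    exact Ideal.subset_span ⟨i, rfl⟩) k q hq (by rw [hker, hL, hm])
  have e : potential f = (L.map fun p => MvPolynomial.C p.1 * potential p.2).sum := ?_
  · exact ⟨ι, _, _, deg, D, ε, e ▸ h1, h2, h3⟩
  simp only [L, List.map_ofFn, List.sum_ofFn, Function.comp_apply, potential, ← hgf, map_sum,
    Finset.sum_mul, Finset.mul_sum]
  rw [Finset.sum_comm]
  refine Finset.sum_congr rfl fun i _ => Finset.sum_congr rfl fun l _ => ?_
  rw [map_mul]
  ring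

end Koszul

/-! ### Unpacking homotopy equivalences of truncations. -/

section Truncation

variable {R : Type u} [CommRing R]

theorem stupidTrunc_d_comp_stupidTruncXIso_hom (K : CochainComplex (ModuleCat.{u} R) ℤ) (p : ℤ)
    {a b : ℕ} {i j : ℤ} (ha : (ComplexShape.embeddingUpIntLE p).f a = i)
    (hb : (ComplexShape.embeddingUpIntLE p).f b = j) :
    (K.stupidTrunc (ComplexShape.embeddingUpIntLE p)).d i j ≫
      (K.stupidTruncXIso (ComplexShape.embeddingUpIntLE p) hb).hom =
    (K.stupidTruncXIso (ComplexShape.embeddingUpIntLE p) ha).hom ≫ K.d i j := by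
  subst ha hb
  simp [HomologicalComplex.stupidTruncXIso, HomologicalComplex.stupidTrunc,
    HomologicalComplex.extend_d_eq _ _ rfl rfl]
  erw [Category.assoc, Iso.inv_hom_id_assoc]
  exact (Category.comp_id _).trans (Category.id_comp _).symm

/-- The isomorphisms between terms of `K` and of its truncation become linear maps defined for every
index, zero above `p`, so that later computations need no proofs about indices. -/
theorem exists_stupidTrunc_maps (K : CochainComplex (ModuleCat.{u} R) ℤ) (p : ℤ) :
    ∃ (τ : ∀ n, K.X n →ₗ[R] (K.stupidTrunc (ComplexShape.embeddingUpIntLE p)).X n)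
      (σ : ∀ n, (K.stupidTrunc (ComplexShape.embeddingUpIntLE p)).X n →ₗ[R] K.X n),
      (∀ n ≤ p, ∀ x, σ n (τ n x) = x) ∧ (∀ n ≤ p, ∀ x, τ n (σ n x) = x) ∧
      (∀ i j, i + 1 = j → j ≤ p → ∀ x, σ j (((K.stupidTrunc
        (ComplexShape.embeddingUpIntLE p)).d i j).hom x) = (K.d i j).hom (σ i x)) ∧
      (∀ i j, i + 1 = j → j ≤ p → ∀ x, ((K.stupidTrunc
        (ComplexShape.embeddingUpIntLE p)).d i j).hom (τ i x) = τ j ((K.d i j).hom x)) := by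
  have hf : ∀ n ≤ p, (ComplexShape.embeddingUpIntLE p).f (p - n).toNat = n := fun n hn => by
    change p - ((p - n).toNat : ℤ) = n
    omega
  let e : ∀ n (hn : n ≤ p), (K.stupidTrunc (ComplexShape.embeddingUpIntLE p)).X n ≅ K.X n :=
    fun n hn => K.stupidTruncXIso (ComplexShape.embeddingUpIntLE p) (hf n hn)
  have he : ∀ i j (hi : i ≤ p) (hj : j ≤ p) x, (e j hj).hom.hom (((K.stupidTrunc
        (ComplexShape.embeddingUpIntLE p)).d i j).hom x) = (K.d i j).hom ((e i hi).hom.hom x) :=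
    fun i j hi hj x => congrArg (fun g => g.hom x)
      (stupidTrunc_d_comp_stupidTruncXIso_hom K p (hf i hi) (hf j hj))
  have h1 : ∀ n (hn : n ≤ p) x, (e n hn).hom.hom ((e n hn).inv.hom x) = x :=
    fun n hn x => congrArg (fun g => g.hom x) (e n hn).inv_hom_id
  have h2 : ∀ n (hn : n ≤ p) x, (e n hn).inv.hom ((e n hn).hom.hom x) = x :=
    fun n hn x => congrArg (fun g => g.hom x) (e n hn).hom_inv_id
  refine ⟨fun n => if hn : n ≤ p then (e n hn).inv.hom else 0,
    fun n => if hn : n ≤ p then (e n hn).hom.hom else 0, fun n hn x => ?_, fun n hn x => ?_,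
    fun i j hij hj x => ?_, fun i j hij hj x => ?_⟩
  · simp only [dif_pos hn]
    exact h1 n hn x
  · simp only [dif_pos hn]
    exact h2 n hn x
  · have hi : i ≤ p := by omega
    simp only [dif_pos hj, dif_pos hi]
    exact he i j hi hj x
  · have hi : i ≤ p := by omega
    simp only [dif_pos hj, dif_pos hi]
    rw [← h2 j hj (((K.stupidTrunc (ComplexShape.embeddingUpIntLE p)).d i j).hom _), he i j hi hj,
      h1 i hi]

theorem exists_of_homotopyEquiv_stupidTrunc {C E : CochainComplex (ModuleCat.{u} R) ℤ} {p : ℤ}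
    (H : HomotopyEquiv (C.stupidTrunc (ComplexShape.embeddingUpIntLE p))
      (E.stupidTrunc (ComplexShape.embeddingUpIntLE p))) :
    ∃ (a : ∀ n, C.X n →ₗ[R] E.X n) (b : ∀ n, E.X n →ₗ[R] C.X n)
      (s : ∀ n m, E.X m →ₗ[R] E.X n),
      (∀ i j, i + 1 = j → j ≤ p → ∀ x, (E.d i j).hom (a i x) = a j ((C.d i j).hom x)) ∧
      (∀ i j, i + 1 = j → j ≤ p → ∀ x, (C.d i j).hom (b i x) = b j ((E.d i j).hom x)) ∧
      ∀ i j k, i + 1 = j → j + 1 = k → k ≤ p → ∀ x, a j (b j x) =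
        (E.d i j).hom (s i j x) + s j k ((E.d j k).hom x) + x := by
  obtain ⟨τ, σ, h1, h2, h3, h4⟩ := exists_stupidTrunc_maps C p
  obtain ⟨τ', σ', h1', h2', h3', h4'⟩ := exists_stupidTrunc_maps E p
  obtain ⟨s, hs⟩ := exists_of_homotopy H.homotopyInvHomId
  have hc : ∀ i j x, ((E.stupidTrunc (ComplexShape.embeddingUpIntLE p)).d i j).hom
      ((H.hom.f i).hom x) = (H.hom.f j).hom (((C.stupidTrunc
        (ComplexShape.embeddingUpIntLE p)).d i j).hom x) :=
    fun i j x => congrArg (fun g => g.hom x) (H.hom.comm i j)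
  have hc' : ∀ i j x, ((C.stupidTrunc (ComplexShape.embeddingUpIntLE p)).d i j).hom
      ((H.inv.f i).hom x) = (H.inv.f j).hom (((E.stupidTrunc
        (ComplexShape.embeddingUpIntLE p)).d i j).hom x) :=
    fun i j x => congrArg (fun g => g.hom x) (H.inv.comm i j)
  refine ⟨fun n => σ' n ∘ₗ (H.hom.f n).hom ∘ₗ τ n, fun n => σ n ∘ₗ (H.inv.f n).hom ∘ₗ τ' n,
    fun n m => σ' n ∘ₗ s n m ∘ₗ τ' m, fun i j hij hj x => ?_, fun i j hij hj x => ?_,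
    fun i j k hij hjk hk x => ?_⟩
  · simp only [LinearMap.comp_apply]
    rw [← h3' i j hij hj, hc, h4 i j hij hj]
  · simp only [LinearMap.comp_apply]
    rw [← h3 i j hij hj, hc', h4' i j hij hj]
  · simp only [LinearMap.comp_apply]
    rw [h2 j (by omega), ← h3' i j hij (by omega), ← h4' j k hjk hk]
    have h5 := hs i j k hij hjk (τ' j x)
    have h6 : ((H.inv ≫ H.hom).f j).hom (τ' j x) = (H.hom.f j).hom ((H.inv.f j).hom (τ' j x)) := rfl
    have h7 : ((𝟙 (E.stupidTrunc (ComplexShape.embeddingUpIntLE p)) :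
      _ ⟶ _).f j).hom (τ' j x) = τ' j x := rfl
    rw [← h6, h5, h7, map_add, map_add, h1' j (by omega)]

theorem exists_isResolution_cochainComplex {M : ModuleCat.{u} R} (P : ProjectiveResolution M) :
    ∃ ε : P.cochainComplex.X 0 →ₗ[R] M, IsResolution P.cochainComplex ε := by
  let e : ((ChainComplex.single₀ (ModuleCat.{u} R)).obj M).X 0 ≅ M :=
    HomologicalComplex.singleObjXSelf _ 0 M
  have he : Function.Bijective e.hom.hom := ConcreteCategory.bijective_of_isIso e.hom
  have hX : Function.Bijective (P.cochainComplexXIso 0 0).hom.hom :=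
    ConcreteCategory.bijective_of_isIso (P.cochainComplexXIso 0 0).hom
  have hX' : Function.Bijective (P.cochainComplexXIso (-1) 1).hom.hom :=
    ConcreteCategory.bijective_of_isIso (P.cochainComplexXIso (-1) 1).hom
  have hi : ∀ w, (P.cochainComplexXIso 0 0).hom.hom ((P.cochainComplexXIso 0 0).inv.hom w) = w :=
    fun w => congrArg (fun g => g.hom w) (P.cochainComplexXIso 0 0).inv_hom_id
  refine ⟨e.hom.hom ∘ₗ (P.π.f 0).hom ∘ₗ (P.cochainComplexXIso 0 0).hom.hom, fun n _ => ?_, ?_, ?_,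
    fun i j k hij hjk hj => ?_⟩
  · have h : Projective (P.cochainComplex.X n) := inferInstance
    exact (IsProjective.iff_projective (R := R) (P := P.cochainComplex.X n)).2 h
  · exact he.2.comp (((ModuleCat.epi_iff_surjective (P.π.f 0)).1 inferInstance).comp hX.2)
  · have h0 := (ShortComplex.ShortExact.moduleCat_exact_iff_function_exact _).1 P.exact₀
    intro x
    have h1 := h0 ((P.cochainComplexXIso 0 0).hom.hom x)
    rw [LinearMap.comp_apply, LinearMap.comp_apply]
    refine ((map_eq_zero_iff e.hom.hom he.1).trans h1).trans ?_
    rw [P.cochainComplex_d (-1) 0 1 0]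
    constructor
    · rintro ⟨y, hy⟩
      obtain ⟨y, rfl⟩ := hX'.2 y
      refine ⟨y, hX.1 ?_⟩
      rw [← hy]
      exact hi _
    · rintro ⟨y, rfl⟩
      refine ⟨(P.cochainComplexXIso (-1) 1).hom.hom y, ?_⟩
      exact (hi _).symm
  · have := (P.cochainComplex.exactAt_iff' i j k (by simp; omega) (by simp; omega)).1
      (P.cochainComplex.exactAt_of_isGE 0 j hj)
    exact (ShortComplex.ShortExact.moduleCat_exact_iff_function_exact _).1 this

end Truncation

/-! ### Comparison of a complete resolution with a projective resolution. -/

section Comparison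

variable {R : Type u} [CommRing R] {C E : CochainComplex (ModuleCat.{u} R) ℤ}

/-- Chain maps in low degrees out of a totally acyclic complex extend to all degrees. -/
theorem IsTotallyAcyclic.exists_extend (hC : IsTotallyAcyclic C)
    (hEf : ∀ n, Module.Free R (E.X n)) (hEF : ∀ n, Module.Finite R (E.X n)) (p : ℤ)
    (θ : ∀ n, C.X n →ₗ[R] E.X n)
    (hθ : ∀ i j, i + 1 = j → j ≤ p → ∀ x, (E.d i j).hom (θ i x) = θ j ((C.d i j).hom x)) :
    ∃ θ' : ∀ n, C.X n →ₗ[R] E.X n, (∀ n ≤ p, θ' n = θ n) ∧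
      ∀ i j, i + 1 = j → ∀ x, (E.d i j).hom (θ' i x) = θ' j ((C.d i j).hom x) := by
  have key : ∀ j, j ≤ p → ∀ i k, i + 1 = j → j + 1 = k → ∀ x,
      (E.d j k).hom (θ j ((C.d i j).hom x)) = 0 := fun j hj i k hi hk x => by
    rw [← hθ i j hi hj, d_d_apply]
  obtain ⟨θ', -, hP, h⟩ := exists_int_family (X := fun n => C.X n →ₗ[R] E.X n)
    (P := fun j α => (j ≤ p → α = θ j) ∧ ∀ i k, i + 1 = j → j + 1 = k → ∀ x,
      (E.d j k).hom (α ((C.d i j).hom x)) = 0)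
    (G := fun i j α α' => ∀ x, (E.d i j).hom (α x) = α' ((C.d i j).hom x)) p (θ p)
    ⟨fun _ => rfl, key p le_rfl⟩
    (fun i j hij hi α hα => by
      obtain ⟨β, hβ⟩ := hC.exists_extension (i - 1) i j (by ring) hij ((E.d i j).hom ∘ₗ α)
        (fun x => hα.2 _ _ (by ring) hij x)
      refine ⟨β, ⟨fun h => by omega, fun i' k hi' hk x => ?_⟩, fun x => (hβ x).symm⟩
      obtain rfl : i' = i := by omega
      rw [hβ]
      exact d_d_apply E _ _ _ _)
    (fun i j hij hj α hα => ⟨θ i, ⟨fun _ => rfl, key i (by omega)⟩, fun x => by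
      rw [hα.1 hj, hθ i j hij hj]⟩)
  exact ⟨θ', fun n hn => (hP n).1 hn, h⟩

/-- A complete resolution of `M` maps to any projective resolution of `M`, and this is a homotopy
equivalence in low degrees. -/
theorem IsCompleteResolution.exists_comparison {D : Ktac R} {M : ModuleCat.{u} R}
    (hD : IsCompleteResolution D M) {ε : E.X 0 →ₗ[R] M} (hE : IsResolution E ε)
    (hEf : ∀ n, Module.Free R (E.X n)) (hEF : ∀ n, Module.Finite R (E.X n)) :
    ∃ θ : ∀ n, D.complex.X n →ₗ[R] E.X n,
      (∀ i j, i + 1 = j → ∀ x, (E.d i j).hom (θ i x) = θ j ((D.complex.d i j).hom x)) ∧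
      ∃ p₀ : ℤ, ∀ (N : Type u) [AddCommGroup N] [Module R N] (q p r : ℤ) (_ : q + 1 = p)
        (_ : p + 1 = r) (_ : p < p₀) (g : E.X p →ₗ[R] N), (∀ z, g ((E.d q p).hom z) = 0) →
        IsCoboundary D.complex p (g ∘ₗ θ p) → IsCoboundary E p g := by
  obtain ⟨P, p, ⟨H⟩⟩ := hD
  obtain ⟨a, b, s, ha, hb, hs⟩ := exists_of_homotopyEquiv_stupidTrunc (E := P.cochainComplex) H
  obtain ⟨ε', hP⟩ := exists_isResolution_cochainComplex P
  obtain ⟨v, hv0, hv⟩ := hP.exists_map hE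
  obtain ⟨w, hw0, hw⟩ := hE.exists_map hP
  obtain ⟨t, ht⟩ := hE.exists_homotopy hE (fun n => LinearMap.id - v n ∘ₗ w n)
    (fun x => by simp [hv0, hw0]) (fun i j hij hj x => by
      simp only [LinearMap.sub_apply, LinearMap.id_apply, LinearMap.comp_apply, map_sub]
      rw [hv i j hij hj, hw i j hij hj])
  -- Below `min p 0` the map is the composite `D → P → E` of the given equivalence and the
  -- comparison of resolutions; total acyclicity extends it upward.
  obtain ⟨θ, hθ0, hθ⟩ := D.property.exists_extend hEf hEF (min p 0) (fun n => v n ∘ₗ a n)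
    (fun i j hij hj x => by
      simp only [LinearMap.comp_apply]
      rw [hv i j hij (by omega), ha i j hij (by omega)])
  refine ⟨θ, hθ, min p 0, ?_⟩
  rintro N _ _ q p' _ hq rfl hp g hg ⟨_, rfl, k, hk⟩
  -- The three terms come from `g θ = k d` transported back along `b w`, from the homotopy `s`
  -- between `a b` and the identity of `P`, and from the homotopy `t` between the identity of `E`
  -- and `v w`.
  refine ⟨p' + 1, rfl, k ∘ₗ b (p' + 1) ∘ₗ w (p' + 1) - g ∘ₗ v p' ∘ₗ s p' (p' + 1) ∘ₗ w (p' + 1) +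
    g ∘ₗ t p' (p' + 1), fun z => ?_⟩
  have h1 := ht q p' (p' + 1) hq rfl (by omega) z
  simp only [LinearMap.sub_apply, LinearMap.id_apply, LinearMap.comp_apply] at h1
  rw [sub_eq_iff_eq_add] at h1
  have h2 := hs q p' (p' + 1) hq rfl (by omega) (w p' z)
  rw [← sub_eq_iff_eq_add'] at h2
  have h3 : g (v p' (a p' (b p' (w p' z)))) = k (b (p' + 1) (w (p' + 1) ((E.d p' (p' + 1)).hom z))) := by
    have := hk (b p' (w p' z))
    rw [hθ0 p' (by omega), hb _ _ rfl (by omega), hw _ _ rfl (by omega)] at this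
    exact this
  have h4 : v p' (((P.cochainComplex.d q p').hom) (s q p' (w p' z))) =
      (E.d q p').hom (v q (s q p' (w p' z))) := (hv q p' hq (by omega) _).symm
  conv_lhs => rw [h1, ← h2]
  simp only [map_add, map_sub, LinearMap.add_apply, LinearMap.sub_apply, LinearMap.comp_apply]
  rw [h4, hg, hg, h3, hw _ _ rfl (by omega)]
  abel

end Comparison

/-! ### Independence of the matrix factorization used to describe the action. -/

section Equivalence

variable {Q : Type u} [CommRing Q] {R : Type u} [CommRing R] [Algebra Q R]
  {c : ℕ} {f : Fin c → Q} {ι ι' κ : Type} [Fintype ι] [DecidableEq ι] [Fintype ι'] [DecidableEq ι']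
  [Fintype κ] {deg : ι → ℕ} {deg' : ι' → ℕ}
  {F : Matrix ι ι (MvPolynomial (Fin c) Q)} {F' : Matrix ι' ι' (MvPolynomial (Fin c) Q)}
  {N : Type u} [AddCommGroup N] [Module R N] [Module Q N] [IsScalarTower Q R N] {ν : κ → N}
  {C : CochainComplex (ModuleCat.{u} R) ℤ}
  {θ : ∀ n, C.X n →ₗ[R] (Position c deg n → R)} {θ' : ∀ n, C.X n →ₗ[R] (Position c deg' n → R)}

theorem IsCoboundary.comp_shiftComponent {E : CochainComplex (ModuleCat.{u} R) ℤ} {p : ℤ}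
    {g : E.X (p + 2) →ₗ[R] N} (h : IsCoboundary E (p + 2) g) (φ : C ⟶ E⟦(2 : ℤ)⟧) :
    IsCoboundary C p (g ∘ₗ shiftComponent φ p) := by
  obtain ⟨r, hr, v, hv⟩ := h
  obtain rfl : r = p + 1 + 2 := by omega
  exact ⟨p + 1, rfl, v ∘ₗ shiftComponent φ (p + 1), fun x =>
    (hv _).trans (congrArg v (d_shiftComponent φ p (p + 1) x))⟩

/-- The matrices `X` and `X'` induce the same functionals on `C`, up to coboundaries. -/
def IsEquivalent (θ : ∀ n, C.X n →ₗ[R] (Position c deg n → R))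
    (θ' : ∀ n, C.X n →ₗ[R] (Position c deg' n → R)) (ν : κ → N)
    (X : Matrix κ ι (MvPolynomial (Fin c) Q)) (X' : Matrix κ ι' (MvPolynomial (Fin c) Q)) : Prop :=
  ∀ p, IsCoboundary C p (rowDegree R deg ν X p ∘ₗ θ p - rowDegree R deg' ν X' p ∘ₗ θ' p)

/-- Two factorizations compared with the same `C` are linked by its Eisenbud operators:
multiplication by `χₗ` on either side is precomposition with `tₗ` up to coboundaries. -/
theorem IsEquivalent.smul [IsLocalRing Q] (hf : IsCompleteIntersection f R)
    (hC : IsTotallyAcyclic C) (hF : IsMatrixFactorization deg (potential f) F)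
    (hθ : IsChainFamily F C θ) (hF' : IsMatrixFactorization deg' (potential f) F')
    (hθ' : IsChainFamily F' C θ') {X : Matrix κ ι (MvPolynomial (Fin c) Q)}
    {X' : Matrix κ ι' (MvPolynomial (Fin c) Q)} (H : IsEquivalent θ θ' ν X X')
    (hX : IsNull ν (X * F)) (hX' : IsNull ν (X' * F')) (p : MvPolynomial (Fin c) Q) :
    IsEquivalent θ θ' ν (p • X) (p • X') := by
  induction p using MvPolynomial.induction_on with
  | C q =>
    intro n
    rw [rowDegree_C_smul, rowDegree_C_smul, LinearMap.smul_comp, LinearMap.smul_comp, ← smul_sub]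
    exact (H n).smul _
  | add p q hp hq =>
    intro n
    have h := (hp n).add (hq n)
    rw [add_smul, add_smul, rowDegree_add, rowDegree_add, LinearMap.add_comp, LinearMap.add_comp]
    convert h using 1
    abel
  | mul_X p l hp =>
    intro n
    obtain ⟨τ, hτ⟩ := exists_isEisenbudFamily hf hC.free hC.finite
    rw [mul_comm, mul_smul, mul_smul, rowDegree_X_smul, rowDegree_X_smul]
    have h1 := hθ.operator hf hF hτ l n (rowDegree R deg ν (p • X) (n + 2))
      ((isNull_mul_iff hF.isHomogeneousOfDegree _).1 (hX.smul_mul p) _ _ (by ring))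
    have h2 := hθ'.operator hf hF' hτ l n (rowDegree R deg' ν (p • X') (n + 2))
      ((isNull_mul_iff hF'.isHomogeneousOfDegree _).1 (hX'.smul_mul p) _ _ (by ring))
    have h3 := (h1.add h2.neg).add ((hp (n + 2)).comp_shiftComponent (τ l))
    convert h3 using 1
    refine LinearMap.ext fun x => ?_
    simp only [LinearMap.sub_apply, LinearMap.add_apply, LinearMap.neg_apply,
      LinearMap.comp_apply]
    abel

end Equivalence

/-! ### Complete resolutions of the residue field. -/

section ResidueField

variable {Q : Type u} [CommRing Q] [IsLocalRing Q] {R : Type u} [CommRing R] [IsLocalRing R]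
  [Algebra Q R] {c : ℕ} {f : Fin c → Q} {ι : Type} [Fintype ι] [DecidableEq ι] {deg : ι → ℕ}

open IsLocalRing

theorem smul_eq_zero_of_mem_maximalIdeal {r : R} (hr : r ∈ maximalIdeal R) (x : ResidueField R) :
    r • x = 0 := by
  rw [Algebra.smul_def]
  have : algebraMap R (ResidueField R) r = 0 := (residue_eq_zero_iff r).2 hr
  rw [this, zero_mul]

theorem IsCompleteIntersection.algebraMap_mem_maximalIdeal (hf : IsCompleteIntersection f R) {q : Q}
    (hq : q ∈ maximalIdeal Q) : algebraMap Q R q ∈ maximalIdeal R := by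
  rw [← hf.ker_residue] at hq
  exact (residue_eq_zero_iff _).1 hq

theorem eq_zero_of_forall_mem_maximalIdeal {P : Type} [Finite P] (v : (P → R) →ₗ[R] ResidueField R)
    (w : P → R) (hw : ∀ y, w y ∈ maximalIdeal R) : v w = 0 := by
  classical
  have := Fintype.ofFinite P
  rw [pi_eq_sum_univ' w, map_sum]
  refine Finset.sum_eq_zero fun y _ => ?_
  rw [map_smul]
  exact smul_eq_zero_of_mem_maximalIdeal (hw y) _

theorem IsCompleteIntersection.contractDegree_mem (hf : IsCompleteIntersection f R)
    {K : Matrix ι ι (MvPolynomial (Fin c) Q)} (hK : ∀ i j e, (K i j).coeff e ∈ maximalIdeal Q)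
    (n n' : ℤ) (z : Position c deg n → R) (y : Position c deg n') :
    contractDegree R deg K n n' z y ∈ maximalIdeal R := by
  change contractMatrix R K (extendDegree R deg n z) y.1.1 y.1.2 ∈ maximalIdeal R
  rw [contractMatrix_apply']
  exact sum_mem fun i _ => sum_mem fun e _ =>
    Ideal.mul_mem_right _ _ (hf.algebraMap_mem_maximalIdeal (hK _ _ _))

theorem IsCompleteIntersection.isNull_mul_of_mem (hf : IsCompleteIntersection f R) {κ : Type}
    [Fintype κ] {K : Matrix ι ι (MvPolynomial (Fin c) Q)}
    (hK : ∀ i j e, (K i j).coeff e ∈ maximalIdeal Q) (ν : κ → ResidueField R)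
    (X : Matrix κ ι (MvPolynomial (Fin c) Q)) : IsNull ν (X * K) := by
  intro e i
  refine Finset.sum_eq_zero fun k _ => ?_
  have h : (X * K) k i ∈ (maximalIdeal Q).map (MvPolynomial.C (σ := Fin c)) := by
    rw [Matrix.mul_apply]
    exact sum_mem fun j _ => Ideal.mul_mem_left _ _ (MvPolynomial.mem_map_C_iff.2 (hK j i))
  rw [← algebraMap_smul R]
  exact smul_eq_zero_of_mem_maximalIdeal
    (hf.algebraMap_mem_maximalIdeal (MvPolynomial.mem_map_C_iff.1 h e)) _

/-- The support variety of a complete resolution of the residue field is the whole space. -/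
theorem IsCompleteResolution.supportVariety_eq_univ {Q : Type u} [CommRing Q] [IsRegularLocalRing Q]
    [Algebra Q R] {f : Fin c → Q} (hf : IsCompleteIntersection f R) {D : Ktac R}
    (hD : IsCompleteResolution D (ModuleCat.of R (ResidueField R))) :
    supportVariety hf D D = Set.univ := by
  refine Set.eq_univ_of_forall fun b => ?_
  by_cases hb : b = 0
  · subst hb
    exact zero_mem_supportVariety hf D D
  by_contra hmem
  obtain ⟨M⟩ := Model.exists_model hf D
  obtain ⟨l, -⟩ := exists_apply_ne_zero hb
  -- A missing point `b` makes `ψ • 1`, with `ψ(b) = 1`, null-homotopic on a model of `D`. The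
  -- contradiction comes from the action of `ψ` on one class, computed with the Koszul
  -- factorization.
  obtain ⟨ψ, Y, hψ, hY⟩ :=
    Model.ContractibleAt.exists_homotopy ((Model.contractibleAt_or M M hb hmem).elim id id)
  let q : Q →ₗ[Q] ResidueField R := Algebra.linearMap Q (ResidueField R)
  obtain ⟨ι, _, _, deg, K, ε, hK, hε, hKm⟩ := exists_koszul_residueField hf.mem_sq
    (ResidueField R) q hf.residue_surjective (by
      ext a
      rw [← hf.ker_residue]
      rfl)
  have hE := isResolution_contractionComplex hf hK hε
  obtain ⟨θ, hθ, p₀, hp₀⟩ := hD.exists_comparison hE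
    (fun n => by
      change Module.Free R (Position c deg n → R)
      infer_instance)
    (fun n => by
      change Module.Finite R (Position c deg n → R)
      infer_instance)
  let θK : ∀ n, D.complex.X n →ₗ[R] (Position c deg n → R) := θ
  have hθK : IsChainFamily K D.complex θK := fun i j hij x =>
    (contractionComplex_d_apply hK hf.algebraMap_eq_zero hij _).symm.trans (hθ i j hij x)
  obtain ⟨i₀, hi₀⟩ : ∃ i, ε i ≠ 0 := by
    by_contra! h
    have h1 := hε.span_eps
    rw [show ε = 0 from funext h] at h1
    have h2 : Submodule.span Q (Set.range (0 : ι → ResidueField R)) = ⊥ := by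
      rw [Submodule.span_eq_bot]
      rintro _ ⟨i, rfl⟩
      rfl
    exact bot_ne_top (h2.symm.trans h1)
  have hdeg : deg i₀ = 0 := hε.eps_deg i₀ hi₀
  -- The exponent `r` puts the class in a negative degree below the bound `p₀` under which
  -- coboundaries on `D` are coboundaries on the Koszul side.
  obtain ⟨r, hr, hr0⟩ : ∃ r : ℕ, -(2 * r : ℤ) < p₀ ∧ 0 < r := ⟨(-p₀).toNat + 1, by omega, by omega⟩
  let ν : Unit → ResidueField R := fun _ => 1
  have hν : Submodule.span Q (Set.range ν) = ⊤ := by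
    refine eq_top_iff.2 fun x _ => ?_
    obtain ⟨a, ha⟩ := hf.residue_surjective x
    have : x = a • ν () := by
      rw [Algebra.smul_def]
      exact ha.symm.trans (mul_one _).symm
    rw [this]
    exact Submodule.smul_mem _ _ (Submodule.subset_span ⟨(), rfl⟩)
  -- The class is `χₗʳ` on a basis element over which `ε` is nonzero. It is a cocycle because all
  -- coefficients of `K` lie in `𝔪`.
  let X : Matrix Unit ι (MvPolynomial (Fin c) Q) :=
    Matrix.of fun _ i => if i = i₀ then MvPolynomial.monomial (Finsupp.single l r) 1 else 0
  have hXK : IsNull ν (X * K) := hf.isNull_mul_of_mem hKm ν X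
  let n : ℤ := -(2 * r : ℤ)
  have hXn : ∀ m, m ≠ n → rowDegree R deg ν X m = 0 := by
    intro m hm
    refine (rowDegree_eq_iff X m 0).2 fun x => Finset.sum_eq_zero fun k _ => ?_
    have hx := x.2
    by_cases hx1 : x.1.1 = i₀
    · change (if x.1.1 = i₀ then MvPolynomial.monomial (Finsupp.single l r) (1 : Q) else 0).coeff
        x.1.2 • ν k = 0
      rw [if_pos hx1, MvPolynomial.coeff_monomial, if_neg, zero_smul]
      intro h0
      refine hm ?_
      rw [← h0, hx1, hdeg, Finsupp.degree_single] at hx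
      push_cast at hx
      omega
    · change (if x.1.1 = i₀ then MvPolynomial.monomial (Finsupp.single l r) (1 : Q) else 0).coeff
        x.1.2 • ν k = 0
      rw [if_neg hx1, MvPolynomial.coeff_zero, zero_smul]
  have hker : ∀ (Z : Matrix Unit ι (MvPolynomial (Fin c) Q)) (i j : ℤ), i + 1 = j → ∀ z,
      rowDegree R deg ν Z j (contractDegree R deg K i j z) = 0 := fun Z =>
    (isNull_mul_iff hK.isHomogeneousOfDegree Z).1 (hf.isNull_mul_of_mem hKm ν Z)
  -- The cocycle on `D` induced by `X` is carried to the model, where the contraction is available.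
  obtain ⟨g, hg, hg'⟩ := M.exists_cocycle (ResidueField R) (n - 1) n (by ring) (by omega)
    (rowDegree R deg ν X n ∘ₗ θK n) (fun x => by
      rw [LinearMap.comp_apply, ← hθK _ _ (by ring)]
      exact hker X _ _ (by ring) _)
  obtain ⟨Z, hZ, hZ'⟩ := exists_rowDegree_eq (c := c) (deg := M.deg) (R := R) hν n g
  have hZM : IsNull ν (Z * M.matrix) := by
    refine (isNull_mul_iff (R := R) M.isMatrixFactorization.isHomogeneousOfDegree Z).2 ?_
    intro i j hij z
    by_cases hj : j = n
    · subst hj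
      obtain rfl : i = n - 1 := by omega
      rw [hZ]
      exact hg z
    · rw [hZ' _ hj]
      rfl
  have hZX : IsEquivalent M.θ θK ν Z X := by
    intro p
    by_cases hp : p = n
    · subst hp
      rw [hZ]
      have := hg'.neg
      rwa [neg_sub] at this
    · rw [hZ' _ hp, hXn _ hp, LinearMap.zero_comp, LinearMap.zero_comp, sub_zero]
      exact IsCoboundary.zero _ _
  have hψZ : ∀ p, IsCoboundary D.complex p (rowDegree R M.deg ν (ψ • Z) p ∘ₗ M.θ p) := by
    intro p
    -- The homotopy exhibits `ψ Z` as the coboundary of `Z Y`, up to a null matrix.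
    have e : ψ • Z - Z * Y * M.matrix = Z * M.matrix * Y := by
      rw [sub_eq_iff_eq_add, Matrix.mul_assoc, Matrix.mul_assoc, ← Matrix.mul_add, hY,
        Matrix.mul_smul, Matrix.mul_one]
    refine ⟨p + 1, rfl, rowDegree R M.deg ν (Z * Y) (p + 1) ∘ₗ M.θ _, fun x => ?_⟩
    have h1 := LinearMap.congr_fun ((isNull_iff_rowDegree (R := R) (deg := M.deg) _).1
      (e ▸ hZM.mul Y) p) (M.θ _ x)
    rw [rowDegree_sub, LinearMap.sub_apply, LinearMap.zero_apply, sub_eq_zero,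
      rowDegree_mul (Z * Y) M.isMatrixFactorization.isHomogeneousOfDegree rfl,
      M.isChainFamily _ _ rfl] at h1
    exact h1
  have hψX : ∀ p, IsCoboundary D.complex p (rowDegree R deg ν (ψ • X) p ∘ₗ θK p) := by
    intro p
    have h := (hψZ p).add (hZX.smul hf D.property M.isMatrixFactorization M.isChainFamily hK hθK hZM
      hXK ψ p).neg
    rw [neg_sub, add_sub_cancel] at h
    exact h
  -- On the Koszul side a coboundary is a functional composed with a differential of values in `𝔪`,
  -- hence zero in `k`.
  have hzero : ∀ p < p₀, rowDegree R deg ν (ψ • X) p = 0 := by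
    intro p hp
    obtain ⟨_, rfl, v, hv⟩ := hp₀ (ResidueField R) (p - 1) p (p + 1) (by ring) rfl hp
      (rowDegree R deg ν (ψ • X) p)
      (fun z => (congrArg _ (contractionComplex_d_apply hK hf.algebraMap_eq_zero (by ring) z)).trans
        (hker _ _ _ (by ring) z)) (hψX p)
    refine LinearMap.ext fun z => (hv z).trans ?_
    refine (congrArg v (contractionComplex_d_apply hK hf.algebraMap_eq_zero rfl z)).trans ?_
    exact eq_zero_of_forall_mem_maximalIdeal (P := Position c deg (p + 1)) v _
      (hf.contractDegree_mem hKm p (p + 1) z)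
  -- Since `ψ(b) = 1`, not all coefficients of `ψ` lie in the maximal ideal.
  obtain ⟨e, he⟩ : ∃ e, residue R (algebraMap Q R (ψ.coeff e)) ≠ 0 := by
    by_contra! h
    refine one_ne_zero (hψ.symm.trans ?_)
    rw [evalAt, MvPolynomial.coe_eval₂Hom, MvPolynomial.eval₂_eq]
    exact Finset.sum_eq_zero fun e _ => by
      rw [RingHom.comp_apply, h, zero_mul]
  -- Multiplication by `χₗʳ` moves the exponent `e` to this position, where the functional of `ψ X`
  -- returns the nonzero coefficient.
  let x : Position c deg (-((2 * (e + Finsupp.single l r).degree + deg i₀ : ℕ) : ℤ)) :=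
    ⟨(i₀, e + Finsupp.single l r), (neg_neg _).symm⟩
  have h0 := (rowDegree_eq_iff (ψ • X) _ 0).1 (hzero _ (by
    rw [map_add, Finsupp.degree_single]
    push_cast
    omega)) x
  refine he (Eq.trans ?_ h0)
  change _ = ∑ k : Unit, (ψ * if i₀ = i₀ then MvPolynomial.monomial (Finsupp.single l r) (1 : Q)
    else 0).coeff (e + Finsupp.single l r) • (1 : ResidueField R)
  rw [if_pos rfl, Fintype.sum_unique, MvPolynomial.coeff_mul_monomial, mul_one, Algebra.smul_def,
    mul_one]
  rfl

end ResidueField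

end TotallyAcyclicVariety

theorem theorem6p2 {Q : Type u} [CommRing Q] [IsRegularLocalRing Q] {R : Type u} [CommRing R]
    [IsLocalRing R] [Algebra Q R] [IsAlgClosed (IsLocalRing.ResidueField R)] {c : ℕ} (f : Fin c → Q)
    (hf : TotallyAcyclicVariety.IsCompleteIntersection f R) :
    (∀ D : TotallyAcyclicVariety.Ktac R,
      TotallyAcyclicVariety.IsCompleteResolution D
        (ModuleCat.of R (IsLocalRing.ResidueField R)) →
      TotallyAcyclicVariety.supportVariety hf D D = Set.univ) ∧
    (∀ C D : TotallyAcyclicVariety.Ktac R,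
      TotallyAcyclicVariety.supportVariety hf C D =
        TotallyAcyclicVariety.supportVariety hf C C ∩
          TotallyAcyclicVariety.supportVariety hf D D) ∧
    (∀ C D : TotallyAcyclicVariety.Ktac R,
      TotallyAcyclicVariety.IsCompleteResolution D
        (ModuleCat.of R (IsLocalRing.ResidueField R)) →
      TotallyAcyclicVariety.supportVariety hf C D =
        TotallyAcyclicVariety.supportVariety hf C C) ∧
    (∀ C C' C'' D : TotallyAcyclicVariety.Ktac R,
      TotallyAcyclicVariety.IsExactTriangle C C' C'' →
      TotallyAcyclicVariety.supportVariety hf C D ⊆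
        TotallyAcyclicVariety.supportVariety hf C' D ∪
          TotallyAcyclicVariety.supportVariety hf C'' D ∧
      TotallyAcyclicVariety.supportVariety hf C' D ⊆
        TotallyAcyclicVariety.supportVariety hf C D ∪
          TotallyAcyclicVariety.supportVariety hf C'' D ∧
      TotallyAcyclicVariety.supportVariety hf C'' D ⊆
        TotallyAcyclicVariety.supportVariety hf C D ∪
          TotallyAcyclicVariety.supportVariety hf C' D) ∧
    (∀ C D D' D'' : TotallyAcyclicVariety.Ktac R,
      TotallyAcyclicVariety.IsExactTriangle D D' D'' →
      TotallyAcyclicVariety.supportVariety hf C D ⊆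
        TotallyAcyclicVariety.supportVariety hf C D' ∪
          TotallyAcyclicVariety.supportVariety hf C D'' ∧
      TotallyAcyclicVariety.supportVariety hf C D' ⊆
        TotallyAcyclicVariety.supportVariety hf C D ∪
          TotallyAcyclicVariety.supportVariety hf C D'' ∧
      TotallyAcyclicVariety.supportVariety hf C D'' ⊆
        TotallyAcyclicVariety.supportVariety hf C D ∪
          TotallyAcyclicVariety.supportVariety hf C D') :=
  ⟨fun _ hD => hD.supportVariety_eq_univ hf,
    TotallyAcyclicVariety.supportVariety_eq_inter hf,
    fun C D hD => by
      rw [TotallyAcyclicVariety.supportVariety_eq_inter, hD.supportVariety_eq_univ hf,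
        Set.inter_univ],
    fun _ _ _ _ h => h.supportVariety_subset' hf,
    fun _ _ _ _ h => h.supportVariety_subset hf⟩
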